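/- A signature of length $N$ is a tuple of integers $\lambda=(\lambda_1\ge\dots\ge\lambda_N)$; $\mathbb{GT}_N$ is the set of all of them, and $s_\lambda(x_1,\dots,x_N)=\det[x_i^{\lambda_j+N-j}]/\prod_{i<j}(x_i-x_j)$ is the (Laurent polynomial) Schur function. The Schur generating function of a probability measure $\rho$ on $\mathbb{GT}_N$ is $S_\rho(x_1,\dots,x_N)=\sum_{\lambda\in\mathbb{GT}_N}\rho(\lambda)\,s_\lambda(x_1,\dots,x_N)/s_\lambda(1,\dots,1)$, where it is assumed that the sum converges (absolutely) in a complex neighbourhood of $(1,\dots,1)$. The empirical measure of $\rho$ is the random measure $m[\rho]=\frac1N\sum_{i=1}^N\delta\big(\frac{\lambda_i+N-i}{N}\big)$, where $\lambda$ is $\rho$-distributed. **Proposition.** Let $\mathcal B$ be a probability distribution on $\mathbb R$ with finite moments of all orders, let $\mathbf b$ be a random variable with distribution $\mathcal B$, and let $M_N\in\mathbb Z_{\ge0}$ satisfy $\lim_{N\to\infty}M_N/N=a\in\mathbb R_{>0}$. Let $\rho_N$, $N\ge1$, be probability measures on $\mathbb{GT}_N$ whose Schur generating functions are, near $(1,\dots,1)$,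 $$S_{\rho_N}(x_1,\dots,x_N)=\Big(\mathbf E_{\mathcal B}\prod_{i=1}^N(1-\mathbf b+x_i\mathbf b)\Big)^{M_N},\qquad N\ge1.$$ Put $$\mathcal F(z)=\frac{z}{z-1}+a\,z\,\mathbf E_{\mathcal B}\frac{\mathbf b}{1-\mathbf b+\mathbf b z}.$$ Then $\mathbf b/(1-\mathbf b+\mathbf bz)$ is integrable for $|z-1|<1$, and $\mathcal F$ is analytic in $0<|z-1|<1$. Moreover, as $N\to\infty$, the random measures $m[\rho_N]$ converge in probability, in the sense of moments, to a deterministic probability measure $\boldsymbol\mu$ on $\mathbb R$; that is, all moments of $\boldsymbol\mu$ are finite, and each moment of $m[\rho_N]$ converges in probability to the corresponding moment of $\boldsymbol\mu$. The moments of $\boldsymbol\mu$ are, for every $k\ge1$, $$\boldsymbol\mu_k=\frac{1}{2\pi\sqrt{-1}\,(k+1)}\oint_{\mathcal C_1}\frac{dz}{z}\,\mathcal F(z)^{k+1},$$ where $\mathcal C_1$ is any counterclockwise circle around $z=1$ (not necessarily centred at $1$) such that the integrand has no singularity other than $z=1$ on or inside it. -/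

import Mathlib

open MeasureTheory Filter Topology

/-- A signature of length `N`: a non-increasing `N`-tuple of integers
(indexed by `0, …, N - 1`). -/
structure Signature (N : ℕ) where
  part : Fin N → ℤ
  antitone_part : Antitone part

/-- Signatures form a discrete measurable space. -/
instance (N : ℕ) : MeasurableSpace (Signature N) := ⊤

/-- The Vandermonde product `∏_{i < j} (x_i - x_j)`. -/
def vandermondeProd {R : Type*} [CommRing R] {N : ℕ} (x : Fin N → R) : R :=
  ∏ p ∈ Finset.univ.filter (fun p : Fin N × Fin N => p.1 < p.2), (x p.1 - x p.2)

theorem irreducible_X_sub_X {N : ℕ} {i j : Fin N} (h : i ≠ j) :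
    Irreducible (MvPolynomial.X i - MvPolynomial.X j : MvPolynomial (Fin N) ℂ) := by
  have := MvPolynomial.irreducible_mul_X_add (1 : MvPolynomial (Fin N) ℂ)
    (-MvPolynomial.X j) i one_ne_zero (by simp) (by simpa using h)
    isRelPrime_one_left
  simpa [sub_eq_add_neg] using this

/-- The Vandermonde product divides every alternant `det [X_i ^ (e_j)]`. -/
theorem vandermondeProd_dvd_det {N : ℕ} (e : Fin N → ℕ) :
    vandermondeProd (fun i => (MvPolynomial.X i : MvPolynomial (Fin N) ℂ)) ∣
      (Matrix.of fun i j : Fin N => (MvPolynomial.X i : MvPolynomial (Fin N) ℂ) ^ e j).det := by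
  classical
  refine Finset.prod_dvd_of_isRelPrime ?_ ?_
  · rintro ⟨i, j⟩ hij ⟨k, l⟩ hkl hne
    simp only [Finset.coe_filter, Finset.mem_univ, true_and, Set.mem_ofPred_eq] at hij hkl
    refine (irreducible_X_sub_X hij.ne).isRelPrime_iff_not_dvd.mpr ?_
    have key : ∀ f : Fin N → ℂ, f i = f j → f k ≠ f l →
        ¬ (MvPolynomial.X i - MvPolynomial.X j : MvPolynomial (Fin N) ℂ) ∣
          MvPolynomial.X k - MvPolynomial.X l := by
      rintro f h1 h2 ⟨q, hq⟩
      have := congrArg (MvPolynomial.eval f) hq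
      simp [h1] at this
      exact h2 (sub_eq_zero.mp this)
    by_cases hk : k = i ∨ k = j
    · have hl : l ≠ i ∧ l ≠ j := by
        have : ¬ (i = k ∧ j = l) := fun h => hne (by rw [h.1, h.2])
        constructor <;> rintro rfl <;> rcases hk with rfl | rfl <;>
          first | exact absurd hkl (lt_irrefl _) | exact absurd hkl (not_lt.mpr hij.le) | simp at this
      refine key (fun x => if x = l then 1 else 0) ?_ ?_
      · simp [hl.1.symm, hl.2.symm]
      · simp [hkl.ne]
    · push Not at hk
      refine key (fun x => if x = k then 1 else 0) ?_ ?_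
      · simp [hk.1.symm, hk.2.symm]
      · simp [hkl.ne']
  · rintro ⟨i, j⟩ hij
    simp only [Finset.mem_filter, Finset.mem_univ, true_and] at hij
    rw [← Matrix.det_updateRow_add_smul_self _ hij.ne (-1 : MvPolynomial (Fin N) ℂ),
      Matrix.det_apply]
    refine Finset.dvd_sum fun σ _ => ?_
    refine dvd_smul_of_dvd _ ?_
    refine dvd_trans ?_ (Finset.dvd_prod_of_mem _ (Finset.mem_univ (σ⁻¹ i)))
    simpa [sub_eq_add_neg] using sub_dvd_pow_sub_pow
      (MvPolynomial.X i : MvPolynomial (Fin N) ℂ) (MvPolynomial.X j) (e (σ⁻¹ i))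

/-- The polynomial `det [X_i ^ (e_j)] / ∏_{i < j} (X_i - X_j)`. -/
noncomputable def alternantQuotient {N : ℕ} (e : Fin N → ℕ) : MvPolynomial (Fin N) ℂ :=
  Classical.choose (vandermondeProd_dvd_det e)

theorem alternantQuotient_spec {N : ℕ} (e : Fin N → ℕ) :
    (Matrix.of fun i j : Fin N => (MvPolynomial.X i : MvPolynomial (Fin N) ℂ) ^ e j).det =
      vandermondeProd (fun i => (MvPolynomial.X i : MvPolynomial (Fin N) ℂ)) *
        alternantQuotient e :=
  Classical.choose_spec (vandermondeProd_dvd_det e)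

namespace Signature

/-- The auxiliary natural number `∑ |λ_j|`; adding it to all parts makes them nonnegative. -/
def shift {N : ℕ} (lam : Signature N) : ℕ := ∑ j, (lam.part j).natAbs

/-- The Schur function `s_λ(x_1, …, x_N)`, as a function of nonzero complex variables: the Laurent
polynomial `det [x_i ^ (λ_j + N - j)] / ∏_{i < j} (x_i - x_j)` (with `j` counted from `1`).
Negative exponents are cleared by the factor `(x_1 ⋯ x_N) ^ m`, `m = lam.shift`; see
`schur_mul_vandermondeProd` for the defining identity. -/
noncomputable def schur {N : ℕ} (lam : Signature N) (x : Fin N → ℂ) : ℂ :=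
  (∏ i, x i) ^ (-(lam.shift : ℤ)) *
    MvPolynomial.eval x
      (alternantQuotient fun j => (lam.part j + lam.shift + (N - 1 - (j : ℤ))).toNat)

theorem schur_mul_vandermondeProd {N : ℕ} (lam : Signature N) (x : Fin N → ℂ)
    (hx : ∀ i, x i ≠ 0) :
    lam.schur x * vandermondeProd x =
      (Matrix.of fun i j : Fin N => x i ^ (lam.part j + (N - 1 - (j : ℤ)))).det := by
  set e : Fin N → ℕ := fun j => (lam.part j + lam.shift + (N - 1 - (j : ℤ))).toNat with he
  have hej : ∀ j, (e j : ℤ) = lam.part j + (N - 1 - (j : ℤ)) + lam.shift := by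
    intro j
    have h1 : (lam.part j).natAbs ≤ lam.shift :=
      Finset.single_le_sum (f := fun j => (lam.part j).natAbs)
        (fun _ _ => Nat.zero_le _) (Finset.mem_univ j)
    have h2 := j.2
    simp only [he]
    omega
  have h := congrArg (MvPolynomial.eval x) (alternantQuotient_spec e)
  rw [RingHom.map_det, map_mul] at h
  have hv : MvPolynomial.eval x
      (vandermondeProd fun i => (MvPolynomial.X i : MvPolynomial (Fin N) ℂ)) =
        vandermondeProd x := by
    simp [vandermondeProd, map_prod]
  have hd : (MvPolynomial.eval x).mapMatrix
      (Matrix.of fun i j : Fin N => (MvPolynomial.X i : MvPolynomial (Fin N) ℂ) ^ e j) =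
      Matrix.of fun i j => x i ^ (lam.shift : ℤ) *
        (Matrix.of fun i j : Fin N => x i ^ (lam.part j + (N - 1 - (j : ℤ)))) i j := by
    ext i j
    simp only [RingHom.mapMatrix_apply, Matrix.map_apply, Matrix.of_apply, map_pow,
      MvPolynomial.eval_X]
    rw [← zpow_natCast (x i) (e j), hej, zpow_add₀ (hx i), mul_comm]
  rw [hd, hv, Matrix.det_mul_column, Finset.prod_zpow] at h
  have hp : (∏ i, x i) ≠ 0 := Finset.prod_ne_zero_iff.mpr fun i _ => hx i
  have hz : (∏ i, x i) ^ (-(lam.shift : ℤ)) * (∏ i, x i) ^ (lam.shift : ℤ) = 1 := by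
    rw [← zpow_add₀ hp]; simp
  calc lam.schur x * vandermondeProd x
      = (∏ i, x i) ^ (-(lam.shift : ℤ)) *
          (vandermondeProd x * MvPolynomial.eval x (alternantQuotient e)) := by
        simp only [schur, he]; ring
    _ = _ := by rw [← h, ← mul_assoc, hz, one_mul]

/-- The empirical measure `(1 / N) ∑_i δ((λ_i + N - i) / N)` (with `i` counted from `1`). -/
noncomputable def empiricalMeasure {N : ℕ} (lam : Signature N) : Measure ℝ :=
  (N : ENNReal)⁻¹ • ∑ i : Fin N, Measure.dirac (((lam.part i : ℝ) + (N - 1 - (i : ℝ))) / N)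

end Signature

/-- `S` is the Schur generating function of `ρ`: on a neighbourhood of `(1, …, 1)` in `ℂ ^ N`
the series `∑_λ ρ(λ) s_λ(x) / s_λ(1, …, 1)` converges, with sum `S x`. -/
def HasSchurGeneratingFunction {N : ℕ} (ρ : Measure (Signature N))
    (S : (Fin N → ℂ) → ℂ) : Prop :=
  ∀ᶠ x in 𝓝 (1 : Fin N → ℂ),
    HasSum (fun lam : Signature N => (ρ.real {lam} : ℂ) * (lam.schur x / lam.schur 1)) (S x)

/-- The random measures `m[ρ_N]` converge in probability, in the sense of moments, to the
deterministic measure `μ`: all moments of `μ` are finite, and each moment of the empirical measure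
of a `ρ_N`-distributed signature converges in probability to that of `μ`. -/
def EmpiricalTendstoInMoments (ρ : ∀ N, Measure (Signature N)) (μ : Measure ℝ) : Prop :=
  (∀ k : ℕ, Integrable (fun x : ℝ => x ^ k) μ) ∧
  ∀ k : ℕ, ∀ ε : ℝ, 0 < ε →
    Tendsto (fun N => ρ N {lam : Signature N |
      ε ≤ |(∫ x, x ^ k ∂lam.empiricalMeasure) - ∫ x, x ^ k ∂μ|}) atTop (𝓝 0)

/-- `𝓕(z) = z / (z - 1) + a z E[b / (1 - b + b z)]`, where `b` has distribution `B`. -/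
noncomputable def limitF (a : ℝ) (B : Measure ℝ) (z : ℂ) : ℂ :=
  z / (z - 1) + a * z * ∫ b, (b : ℂ) / (1 - b + b * z) ∂B

/-!
Write `l_j = λ_j + N - j`.

The Schur function times the Vandermonde product is an alternant, and the operator
`f ↦ ∑ i, f (x with x_i replaced by q x_i)` multiplies that alternant by `∑ j, q ^ l_j`. Applying
the operator once or twice to the Schur generating function times the Vandermonde product, writing
the sums over `i` as residue sums and letting `x → (1, …, 1)` gives exact contour integrals for the expectations of
`∑ j, q ^ l_j` and of its square (`sum_psum_eq_circleIntegral`, `sum_psum_sq_eq_circleIntegral`).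

Nothing beyond convergence near `(1, …, 1)` is assumed, so the positivity of the law has to provide
the remaining control. On the diagonal `x_i = e ^ s`, and on the principal specialization
`x_i = e ^ ((N - i) s)` after clearing a denominator, the generating function becomes a series of
exponentials with nonnegative coefficients whose sum is a polynomial in `e ^ s`. Such a series
converges on the whole imaginary axis (`hasSum_exp_imaginary`) and has only exponents between `0`
and the degree (`exponent_mem_of_hasSum_exp`). The value at `x = (-1, …, -1)` forces `b ∈ [0, 1]`
almost surely (`ae_mem_Icc_of_schurGeneratingFunction`), and the exponents force `ρ_N` to have
finite support (`finite_support`); then the generating function identity, multiplied by the Vandermonde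
product, holds at all nonzero `x` (`sum_alternant_eq`), which is what the shifts need. In the
contour formula, `q → 0` and `q → ∞` give `0 ≤ l_j < N + M_N` (`coord_mem_of_mass_ne_zero`).

With `q = e ^ (t / N)`, the mean over `j` of `q ^ l_j` is the exponential mean
`∫ e ^ (t x) m[ρ_N](dx)`. In the limit `N → ∞` its expectation converges to
`(2πi)⁻¹ ∮ e ^ (t 𝓕(z)) / (t z) dz`, and the expectation of its square to the square of this,
because the factor coupling the two contours tends to `1` (`tendsto_single_contour`,
`tendsto_double_contour`). The exponential means therefore converge in mean square. All measures
live on a fixed compact interval, so the mean empirical measures have a limit point `μ` with these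
exponential means, and approximating `x ^ k` by polynomials in `e ^ x` turns the convergence of
exponential means into convergence of moments in probability (`exists_limit_measure`,
`tendsto_measure_moment_dev`). Comparing coefficients of powers of `t` yields the moment formula on
one circle (`moment_eq_of_exp_integral_eq`), and subtracting the principal part at `1` extends it to
every admissible circle (`circleIntegral_limitF_pow`).
-/

/-! ### Exponential sums with nonnegative weights -/

/-- Identity theorem on a domain through `0`, for functions agreeing on a real interval. -/
theorem analyticOnNhd_eq_of_eventually_real {f g : ℂ → ℂ} {U : Set ℂ}
    (hf : AnalyticOnNhd ℂ f U) (hg : AnalyticOnNhd ℂ g U) (hU : IsPreconnected U)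
    (h0 : (0 : ℂ) ∈ U) (h : ∀ᶠ s : ℝ in 𝓝 0, f s = g s) : Set.EqOn f g U := by
  refine hf.eqOn_of_preconnected_of_frequently_eq hg hU h0 ?_
  have ht : Tendsto (fun s : ℝ => (s : ℂ)) (𝓝[≠] 0) (𝓝[≠] 0) := by
    refine tendsto_nhdsWithin_iff.2 ⟨?_, ?_⟩
    · exact (Complex.continuous_ofReal.tendsto' 0 0 (by simp)).mono_left nhdsWithin_le_nhds
    · filter_upwards [self_mem_nhdsWithin] with s hs
      simpa using hs
  exact ht.frequently (h.filter_mono nhdsWithin_le_nhds).frequently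

/-- An exponential sum with nonnegative weights that agrees on a real interval around `0` with a
polynomial in `exp s` does so on the imaginary axis as well: it is analytic in a vertical strip. -/
theorem hasSum_exp_imaginary {ι : Type*} {w : ι → ℝ} {n : ι → ℤ} {P : Polynomial ℂ}
    (hw : ∀ i, 0 ≤ w i)
    (h : ∀ᶠ s : ℝ in 𝓝 0,
      HasSum (fun i => (w i : ℂ) * Complex.exp (n i * s)) (P.eval (Complex.exp s))) (θ : ℝ) :
    HasSum (fun i => (w i : ℂ) * Complex.exp (n i * (θ * Complex.I)))
      (P.eval (Complex.exp (θ * Complex.I))) := by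
  obtain ⟨δ, hδ, hball⟩ := Metric.eventually_nhds_iff.1 h
  have hreal : ∀ s : ℝ, |s| < δ → Summable fun i => w i * Real.exp (n i * s) := by
    intro s hs
    have := (hball (by simpa using hs)).summable.norm
    refine this.congr fun i => ?_
    rw [norm_mul, Complex.norm_exp, Complex.norm_real, Real.norm_of_nonneg (hw i)]
    simp
  set d := δ / 2 with hd
  have hd0 : 0 < d := by positivity
  set U : Set ℂ := {z | |z.re| < d} with hU
  have hUo : IsOpen U := isOpen_lt (by fun_prop) continuous_const
  have hUc : Convex ℝ U := by
    have : U = Complex.reLm ⁻¹' (Set.Ioo (-d) d) := by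
      ext z; simp [hU, abs_lt]
    rw [this]
    exact (convex_Ioo _ _).linear_preimage _
  set u : ι → ℝ := fun i => w i * Real.exp (n i * d) + w i * Real.exp (n i * (-d : ℝ)) with hu
  have hus : Summable u := by
    refine (hreal d ?_).add (hreal (-d) ?_)
    · rw [abs_of_pos hd0]; linarith
    · rw [abs_neg, abs_of_pos hd0]; linarith
  have hle : ∀ i, ∀ z ∈ U, ‖(w i : ℂ) * Complex.exp (n i * z)‖ ≤ u i := by
    intro i z hz
    rw [norm_mul, Complex.norm_exp, Complex.norm_real, Real.norm_of_nonneg (hw i), hu]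
    have hz' : |z.re| < d := hz
    have hre : ((n i : ℂ) * z).re = n i * z.re := by simp
    rw [hre]
    change _ ≤ w i * Real.exp (n i * d) + w i * Real.exp (n i * (-d : ℝ))
    rw [← mul_add]
    refine mul_le_mul_of_nonneg_left ?_ (hw i)
    obtain ⟨h1, h2⟩ := abs_lt.1 hz'
    rcases le_total 0 (n i : ℝ) with hn | hn
    · have : Real.exp (n i * z.re) ≤ Real.exp (n i * d) :=
        Real.exp_le_exp.2 (mul_le_mul_of_nonneg_left h2.le hn)
      linarith [Real.exp_pos (n i * (-d : ℝ))]
    · have : Real.exp (n i * z.re) ≤ Real.exp (n i * (-d)) :=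
        Real.exp_le_exp.2 (mul_le_mul_of_nonpos_left h1.le hn)
      linarith [Real.exp_pos (n i * d)]
  have hdiff : DifferentiableOn ℂ (fun z : ℂ => ∑' i, (w i : ℂ) * Complex.exp (n i * z)) U :=
    Complex.differentiableOn_tsum_of_summable_norm hus (fun i => by fun_prop) hUo hle
  have hP : DifferentiableOn ℂ (fun z : ℂ => P.eval (Complex.exp z)) U := by
    fun_prop
  have heq := analyticOnNhd_eq_of_eventually_real (hdiff.analyticOnNhd hUo) (hP.analyticOnNhd hUo)
    hUc.isPreconnected (by simp [hU, hd0]) (h.mono fun s hs => hs.tsum_eq)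
  have hmem : (θ * Complex.I : ℂ) ∈ U := by simp [hU, hd0]
  have := heq hmem
  simp only at this
  rw [← this]
  exact (Summable.of_norm_bounded hus fun i => hle i _ hmem).hasSum

/-- Orthogonality of characters on the `L`-th roots of unity. -/
theorem sum_range_exp_div (L : ℕ) (hL : 0 < L) (m : ℤ) :
    ∑ k ∈ Finset.range L, Complex.exp (m * (((2 * Real.pi * k / L : ℝ) : ℂ) * Complex.I)) =
      if (L : ℤ) ∣ m then (L : ℂ) else 0 := by
  have hL' : (L : ℂ) ≠ 0 := by exact_mod_cast hL.ne'
  set η := Complex.exp (m * (2 * Real.pi / L * Complex.I)) with hη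
  have hterm : ∀ k : ℕ, Complex.exp (m * (((2 * Real.pi * k / L : ℝ) : ℂ) * Complex.I)) = η ^ k := by
    intro k
    rw [hη, ← Complex.exp_nat_mul]
    congr 1
    push_cast
    ring
  simp_rw [hterm]
  have hηL : η ^ L = 1 := by
    rw [hη, ← Complex.exp_nat_mul, Complex.exp_eq_one_iff]
    exact ⟨m, by field_simp⟩
  split_ifs with hdvd
  · obtain ⟨c, rfl⟩ := hdvd
    have : η = 1 := by
      rw [hη, Complex.exp_eq_one_iff]
      exact ⟨c, by push_cast; field_simp⟩
    simp [this]
  · have hne : η ≠ 1 := by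
      intro h1
      rw [hη, Complex.exp_eq_one_iff] at h1
      obtain ⟨c, hc⟩ := h1
      apply hdvd
      refine ⟨c, ?_⟩
      have hpi : (2 * Real.pi * Complex.I : ℂ) ≠ 0 := Complex.two_pi_I_ne_zero
      have : (2 * Real.pi * Complex.I : ℂ) * m = (2 * Real.pi * Complex.I) * (L * c) := by
        field_simp at hc
        linear_combination (2 * Real.pi * Complex.I : ℂ) * hc
      have := mul_left_cancel₀ hpi this
      exact_mod_cast this
    rw [geom_sum_eq hne, hηL]; simp

/-- Frequencies carrying positive weight lie between `0` and the degree. The frequency `m` is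
isolated by averaging against `exp (-i m θ)` over the `L`-th roots of unity, `L` large. -/
theorem exponent_mem_of_hasSum_exp {ι : Type*} {w : ι → ℝ} {n : ι → ℤ} {P : Polynomial ℂ}
    (hw : ∀ i, 0 ≤ w i)
    (h : ∀ᶠ s : ℝ in 𝓝 0,
      HasSum (fun i => (w i : ℂ) * Complex.exp (n i * s)) (P.eval (Complex.exp s)))
    {i₀ : ι} (hi₀ : w i₀ ≠ 0) : 0 ≤ n i₀ ∧ n i₀ ≤ P.natDegree := by
  by_contra hcon
  set m := n i₀ with hm
  -- `L` exceeds every `|j - m|` with `j` between `0` and the degree, so no such `j - m` other than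
  -- `0`, which is excluded, is divisible by `L`
  set L : ℕ := m.natAbs + P.natDegree + 1 with hL
  have hL0 : 0 < L := by omega
  have hθ := fun k : ℕ => (hasSum_exp_imaginary hw h (2 * Real.pi * k / L)).mul_right
    (Complex.exp (-m * (((2 * Real.pi * k / L : ℝ) : ℂ) * Complex.I)))
  have hsum := hasSum_sum (s := Finset.range L) fun k _ => hθ k
  have hright : ∑ k ∈ Finset.range L, Polynomial.eval
        (Complex.exp (((2 * Real.pi * k / L : ℝ) : ℂ) * Complex.I)) P *
      Complex.exp (-m * (((2 * Real.pi * k / L : ℝ) : ℂ) * Complex.I)) = 0 := by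
    simp_rw [Polynomial.eval_eq_sum_range, Finset.sum_mul]
    rw [Finset.sum_comm]
    refine Finset.sum_eq_zero fun j hj => ?_
    have : ∀ k ∈ Finset.range L, P.coeff j *
        Complex.exp (((2 * Real.pi * k / L : ℝ) : ℂ) * Complex.I) ^ j *
        Complex.exp (-m * (((2 * Real.pi * k / L : ℝ) : ℂ) * Complex.I)) =
        P.coeff j * Complex.exp (((j - m : ℤ) : ℂ) *
          (((2 * Real.pi * k / L : ℝ) : ℂ) * Complex.I)) := by
      intro k _
      rw [← Complex.exp_nat_mul, mul_assoc, ← Complex.exp_add]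
      congr 2
      push_cast
      ring
    rw [Finset.sum_congr rfl this, ← Finset.mul_sum, sum_range_exp_div L hL0, if_neg, mul_zero]
    intro hd
    have hj' : j ≤ P.natDegree := by simpa [Nat.lt_succ_iff] using hj
    have := Int.eq_zero_of_abs_lt_dvd hd (by rw [abs_lt]; omega)
    omega
  rw [hright] at hsum
  set g : ι → ℝ := fun i => if (L : ℤ) ∣ n i - m then (L : ℝ) else 0 with hg
  have hg0 : ∀ i, 0 ≤ g i := fun i => by simp only [hg]; split_ifs <;> positivity
  have hleft : ∀ i, ∑ k ∈ Finset.range L, (w i : ℂ) *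
        Complex.exp (n i * (((2 * Real.pi * k / L : ℝ) : ℂ) * Complex.I)) *
      Complex.exp (-m * (((2 * Real.pi * k / L : ℝ) : ℂ) * Complex.I)) =
      ((w i * g i : ℝ) : ℂ) := by
    intro i
    have h1 : ((g i : ℝ) : ℂ) = if (L : ℤ) ∣ n i - m then (L : ℂ) else 0 := by
      simp only [hg]; split_ifs <;> simp
    rw [Complex.ofReal_mul, h1, ← sum_range_exp_div L hL0 (n i - m), Finset.mul_sum]
    refine Finset.sum_congr rfl fun k _ => ?_
    rw [mul_assoc, ← Complex.exp_add]
    congr 2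
    push_cast
    ring
  simp_rw [hleft] at hsum
  have hsum' : HasSum (fun i => w i * g i) 0 := by
    rw [← Complex.ofReal_zero] at hsum
    exact Complex.hasSum_ofReal.1 hsum
  have hz := (hasSum_zero_iff_of_nonneg (fun i => mul_nonneg (hw i) (hg0 i))).1 hsum'
  have := congrFun hz i₀
  simp [hg, ← hm, hi₀, hL0.ne'] at this

/-! ### Alternants and principal specializations of Schur functions -/

theorem Signature.part_injective {N : ℕ} :
    Function.Injective (Signature.part : Signature N → Fin N → ℤ) := by
  rintro ⟨p, hp⟩ ⟨q, hq⟩ h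
  simpa using h

instance (N : ℕ) : Countable (Signature N) := Signature.part_injective.countable

instance (N : ℕ) : DiscreteMeasurableSpace (Signature N) := ⟨fun _ => trivial⟩

/-- The strictly decreasing coordinates `λ_j + N - j` (with `j` counted from `1`). -/
def Signature.coord {N : ℕ} (lam : Signature N) (j : Fin N) : ℤ := lam.part j + (N - 1 - (j : ℤ))

theorem Signature.coord_strictAnti {N : ℕ} (lam : Signature N) : StrictAnti lam.coord := by
  intro i j h
  have h1 := lam.antitone_part h.le
  have h2 : (i : ℤ) < j := by exact_mod_cast h
  simp only [Signature.coord]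
  omega

/-- The numerator `det [x_i ^ (λ_j + N - j)]` of the Schur function. -/
noncomputable def Signature.alternant {N : ℕ} (lam : Signature N) (x : Fin N → ℂ) : ℂ :=
  (Matrix.of fun i j : Fin N => x i ^ lam.coord j).det

theorem Signature.schur_mul_vandermonde {N : ℕ} (lam : Signature N) {x : Fin N → ℂ}
    (hx : ∀ i, x i ≠ 0) : lam.schur x * vandermondeProd x = lam.alternant x :=
  lam.schur_mul_vandermondeProd x hx

theorem Signature.continuousAt_schur {N : ℕ} (lam : Signature N) {x : Fin N → ℂ}
    (hx : ∀ i, x i ≠ 0) : ContinuousAt lam.schur x := by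
  unfold Signature.schur
  refine ContinuousAt.mul ?_ (MvPolynomial.continuous_eval _).continuousAt
  refine ContinuousAt.zpow₀ (by fun_prop) _ (Or.inl ?_)
  exact Finset.prod_ne_zero_iff.2 fun i _ => hx i

/-- Index pairs `i < j`. -/
def ltPairs (N : ℕ) : Finset (Fin N × Fin N) :=
  Finset.univ.filter (fun p : Fin N × Fin N => p.1 < p.2)

theorem mem_ltPairs {N : ℕ} {p : Fin N × Fin N} : p ∈ ltPairs N ↔ p.1 < p.2 := by simp [ltPairs]

theorem vandermondeProd_ne_zero {N : ℕ} {x : Fin N → ℂ} (hx : Function.Injective x) :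
    vandermondeProd x ≠ 0 :=
  Finset.prod_ne_zero_iff.2 fun _ hp =>
    sub_ne_zero.2 fun h => (ne_of_lt (mem_ltPairs.1 hp)) (hx h)

/-- The Vandermonde determinant with decreasing exponents. -/
theorem det_pow_rev {N : ℕ} (y : Fin N → ℂ) :
    (Matrix.of fun i j : Fin N => y i ^ (N - 1 - (j : ℕ))).det = vandermondeProd y := by
  have h : (Matrix.of fun i j : Fin N => y i ^ (N - 1 - (j : ℕ))) =
      (Matrix.vandermonde (y ∘ Fin.rev)).submatrix Fin.revPerm Fin.revPerm := by
    ext i j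
    simp only [Matrix.of_apply, Matrix.submatrix_apply, Matrix.vandermonde_apply,
      Function.comp, Fin.revPerm_apply, Fin.rev_rev, Fin.val_rev]
    congr 1
    omega
  rw [h, Matrix.det_submatrix_equiv_self, Matrix.det_vandermonde]
  simp only [vandermondeProd]
  have h2 : ∏ i : Fin N, ∏ j ∈ Finset.Ioi i, ((y ∘ Fin.rev) j - (y ∘ Fin.rev) i) =
      ∏ p ∈ ltPairs N, (y (Fin.rev p.2) - y (Fin.rev p.1)) := by
    unfold ltPairs
    rw [Finset.prod_filter, ← Finset.univ_product_univ, Finset.prod_product]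
    refine Finset.prod_congr rfl fun i _ => ?_
    rw [← Finset.prod_filter]
    refine Finset.prod_congr ?_ fun _ _ => rfl
    ext j; simp
  rw [h2]
  refine Finset.prod_nbij' (fun p => (Fin.rev p.2, Fin.rev p.1))
    (fun p => (Fin.rev p.2, Fin.rev p.1)) ?_ ?_ ?_ ?_ ?_ <;> simp [mem_ltPairs]

/-- The principal specialization `(e ^ ((N - 1) s), …, e ^ s, 1)`: a curve of points with distinct
coordinates that tends to `(1, …, 1)` as `s → 0`. -/
noncomputable def principalPoint (N : ℕ) (s : ℂ) : Fin N → ℂ :=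
  fun i => Complex.exp (((N - 1 - (i : ℕ) : ℕ) : ℂ) * s)

theorem principalPoint_zero (N : ℕ) : principalPoint N 0 = 1 := by
  ext i; simp [principalPoint]

theorem continuous_principalPoint (N : ℕ) : Continuous (principalPoint N) := by
  unfold principalPoint
  fun_prop

theorem principalPoint_ne_zero {N : ℕ} (s : ℂ) (i : Fin N) : principalPoint N s i ≠ 0 :=
  Complex.exp_ne_zero _

/-- `∑ e ^ (n s)` over the integers `a ≤ n < b`. -/
noncomputable def expGeomSum (a b : ℤ) (s : ℂ) : ℂ := ∑ n ∈ Finset.Ico a b, Complex.exp (n * s)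

theorem exp_sub_one_mul_expGeomSum {a b : ℤ} (hab : a ≤ b) (s : ℂ) :
    (Complex.exp s - 1) * expGeomSum a b s = Complex.exp (b * s) - Complex.exp (a * s) := by
  induction b, hab using Int.leInduction with
  | base => simp [expGeomSum]
  | succ b hab ih =>
    have : expGeomSum a (b + 1) s = expGeomSum a b s + Complex.exp (b * s) := by
      unfold expGeomSum
      have h : Finset.Ico a (b + 1) = insert b (Finset.Ico a b) := by
        ext n; simp only [Finset.mem_Ico, Finset.mem_insert]; omega
      rw [h, Finset.sum_insert (by simp), add_comm]
    rw [this, mul_add, ih]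
    push_cast
    rw [add_mul, Complex.exp_add, one_mul]
    ring

theorem expGeomSum_zero {a b : ℤ} : expGeomSum a b 0 = ((b - a).toNat : ℂ) := by
  simp [expGeomSum]

theorem continuous_expGeomSum (a b : ℤ) : Continuous (expGeomSum a b) := by
  unfold expGeomSum
  fun_prop

theorem injective_principalPoint {N : ℕ} {s : ℝ} (hs : s ≠ 0) :
    Function.Injective (principalPoint N s) := by
  intro i j h
  simp only [principalPoint] at h
  have h' : Real.exp (((N - 1 - (i : ℕ) : ℕ) : ℝ) * s) = Real.exp (((N - 1 - (j : ℕ) : ℕ) : ℝ) * s) := by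
    exact_mod_cast h
  have h2 := mul_right_cancel₀ hs (Real.exp_injective h')
  have h3 : N - 1 - (i : ℕ) = N - 1 - (j : ℕ) := by exact_mod_cast h2
  ext
  omega

/-- On the principal specialization an alternant is itself a Vandermonde product, by transposition
of the matrix. -/
theorem Signature.alternant_principalPoint {N : ℕ} (lam : Signature N) (s : ℂ) :
    lam.alternant (principalPoint N s) =
      vandermondeProd (fun j => Complex.exp (lam.coord j * s)) := by
  rw [← det_pow_rev, ← Matrix.det_transpose, Signature.alternant]
  congr 1
  ext i j
  simp only [Matrix.transpose_apply, Matrix.of_apply, principalPoint]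
  rw [← Complex.exp_int_mul, ← Complex.exp_nat_mul]
  congr 1
  ring

theorem vandermondeProd_exp_eq {N : ℕ} {l : Fin N → ℤ} (hl : Antitone l) (s : ℂ) :
    vandermondeProd (fun j => Complex.exp (l j * s)) =
      (Complex.exp s - 1) ^ (ltPairs N).card * ∏ p ∈ ltPairs N, expGeomSum (l p.2) (l p.1) s := by
  rw [← Finset.prod_const, ← Finset.prod_mul_distrib]
  refine Finset.prod_congr rfl fun p hp => ?_
  rw [exp_sub_one_mul_expGeomSum (hl (mem_ltPairs.1 hp).le)]

/-- The product formula for principal specializations, in division-free form. At `s = 0` it is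
Weyl's dimension formula. -/
theorem Signature.schur_principalPoint_mul {N : ℕ} (lam : Signature N) (s : ℝ) :
    lam.schur (principalPoint N s) *
        ∏ p ∈ ltPairs N, expGeomSum ((N - 1 - (p.2 : ℕ) : ℕ) : ℤ) ((N - 1 - (p.1 : ℕ) : ℕ) : ℤ) s =
      ∏ p ∈ ltPairs N, expGeomSum (lam.coord p.2) (lam.coord p.1) s := by
  have hne : ∀ s : ℝ, s ≠ 0 → lam.schur (principalPoint N s) *
        ∏ p ∈ ltPairs N, expGeomSum ((N - 1 - (p.2 : ℕ) : ℕ) : ℤ) ((N - 1 - (p.1 : ℕ) : ℕ) : ℤ) s =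
      ∏ p ∈ ltPairs N, expGeomSum (lam.coord p.2) (lam.coord p.1) s := by
    intro s hs
    have h := lam.schur_mul_vandermonde (x := principalPoint N s) (principalPoint_ne_zero _)
    rw [lam.alternant_principalPoint, vandermondeProd_exp_eq lam.coord_strictAnti.antitone] at h
    have h2 : vandermondeProd (principalPoint N s) = (Complex.exp s - 1) ^ (ltPairs N).card *
        ∏ p ∈ ltPairs N, expGeomSum ((N - 1 - (p.2 : ℕ) : ℕ) : ℤ) ((N - 1 - (p.1 : ℕ) : ℕ) : ℤ) s := by
      rw [← vandermondeProd_exp_eq (l := fun j : Fin N => ((N - 1 - (j : ℕ) : ℕ) : ℤ))]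
      · simp
        rfl
      · intro i j hij
        have : (i : ℕ) ≤ j := hij
        simp only
        omega
    rw [h2] at h
    have hE : (Complex.exp s - 1) ^ (ltPairs N).card ≠ 0 := by
      refine pow_ne_zero _ (sub_ne_zero.2 fun h => hs ?_)
      have : Real.exp s = 1 := by exact_mod_cast h
      simpa using this
    refine mul_left_cancel₀ hE ?_
    linear_combination h
  by_cases hs : s = 0
  · subst hs
    have hc : ContinuousAt (fun s : ℝ => lam.schur (principalPoint N s) *
        ∏ p ∈ ltPairs N, expGeomSum ((N - 1 - (p.2 : ℕ) : ℕ) : ℤ) ((N - 1 - (p.1 : ℕ) : ℕ) : ℤ) s)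
          0 := by
      refine ContinuousAt.mul ?_ ?_
      · refine ContinuousAt.comp (g := lam.schur) (f := fun s : ℝ => principalPoint N s)
          (lam.continuousAt_schur (principalPoint_ne_zero _)) ?_
        exact ((continuous_principalPoint N).comp Complex.continuous_ofReal).continuousAt
      · refine (continuous_finsetProd _ fun p _ => ?_).continuousAt
        exact (continuous_expGeomSum _ _).comp Complex.continuous_ofReal
    have hc2 : ContinuousAt (fun s : ℝ =>
        ∏ p ∈ ltPairs N, expGeomSum (lam.coord p.2) (lam.coord p.1) s) 0 := by
      refine (continuous_finsetProd _ fun p _ => ?_).continuousAt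
      exact (continuous_expGeomSum _ _).comp Complex.continuous_ofReal
    refine tendsto_nhds_unique (hc.tendsto.mono_left nhdsWithin_le_nhds)
      ((hc2.tendsto.mono_left (nhdsWithin_le_nhds (s := {0}ᶜ))).congr' ?_)
    filter_upwards [self_mem_nhdsWithin] with s hs
    exact (hne s hs).symm
  · exact hne s hs

/-- The dimension `s_λ(1, …, 1)`, as a real number. -/
noncomputable def Signature.dim {N : ℕ} (lam : Signature N) : ℝ := (lam.schur 1).re

theorem Signature.schur_one_eq_and_pos {N : ℕ} (lam : Signature N) :
    lam.schur 1 = lam.dim ∧ 0 < lam.dim := by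
  have h := lam.schur_principalPoint_mul 0
  simp only [Complex.ofReal_zero, principalPoint_zero, expGeomSum_zero] at h
  set q : ℕ := ∏ p ∈ ltPairs N,
    (((N - 1 - (p.1 : ℕ) : ℕ) : ℤ) - ((N - 1 - (p.2 : ℕ) : ℕ) : ℤ)).toNat with hq
  set r : ℕ := ∏ p ∈ ltPairs N, (lam.coord p.1 - lam.coord p.2).toNat with hr
  have hq0 : 0 < q := Finset.prod_pos fun p hp => by
    have : (p.1 : ℕ) < p.2 := mem_ltPairs.1 hp
    have := p.2.2
    omega
  have hr0 : 0 < r := Finset.prod_pos fun p hp => by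
    have := lam.coord_strictAnti (mem_ltPairs.1 hp)
    omega
  have h' : lam.schur 1 * q = r := by
    rw [hq, hr]; push_cast; exact h
  have h2 : lam.schur 1 = ((r / q : ℝ) : ℂ) := by
    have : (q : ℂ) ≠ 0 := by exact_mod_cast hq0.ne'
    push_cast
    field_simp
    exact h'
  have h3 : lam.dim = r / q := by
    rw [Signature.dim, h2, Complex.ofReal_re]
  rw [h3]
  exact ⟨h2, by positivity⟩

theorem Signature.schur_one {N : ℕ} (lam : Signature N) : lam.schur 1 = lam.dim :=
  lam.schur_one_eq_and_pos.1

theorem Signature.dim_pos {N : ℕ} (lam : Signature N) : 0 < lam.dim := lam.schur_one_eq_and_pos.2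

theorem zpow_sum_eq_prod {ι : Type*} {x : ℂ} (hx : x ≠ 0) (f : ι → ℤ) (s : Finset ι) :
    x ^ (∑ j ∈ s, f j) = ∏ j ∈ s, x ^ f j := by
  classical
  induction s using Finset.induction_on with
  | empty => simp
  | insert a s ha ih => rw [Finset.sum_insert ha, Finset.prod_insert ha, zpow_add₀ hx, ih]

/-- Schur functions are homogeneous of degree `|λ|`. -/
theorem Signature.schur_const {N : ℕ} (lam : Signature N) {x : ℂ} (hx : x ≠ 0) :
    lam.schur (fun _ => x) = x ^ (∑ j, lam.part j) * lam.schur 1 := by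
  have hgen : ∀ s : ℝ, s ≠ 0 → lam.schur (fun i => x * principalPoint N s i) =
      x ^ (∑ j, lam.part j) * lam.schur (principalPoint N s) := by
    intro s hs
    have h1 := lam.schur_mul_vandermonde (x := fun i => x * principalPoint N s i)
      fun i => mul_ne_zero hx (principalPoint_ne_zero _ i)
    have h2 := lam.schur_mul_vandermonde (x := principalPoint N s) (principalPoint_ne_zero _)
    have hA : lam.alternant (fun i => x * principalPoint N s i) =
        (∏ j, x ^ lam.coord j) * lam.alternant (principalPoint N s) := by
      unfold Signature.alternant
      rw [← Matrix.det_mul_row]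
      congr 1
      ext i j
      simp [mul_zpow]
    have hV : vandermondeProd (fun i => x * principalPoint N s i) =
        (∏ j : Fin N, x ^ (N - 1 - (j : ℕ))) * vandermondeProd (principalPoint N s) := by
      rw [← det_pow_rev, ← det_pow_rev, ← Matrix.det_mul_row]
      congr 1
      ext i j
      simp [mul_pow]
    rw [hA, hV, ← h2] at h1
    have hV0 := vandermondeProd_ne_zero (injective_principalPoint (N := N) hs)
    have hp : ∏ j, x ^ lam.coord j =
        x ^ (∑ j, lam.part j) * ∏ j : Fin N, x ^ (N - 1 - (j : ℕ)) := by
      rw [zpow_sum_eq_prod hx, ← Finset.prod_mul_distrib]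
      refine Finset.prod_congr rfl fun j _ => ?_
      rw [← zpow_natCast, ← zpow_add₀ hx, Signature.coord]
      congr 2
      have := j.2
      omega
    have hpow : (∏ j : Fin N, x ^ (N - 1 - (j : ℕ))) ≠ 0 :=
      Finset.prod_ne_zero_iff.2 fun j _ => pow_ne_zero _ hx
    rw [hp] at h1
    refine mul_right_cancel₀ (mul_ne_zero hpow hV0) ?_
    linear_combination h1
  have hP : ContinuousAt (fun s : ℝ => principalPoint N s) 0 :=
    ((continuous_principalPoint N).comp Complex.continuous_ofReal).continuousAt
  have hc1 : ContinuousAt (fun s : ℝ => lam.schur (fun i => x * principalPoint N s i)) 0 := by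
    refine ContinuousAt.comp (g := lam.schur) (f := fun (s : ℝ) i => x * principalPoint N s i)
      (lam.continuousAt_schur fun i => mul_ne_zero hx (principalPoint_ne_zero _ i)) ?_
    exact continuousAt_pi.2 fun i => (continuousAt_pi.1 hP i).const_mul x
  have hc2 : ContinuousAt (fun s : ℝ => x ^ (∑ j, lam.part j) * lam.schur (principalPoint N s)) 0 :=
    (ContinuousAt.comp (g := lam.schur) (f := fun s : ℝ => principalPoint N s)
      (lam.continuousAt_schur (principalPoint_ne_zero _)) hP).const_mul _
  have := tendsto_nhds_unique (hc1.tendsto.mono_left nhdsWithin_le_nhds)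
      ((hc2.tendsto.mono_left (nhdsWithin_le_nhds (s := {0}ᶜ))).congr' (by
        filter_upwards [self_mem_nhdsWithin] with s hs
        exact (hgen s hs).symm))
  simpa [principalPoint_zero] using this

/-! ### Compact support of the parameter distribution and of the random signature -/

/-- The generating function `(E ∏ (1 - b + x_i b)) ^ M`. -/
noncomputable def mixtureSGF {N : ℕ} (B : Measure ℝ) (M : ℕ) (x : Fin N → ℂ) : ℂ :=
  (∫ b, ∏ i, (1 - (b : ℂ) + x i * (b : ℂ)) ∂B) ^ M

theorem integrable_polynomial_eval {B : Measure ℝ}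
    (hB : ∀ k : ℕ, Integrable (fun b : ℝ => b ^ k) B) (p : Polynomial ℂ) :
    Integrable (fun b : ℝ => p.eval (b : ℂ)) B := by
  simp_rw [Polynomial.eval_eq_sum_range]
  refine integrable_finsetSum _ fun k _ => Integrable.const_mul ?_ _
  have := (hB k).ofReal (𝕜 := ℂ)
  simpa using this

/-- Along a monomial curve the expectation `E ∏ (1 - b + x_i b)` is a polynomial. -/
theorem exists_polynomial_integral_prod {B : Measure ℝ}
    (hB : ∀ k : ℕ, Integrable (fun b : ℝ => b ^ k) B) {N : ℕ} (e : Fin N → ℕ) :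
    ∃ P : Polynomial ℂ, ∀ z : ℂ,
      P.eval z = ∫ b, ∏ i, (1 - (b : ℂ) + z ^ e i * (b : ℂ)) ∂B := by
  set p : Polynomial (Polynomial ℂ) :=
    ∏ i, (1 - Polynomial.C Polynomial.X + Polynomial.X ^ e i * Polynomial.C Polynomial.X) with hp
  have hval : ∀ (b : ℝ) (z : ℂ), ∏ i, (1 - (b : ℂ) + z ^ e i * (b : ℂ)) =
      ∑ k ∈ Finset.range (p.natDegree + 1), (p.coeff k).eval (b : ℂ) * z ^ k := by
    intro b z
    have h1 : ((p.eval (Polynomial.C z)).eval (b : ℂ)) = ∏ i, (1 - (b : ℂ) + z ^ e i * (b : ℂ)) := by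
      simp only [hp, Polynomial.eval_prod, Polynomial.eval_add, Polynomial.eval_sub,
        Polynomial.eval_one, Polynomial.eval_mul, Polynomial.eval_pow, Polynomial.eval_X,
        Polynomial.eval_C]
    rw [← h1, Polynomial.eval_eq_sum_range (p := p), Polynomial.eval_finsetSum]
    simp
  refine ⟨∑ k ∈ Finset.range (p.natDegree + 1),
    Polynomial.C (∫ b, (p.coeff k).eval ((b : ℝ) : ℂ) ∂B) * Polynomial.X ^ k, fun z => ?_⟩
  simp_rw [hval]
  rw [integral_finsetSum _ fun k _ => (integrable_polynomial_eval hB _).mul_const _]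
  simp [Polynomial.eval_finsetSum, integral_mul_const]

/-- The generating function of `|λ|`, from the diagonal `x_1 = … = x_N`. -/
theorem eventually_hasSum_size {N : ℕ} {ρ : Measure (Signature N)} {S : (Fin N → ℂ) → ℂ}
    (hS : HasSchurGeneratingFunction ρ S) :
    ∀ᶠ s : ℝ in 𝓝 0, HasSum (fun lam : Signature N =>
      (ρ.real {lam} : ℂ) * Complex.exp ((∑ j, lam.part j : ℤ) * s))
      (S fun _ => Complex.exp s) := by
  have hc : Tendsto (fun s : ℝ => (fun _ => Complex.exp s : Fin N → ℂ)) (𝓝 0) (𝓝 1) := by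
    refine Continuous.tendsto' ?_ _ _ ?_
    · fun_prop
    · ext; simp
  filter_upwards [hc.eventually hS] with s hs
  convert hs using 3 with lam
  rw [lam.schur_const (Complex.exp_ne_zero _), Complex.exp_int_mul, mul_div_assoc, div_self, mul_one]
  rw [lam.schur_one]
  exact_mod_cast lam.dim_pos.ne'

/-- Continuation along `x = (e ^ s, …, e ^ s)` to `s = π i`: a series with nonnegative coefficients
is bounded there by its value `1` at `s = 0`. -/
theorem norm_integral_pow_le_one {N : ℕ} {ρ : Measure (Signature N)} [IsProbabilityMeasure ρ]
    {B : Measure ℝ} [IsProbabilityMeasure B]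
    (hB : ∀ k : ℕ, Integrable (fun b : ℝ => b ^ k) B) {M : ℕ}
    (hS : HasSchurGeneratingFunction ρ (mixtureSGF B M)) :
    |∫ b, (1 - 2 * b) ^ N ∂B| ^ M ≤ 1 := by
  obtain ⟨P, hP⟩ := exists_polynomial_integral_prod hB (fun _ : Fin N => 1)
  have h := eventually_hasSum_size hS
  have h' : ∀ᶠ s : ℝ in 𝓝 0, HasSum (fun lam : Signature N =>
      (ρ.real {lam} : ℂ) * Complex.exp ((∑ j, lam.part j : ℤ) * s))
      ((P ^ M).eval (Complex.exp s)) := by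
    refine h.mono fun s hs => ?_
    rw [Polynomial.eval_pow, hP]
    simpa [mixtureSGF] using hs
  have h0 : HasSum (fun lam : Signature N => ρ.real {lam}) 1 := by
    have := h'.self_of_nhds
    rw [Polynomial.eval_pow, hP] at this
    simp only [Complex.ofReal_zero, mul_zero, Complex.exp_zero, mul_one, one_pow, one_mul,
      sub_add_cancel, Finset.prod_const_one, integral_const, probReal_univ, one_smul] at this
    rw [← Complex.ofReal_one] at this
    exact Complex.hasSum_ofReal.1 this
  have hπ := hasSum_exp_imaginary (fun lam => measureReal_nonneg) h' Real.pi
  have hle := hπ.norm_le_of_bounded h0 fun lam => by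
    rw [norm_mul, Complex.norm_real, Real.norm_of_nonneg measureReal_nonneg]
    have : ‖Complex.exp ((∑ j, lam.part j : ℤ) * (Real.pi * Complex.I))‖ = 1 := by
      rw [Complex.norm_exp]; simp
    rw [this, mul_one]
  rw [Polynomial.eval_pow, hP, Complex.exp_pi_mul_I, norm_pow] at hle
  have hint : (∫ b : ℝ, ∏ _i : Fin N, (1 - (b : ℂ) + (-1) ^ 1 * (b : ℂ)) ∂B) =
      ((∫ b, (1 - 2 * b) ^ N ∂B : ℝ) : ℂ) := by
    refine Eq.trans (integral_congr_ae (ae_of_all _ fun b => ?_)) integral_ofReal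
    simp
    ring
  rw [hint, Complex.norm_real, Real.norm_eq_abs] at hle
  exact hle

/-- A distribution all of whose large even moments are at most `1` is carried by `[-1, 1]`. -/
theorem ae_abs_le_one_of_frequently_moment_le {B : Measure ℝ} [IsFiniteMeasure B] {f : ℝ → ℝ}
    (hf : ∀ n : ℕ, Integrable (fun b => f b ^ n) B)
    (h : ∃ᶠ n : ℕ in atTop, ∫ b, f b ^ (2 * n) ∂B ≤ 1) : ∀ᵐ b ∂B, |f b| ≤ 1 := by
  have key : ∀ δ : ℝ, 1 < δ → B {b | δ ≤ |f b|} = 0 := by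
    intro δ hδ
    by_contra hne
    have hpos : 0 < B.real {b | δ ≤ |f b|} :=
      ENNReal.toReal_pos hne (measure_ne_top _ _)
    have hinf : Tendsto (fun n : ℕ => δ ^ (2 * n) * B.real {b | δ ≤ |f b|}) atTop atTop := by
      refine Tendsto.atTop_mul_const hpos ?_
      have : Tendsto (fun n : ℕ => (δ ^ 2) ^ n) atTop atTop :=
        tendsto_pow_atTop_atTop_of_one_lt (by nlinarith)
      simpa [pow_mul] using this
    obtain ⟨n, h1, h2⟩ := (h.and_eventually (hinf.eventually_gt_atTop 1)).exists
    have hmk := mul_meas_ge_le_integral_of_nonneg (μ := B) (f := fun b => f b ^ (2 * n))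
      (ae_of_all _ fun b => by simp only [Pi.zero_apply, pow_mul]; positivity) (hf _) (δ ^ (2 * n))
    have hset : {b | δ ≤ |f b|} ⊆ {b | δ ^ (2 * n) ≤ f b ^ (2 * n)} := by
      intro b hb
      have : f b ^ (2 * n) = |f b| ^ (2 * n) := by rw [pow_mul, pow_mul, sq_abs]
      simp only [Set.mem_ofPred_eq] at hb ⊢
      rw [this]
      gcongr
    have := mul_le_mul_of_nonneg_left (measureReal_mono hset : B.real _ ≤ B.real _)
      (by positivity : 0 ≤ δ ^ (2 * n))
    linarith
  have hall : ∀ᵐ b ∂B, ∀ k : ℕ, ¬ (1 + 1 / ((k : ℝ) + 1) ≤ |f b|) := by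
    rw [ae_all_iff]
    intro k
    rw [ae_iff]
    simp only [not_not]
    exact key _ (by
      have : (0 : ℝ) < 1 / ((k : ℝ) + 1) := by positivity
      linarith)
  filter_upwards [hall] with b hb
  by_contra hcon
  push Not at hcon
  obtain ⟨k, hk⟩ := exists_nat_one_div_lt (sub_pos.2 hcon)
  exact hb k (by linarith)

/-- The parameter distribution is carried by `[0, 1]`: at `x = (-1, …, -1)` a Schur generating
function is bounded by `1`, so that `E (1 - 2 b) ^ N ≤ 1` for all large even `N`. -/
theorem ae_mem_Icc_of_schurGeneratingFunction
    (ρ : ∀ N : ℕ, Measure (Signature N)) [∀ N, IsProbabilityMeasure (ρ N)]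
    (M : ℕ → ℕ) (hM : ∀ᶠ N in atTop, 1 ≤ M N) (B : Measure ℝ) [IsProbabilityMeasure B]
    (hB : ∀ k : ℕ, Integrable (fun b : ℝ => b ^ k) B)
    (hS : ∀ N : ℕ, 1 ≤ N → HasSchurGeneratingFunction (ρ N) (mixtureSGF B (M N))) :
    ∀ᵐ b ∂B, b ∈ Set.Icc (0 : ℝ) 1 := by
  have h := ae_abs_le_one_of_frequently_moment_le (B := B) (f := fun b => 1 - 2 * b) ?_ ?_
  · filter_upwards [h] with b hb
    obtain ⟨h1, h2⟩ := abs_le.1 hb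
    constructor <;> linarith
  · intro n
    have := (integrable_polynomial_eval hB ((1 - 2 * Polynomial.X) ^ n)).re
    refine this.congr (ae_of_all _ fun b => ?_)
    simp only [Polynomial.eval_pow, Polynomial.eval_sub, Polynomial.eval_one, Polynomial.eval_mul,
      Polynomial.eval_X, Polynomial.eval_ofNat]
    have : ((1 : ℂ) - 2 * (b : ℂ)) ^ n = (((1 - 2 * b) ^ n : ℝ) : ℂ) := by push_cast; ring
    rw [this]
    exact RCLike.ofReal_re _
  · refine Eventually.frequently ?_
    have h2 : Tendsto (fun n : ℕ => 2 * n) atTop atTop :=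
      tendsto_id.const_mul_atTop' (by norm_num)
    filter_upwards [h2.eventually hM, eventually_ge_atTop 1] with n hn hn1
    have := norm_integral_pow_le_one hB (hS (2 * n) (by omega))
    by_contra hcon
    push Not at hcon
    have h3 : 1 < |∫ b, (1 - 2 * b) ^ (2 * n) ∂B| := hcon.trans_le (le_abs_self _)
    exact absurd this (not_le.2 (one_lt_pow₀ h3 (by omega)))

/-- Only finitely many signatures carry positive mass: along the principal specialization, the
product formula turns the generating function into an exponential sum with nonnegative weights,
whose frequencies see the gaps between the coordinates; the diagonal controls `|λ|`. -/
theorem finite_support {N : ℕ} (hN : 1 ≤ N) {ρ : Measure (Signature N)} [IsProbabilityMeasure ρ]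
    {B : Measure ℝ} (hB : ∀ k : ℕ, Integrable (fun b : ℝ => b ^ k) B) {M : ℕ}
    (hS : HasSchurGeneratingFunction ρ (mixtureSGF B M)) :
    {lam : Signature N | ρ.real {lam} ≠ 0}.Finite := by
  classical
  obtain ⟨P₁, hP₁⟩ := exists_polynomial_integral_prod hB (fun _ : Fin N => 1)
  obtain ⟨P₂, hP₂⟩ := exists_polynomial_integral_prod hB (fun i : Fin N => N - 1 - (i : ℕ))
  have h₁ : ∀ᶠ s : ℝ in 𝓝 0, HasSum (fun lam : Signature N =>
      (ρ.real {lam} : ℂ) * Complex.exp ((∑ j, lam.part j : ℤ) * s))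
      ((P₁ ^ M).eval (Complex.exp s)) := by
    refine (eventually_hasSum_size hS).mono fun s hs => ?_
    rw [Polynomial.eval_pow, hP₁]
    simpa [mixtureSGF] using hs
  set Q : Polynomial ℂ := ∏ p ∈ ltPairs N,
    ∑ n ∈ Finset.Ico (N - 1 - (p.2 : ℕ)) (N - 1 - (p.1 : ℕ)), Polynomial.X ^ n with hQ
  have hQe : ∀ s : ℂ, Q.eval (Complex.exp s) = ∏ p ∈ ltPairs N,
      expGeomSum ((N - 1 - (p.2 : ℕ) : ℕ) : ℤ) ((N - 1 - (p.1 : ℕ) : ℕ) : ℤ) s := by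
    intro s
    rw [hQ, Polynomial.eval_prod]
    refine Finset.prod_congr rfl fun p _ => ?_
    rw [Polynomial.eval_finsetSum, expGeomSum]
    refine Finset.sum_bij (fun n _ => (n : ℤ)) ?_ ?_ ?_ ?_
    · intro n hn
      simp only [Finset.mem_Ico] at hn ⊢
      omega
    · intro n _ m _ h
      exact_mod_cast h
    · intro n hn
      simp only [Finset.mem_Ico] at hn
      exact ⟨n.toNat, by simp only [Finset.mem_Ico]; omega, by omega⟩
    · intro n _
      simp [Complex.exp_nat_mul]
  -- Expanding the product of geometric sums, each `lam` contributes one exponential for every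
  -- choice of an integer in `[l_j, l_i)` for all `i < j`; all carry the weight `ρ(lam) / s_lam(1)`.
  let ι := Σ lam : Signature N, (Finset.pi (ltPairs N)
    (fun p => Finset.Ico (lam.coord p.2) (lam.coord p.1)) : Finset _)
  let w : ι → ℝ := fun i => ρ.real {i.1} / i.1.dim
  let n : ι → ℤ := fun i => ∑ p ∈ (ltPairs N).attach, i.2.1 p.1 p.2
  have hw : ∀ i, 0 ≤ w i := fun i => div_nonneg measureReal_nonneg i.1.dim_pos.le
  have hexp : ∀ (lam : Signature N) (s : ℂ),
      ∏ p ∈ ltPairs N, expGeomSum (lam.coord p.2) (lam.coord p.1) s =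
      ∑ f : (Finset.pi (ltPairs N)
        (fun p => Finset.Ico (lam.coord p.2) (lam.coord p.1)) : Finset _),
        Complex.exp ((∑ p ∈ (ltPairs N).attach, f.1 p.1 p.2 : ℤ) * s) := by
    intro lam s
    unfold expGeomSum
    rw [Finset.prod_sum, ← Finset.sum_coe_sort]
    refine Finset.sum_congr rfl fun f _ => ?_
    rw [← Complex.exp_sum]
    push_cast
    rw [Finset.sum_mul]
  have h₂ : ∀ᶠ s : ℝ in 𝓝 0, HasSum (fun i : ι => (w i : ℂ) * Complex.exp (n i * s))
      ((Q * P₂ ^ M).eval (Complex.exp s)) := by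
    have hc : Tendsto (fun s : ℝ => principalPoint N s) (𝓝 0) (𝓝 1) := by
      refine Continuous.tendsto' ?_ _ _ ?_
      · exact (continuous_principalPoint N).comp Complex.continuous_ofReal
      · simp [principalPoint_zero]
    filter_upwards [hc.eventually hS] with s hs
    have hval : mixtureSGF B M (principalPoint N s) = P₂.eval (Complex.exp s) ^ M := by
      rw [hP₂, mixtureSGF]
      simp only [principalPoint, Complex.exp_nat_mul]
    have hs' := hs.mul_left (Q.eval (Complex.exp s))
    rw [hval, ← Polynomial.eval_pow, ← Polynomial.eval_mul] at hs'
    have houter : HasSum (fun lam : Signature N => ∑ f : (Finset.pi (ltPairs N)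
        (fun p => Finset.Ico (lam.coord p.2) (lam.coord p.1)) : Finset _),
        (w ⟨lam, f⟩ : ℂ) * Complex.exp (n ⟨lam, f⟩ * s))
        ((Q * P₂ ^ M).eval (Complex.exp s)) := by
      refine (congrArg (fun f => HasSum f _) (funext fun lam => ?_)).mpr hs'
      have h3 := lam.schur_principalPoint_mul s
      rw [hexp, ← hQe] at h3
      have hd : (lam.dim : ℂ) ≠ 0 := by exact_mod_cast lam.dim_pos.ne'
      simp only [w, n]
      rw [lam.schur_one, ← Finset.mul_sum, ← h3]
      push_cast
      field_simp
    -- summability of the regrouped series: within one `lam` the terms are positive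
    have hsummable : Summable fun i : ι => (w i : ℂ) * Complex.exp (n i * s) := by
      have hnorm : ∀ i : ι, ‖(w i : ℂ) * Complex.exp (n i * s)‖ = w i * Real.exp (n i * s) := by
        intro i
        rw [norm_mul, Complex.norm_exp, Complex.norm_real, Real.norm_of_nonneg (hw i)]
        simp
      refine Summable.of_norm ?_
      simp_rw [hnorm]
      rw [summable_sigma_of_nonneg fun i => mul_nonneg (hw i) (Real.exp_pos _).le]
      refine ⟨fun lam => (hasSum_fintype _).summable, ?_⟩
      refine houter.summable.norm.congr fun lam => ?_
      rw [tsum_fintype]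
      have hre : (∑ f : (Finset.pi (ltPairs N)
        (fun p => Finset.Ico (lam.coord p.2) (lam.coord p.1)) : Finset _),
        (w ⟨lam, f⟩ : ℂ) * Complex.exp (n ⟨lam, f⟩ * s)) =
        ((∑ f : (Finset.pi (ltPairs N)
        (fun p => Finset.Ico (lam.coord p.2) (lam.coord p.1)) : Finset _),
        w ⟨lam, f⟩ * Real.exp (n ⟨lam, f⟩ * s) : ℝ) : ℂ) := by
        push_cast; rfl
      rw [hre, Complex.norm_real, Real.norm_of_nonneg]
      exact Finset.sum_nonneg fun f _ => mul_nonneg (hw _) (Real.exp_pos _).le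
    have := hsummable.hasSum.sigma fun lam => hasSum_fintype _
    rw [houter.unique this]
    exact hsummable.hasSum
  set D₁ := (P₁ ^ M).natDegree
  set D₂ := (Q * P₂ ^ M).natDegree
  set K : ℤ := D₁ + D₂ + 1 with hK
  have hbound : ∀ lam ∈ {lam : Signature N | ρ.real {lam} ≠ 0},
      lam.part ∈ Set.Icc (fun _ => -K) (fun _ => K) := by
    intro lam hlam
    have hs1 := exponent_mem_of_hasSum_exp (fun _ => measureReal_nonneg) h₁ (i₀ := lam) hlam
    have hwl : ∀ f, w ⟨lam, f⟩ ≠ 0 := fun f => div_ne_zero hlam lam.dim_pos.ne'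
    have hanti := lam.coord_strictAnti
    -- the largest and the smallest frequency contributed by `lam`
    have hmax := (exponent_mem_of_hasSum_exp hw h₂ (i₀ := ⟨lam, ⟨fun p _ => lam.coord p.1 - 1, by
      simp only [Finset.mem_pi, Finset.mem_Ico]
      intro p hp
      have := hanti (mem_ltPairs.1 hp)
      omega⟩⟩) (hwl _)).2
    have hmin := (exponent_mem_of_hasSum_exp hw h₂ (i₀ := ⟨lam, ⟨fun p _ => lam.coord p.2, by
      simp only [Finset.mem_pi, Finset.mem_Ico]
      intro p hp
      have := hanti (mem_ltPairs.1 hp)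
      omega⟩⟩) (hwl _)).1
    simp only [n] at hmax hmin
    rw [Finset.sum_attach (ltPairs N) (fun p => lam.coord p.1 - 1)] at hmax
    rw [Finset.sum_attach (ltPairs N) (fun p => lam.coord p.2)] at hmin
    have hdiff : ∑ p ∈ ltPairs N, (lam.coord p.1 - 1 - lam.coord p.2) ≤ D₂ := by
      rw [Finset.sum_sub_distrib]; linarith
    have hgap : ∀ i j : Fin N, i ≤ j → lam.part i - lam.part j ≤ D₂ + 1 := by
      intro i j hij
      rcases hij.eq_or_lt with rfl | hlt
      · simp only [sub_self]; omega
      · have h4 : lam.coord i - 1 - lam.coord j ≤ D₂ := by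
          refine le_trans ?_ hdiff
          refine Finset.single_le_sum (f := fun p : Fin N × Fin N =>
            lam.coord p.1 - 1 - lam.coord p.2) (fun p hp => ?_)
            (mem_ltPairs.2 hlt : (i, j) ∈ ltPairs N)
          have := hanti (mem_ltPairs.1 hp)
          omega
        have h5 : (i : ℤ) < j := by exact_mod_cast hlt
        simp only [Signature.coord] at h4
        omega
    set z : Fin N := ⟨0, by omega⟩
    set e : Fin N := ⟨N - 1, by omega⟩
    have hze : ∀ j : Fin N, z ≤ j ∧ j ≤ e := fun j =>
      ⟨Fin.mk_le_of_le_val (by simp), Fin.le_def.2 (by simp only [e]; omega)⟩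
    have hz0 : 0 ≤ lam.part z := by
      by_contra hneg
      push Not at hneg
      have : ∑ j, lam.part j < 0 := by
        refine Finset.sum_neg (fun j _ => ?_) ⟨z, Finset.mem_univ _⟩
        exact (lam.antitone_part (hze j).1).trans_lt hneg
      omega
    have he0 : lam.part e ≤ D₁ := by
      by_contra hneg
      push Not at hneg
      have hpos : ∀ j ∈ Finset.univ, 0 ≤ lam.part j := fun j _ =>
        le_trans (by omega) (lam.antitone_part (hze j).2)
      have := Finset.single_le_sum hpos (Finset.mem_univ e)
      omega
    constructor <;> intro j <;> have h6 := hgap _ _ (hze j).1 <;> have h7 := hgap _ _ (hze j).2 <;>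
      have h8 := hgap _ _ (hze e).1 <;> simp only <;> omega
  refine Set.Finite.of_finite_image (f := Signature.part) ?_ Signature.part_injective.injOn
  refine (Set.finite_Icc (fun _ => -K) (fun _ : Fin N => K)).subset ?_
  rintro _ ⟨lam, hlam, rfl⟩
  exact hbound lam hlam

/-! ### Multiplicative shifts of one variable -/

/-- Multiplication of the `i`-th variable by `q`. -/
def shiftVar {N : ℕ} (q : ℂ) (x : Fin N → ℂ) (i : Fin N) : Fin N → ℂ :=
  Function.update x i (q * x i)

theorem shiftVar_ne_zero {N : ℕ} {q : ℂ} (hq : q ≠ 0) {x : Fin N → ℂ} (hx : ∀ i, x i ≠ 0)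
    (i j : Fin N) : shiftVar q x i j ≠ 0 := by
  unfold shiftVar
  rcases eq_or_ne j i with rfl | h
  · simp [hq, hx]
  · simp [Function.update_of_ne h, hx]

/-- The exponential power sum `∑ q ^ (λ_j + N - j)`. -/
noncomputable def Signature.psum {N : ℕ} (lam : Signature N) (q : ℂ) : ℂ := ∑ j, q ^ lam.coord j

/-- Multiplying the rows of a matrix, one at a time, by the entries of `d` and adding up the
determinants gives the trace of `diagonal d` times the determinant. -/
theorem sum_det_updateRow_mul {n : Type*} [Fintype n] [DecidableEq n] (A : Matrix n n ℂ)
    (d : n → ℂ) : ∑ i, (A.updateRow i fun j => A i j * d j).det = (∑ j, d j) * A.det := by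
  have h : ∀ i, (A.updateRow i fun j => A i j * d j).det =
      ∑ j, A.adjugate j i * (A i j * d j) := by
    intro i
    rw [← Matrix.cramer_transpose_apply, Matrix.cramer_eq_adjugate_mulVec, Matrix.mulVec,
      dotProduct, ← Matrix.adjugate_transpose]
    rfl
  simp_rw [h]
  rw [Finset.sum_comm, Finset.sum_mul]
  refine Finset.sum_congr rfl fun j _ => ?_
  have h2 := congrFun (congrFun (Matrix.adjugate_mul A) j) j
  rw [Matrix.mul_apply] at h2
  simp only [Matrix.smul_apply, Matrix.one_apply_eq, smul_eq_mul, mul_one] at h2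
  rw [← h2, Finset.mul_sum]
  exact Finset.sum_congr rfl fun i _ => by ring

/-- Alternants are eigenfunctions of the sum of the shifts. -/
theorem Signature.sum_alternant_shiftVar {N : ℕ} (lam : Signature N) {q : ℂ} (x : Fin N → ℂ) :
    ∑ i, lam.alternant (shiftVar q x i) = lam.psum q * lam.alternant x := by
  unfold Signature.alternant Signature.psum
  rw [← sum_det_updateRow_mul]
  refine Finset.sum_congr rfl fun i _ => ?_
  congr 1
  ext a b
  rcases eq_or_ne a i with rfl | h
  · simp [shiftVar, mul_zpow, mul_comm]
  · simp [shiftVar, h]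

/-- The Vandermonde product as a function of one variable: its roots are the other variables. -/
theorem exists_vandermondeProd_update {N : ℕ} (x : Fin N → ℂ) (i : Fin N) :
    ∃ C : ℂ, ∀ u : ℂ, vandermondeProd (Function.update x i u) =
      C * ∏ j ∈ Finset.univ.erase i, (u - x j) := by
  set φ : (Fin N → ℂ) → Fin N → Fin N → ℂ := fun y a b => if a < b then y a - y b else 1 with hφ
  have hV : ∀ y : Fin N → ℂ, vandermondeProd y = ∏ a, ∏ b, φ y a b := by
    intro y
    unfold vandermondeProd
    rw [Finset.prod_filter, ← Finset.univ_product_univ, Finset.prod_product]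
  have hsplit : ∀ y : Fin N → ℂ, vandermondeProd y =
      (∏ a ∈ Finset.univ.erase i, (φ y i a * φ y a i)) *
        ∏ a ∈ Finset.univ.erase i, ∏ b ∈ Finset.univ.erase i, φ y a b := by
    intro y
    rw [hV, ← Finset.mul_prod_erase _ _ (Finset.mem_univ i),
      ← Finset.mul_prod_erase _ (φ y i) (Finset.mem_univ i)]
    have : ∀ a ∈ Finset.univ.erase i, ∏ b, φ y a b =
        φ y a i * ∏ b ∈ Finset.univ.erase i, φ y a b := fun a _ =>
      (Finset.mul_prod_erase _ _ (Finset.mem_univ i)).symm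
    rw [Finset.prod_congr rfl this, Finset.prod_mul_distrib, Finset.prod_mul_distrib]
    have hii : φ y i i = 1 := by simp [hφ]
    rw [hii]
    ring
  refine ⟨(∏ j ∈ Finset.univ.erase i, if i < j then 1 else -1) *
    ∏ a ∈ Finset.univ.erase i, ∏ b ∈ Finset.univ.erase i, φ x a b, fun u => ?_⟩
  rw [hsplit]
  have h1 : ∏ a ∈ Finset.univ.erase i, ∏ b ∈ Finset.univ.erase i, φ (Function.update x i u) a b =
      ∏ a ∈ Finset.univ.erase i, ∏ b ∈ Finset.univ.erase i, φ x a b := by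
    refine Finset.prod_congr rfl fun a ha => Finset.prod_congr rfl fun b hb => ?_
    simp only [hφ, Function.update_of_ne (Finset.ne_of_mem_erase ha),
      Function.update_of_ne (Finset.ne_of_mem_erase hb)]
  have h2 : ∏ a ∈ Finset.univ.erase i,
      (φ (Function.update x i u) i a * φ (Function.update x i u) a i) =
      (∏ j ∈ Finset.univ.erase i, if i < j then 1 else -1) *
        ∏ j ∈ Finset.univ.erase i, (u - x j) := by
    rw [← Finset.prod_mul_distrib]
    refine Finset.prod_congr rfl fun a ha => ?_
    have hai := Finset.ne_of_mem_erase ha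
    simp only [hφ, Function.update_of_ne hai, Function.update_self]
    rcases lt_or_gt_of_ne hai with h | h
    · rw [if_neg h.not_gt, if_pos h, if_neg h.not_gt]; ring
    · rw [if_pos h, if_neg h.not_gt, if_pos h]; ring
  rw [h1, h2]
  ring

theorem vandermondeProd_shiftVar {N : ℕ} (q : ℂ) {x : Fin N → ℂ} (hx : Function.Injective x)
    (i : Fin N) : vandermondeProd (shiftVar q x i) =
      vandermondeProd x * ((∏ j ∈ Finset.univ.erase i, (q * x i - x j)) *
        ∏ j ∈ Finset.univ.erase i, (x i - x j)⁻¹) := by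
  obtain ⟨C, hC⟩ := exists_vandermondeProd_update x i
  have h1 := hC (x i)
  rw [Function.update_eq_self] at h1
  rw [shiftVar, hC, h1, Finset.prod_inv_distrib]
  have : ∏ j ∈ Finset.univ.erase i, (x i - x j) ≠ 0 :=
    Finset.prod_ne_zero_iff.2 fun j hj =>
      sub_ne_zero.2 fun h => Finset.ne_of_mem_erase hj (hx h).symm
  field_simp

/-! ### Contour integral form of the shift operators -/

/-- The residue theorem for simple poles, from Cauchy's formula and the partial fraction expansion
of `∏ (z - x_j)⁻¹`. -/
theorem circleIntegral_div_prod_sub {N : ℕ} (hN : 1 ≤ N) {c : ℂ} {r : ℝ} {x : Fin N → ℂ}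
    (hx : Function.Injective x) (hxr : ∀ i, x i ∈ Metric.ball c r) {g : ℂ → ℂ}
    (hg : DiffContOnCl ℂ g (Metric.ball c r)) :
    (∮ z in C(c, r), g z * ∏ j, (z - x j)⁻¹) =
      2 * Real.pi * Complex.I * ∑ i, g (x i) * ∏ j ∈ Finset.univ.erase i, (x i - x j)⁻¹ := by
  have hr : 0 < r := by
    have := hxr ⟨0, hN⟩
    exact Metric.pos_of_mem_ball this
  have hne : ∀ z ∈ Metric.sphere c r, ∀ i, z ≠ x i := by
    intro z hz i h
    have h1 := hxr i
    rw [← h, Metric.mem_ball] at h1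
    exact absurd (Metric.mem_sphere.1 hz) h1.ne
  have hsplit : Set.EqOn (fun z => g z * ∏ j, (z - x j)⁻¹)
      (fun z => ∑ i, (∏ j ∈ Finset.univ.erase i, (x i - x j)⁻¹) * ((z - x i)⁻¹ • g z))
      (Metric.sphere c r) := by
    intro z hz
    have h1 := Lagrange.eval_interpolate_not_at_node (s := Finset.univ) (v := x)
      (fun _ => (1 : ℂ)) (x := z) (fun i _ => hne z hz i)
    have h2 : Lagrange.interpolate Finset.univ x (fun _ => (1 : ℂ)) = 1 :=
      Lagrange.interpolate_one hx.injOn ⟨⟨0, hN⟩, Finset.mem_univ _⟩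
    rw [h2, Polynomial.eval_one, Lagrange.eval_nodal] at h1
    have h3 : ∏ j, (z - x j) ≠ 0 :=
      Finset.prod_ne_zero_iff.2 fun j _ => sub_ne_zero.2 (hne z hz j)
    simp only [smul_eq_mul]
    rw [Finset.prod_inv_distrib]
    have h4 : (∏ j, (z - x j))⁻¹ =
        ∑ i, Lagrange.nodalWeight Finset.univ x i * (z - x i)⁻¹ * 1 := by
      exact inv_eq_of_mul_eq_one_right h1.symm
    rw [h4, Finset.mul_sum]
    refine Finset.sum_congr rfl fun i _ => ?_
    rw [Lagrange.nodalWeight]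
    ring
  rw [circleIntegral.integral_congr hr.le hsplit, circleIntegral.integral_fun_sum]
  · rw [Finset.mul_sum]
    refine Finset.sum_congr rfl fun i _ => ?_
    rw [circleIntegral.integral_const_mul, hg.circleIntegral_sub_inv_smul (hxr i)]
    simp only [smul_eq_mul]
    ring
  · intro i _
    refine ContinuousOn.circleIntegrable hr.le ?_
    refine continuousOn_const.mul (ContinuousOn.fun_smul ?_ ?_)
    · exact (continuousOn_id.sub continuousOn_const).inv₀ fun z hz =>
        sub_ne_zero.2 (hne z hz i)
    · exact hg.continuousOn_ball.mono Metric.sphere_subset_closedBall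

/-- The kernel `((q - 1) z)⁻¹ ∏ (q z - x_j) / (z - x_j)` of the shift operator. -/
noncomputable def shiftKernel {N : ℕ} (q : ℂ) (x : Fin N → ℂ) (z : ℂ) : ℂ :=
  ((q - 1) * z)⁻¹ * ∏ j, ((q * z - x j) * (z - x j)⁻¹)

/-- The shift operator, conjugated by the Vandermonde product, as a contour integral: the function
it is applied to enters through an analytic function `K` whose values at the nodes `x_i` are the
values of the former at the shifted points. -/
theorem sum_vandermonde_shiftVar_mul {N : ℕ} (hN : 1 ≤ N) {q : ℂ} (hq : q ≠ 1) {r : ℝ} (hr1 : r < 1)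
    {x : Fin N → ℂ} (hx : Function.Injective x) (hxr : ∀ i, x i ∈ Metric.ball (1 : ℂ) r)
    {K : ℂ → ℂ} (hK : DifferentiableOn ℂ K (Metric.closedBall 1 r)) :
    ∑ i, vandermondeProd (shiftVar q x i) * K (x i) =
      vandermondeProd x * ((2 * Real.pi * Complex.I)⁻¹ *
        ∮ z in C(1, r), K z * shiftKernel q x z) := by
  have hr : 0 < r := Metric.pos_of_mem_ball (hxr ⟨0, hN⟩)
  have hz0 : ∀ z ∈ Metric.closedBall (1 : ℂ) r, z ≠ 0 := by
    rintro z hz rfl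
    rw [Metric.mem_closedBall, dist_zero_left, norm_one] at hz
    linarith
  set g : ℂ → ℂ := fun z => K z * (((q - 1) * z)⁻¹ * ∏ j, (q * z - x j)) with hg
  have hgd : DifferentiableOn ℂ g (Metric.closedBall 1 r) := by
    refine hK.mul (DifferentiableOn.mul ?_ ?_)
    · refine DifferentiableOn.inv (by fun_prop) fun z hz => ?_
      exact mul_ne_zero (sub_ne_zero.2 hq) (hz0 z hz)
    · fun_prop
  have hgc : DiffContOnCl ℂ g (Metric.ball 1 r) := hgd.diffContOnCl_ball subset_rfl
  have hres := circleIntegral_div_prod_sub hN hx hxr hgc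
  have hint : (∮ z in C(1, r), K z * shiftKernel q x z) =
      ∮ z in C(1, r), g z * ∏ j, (z - x j)⁻¹ := by
    congr 1
    ext z
    simp only [hg, shiftKernel, Finset.prod_mul_distrib]
    ring
  rw [hint, hres, inv_mul_cancel_left₀ Complex.two_pi_I_ne_zero, Finset.mul_sum]
  refine Finset.sum_congr rfl fun i _ => ?_
  rw [vandermondeProd_shiftVar q hx]
  have h1 : ∏ j, (q * x i - x j) = (q * x i - x i) * ∏ j ∈ Finset.univ.erase i, (q * x i - x j) :=
    (Finset.mul_prod_erase _ _ (Finset.mem_univ i)).symm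
  have hxi := hz0 (x i) (Metric.ball_subset_closedBall (hxr i))
  have h2 : ((q - 1) * x i)⁻¹ * (q * x i - x i) = 1 := by
    have : q - 1 ≠ 0 := sub_ne_zero.2 hq
    field_simp
  simp only [hg]
  rw [h1]
  linear_combination (-vandermondeProd x * K (x i) *
    (∏ j ∈ Finset.univ.erase i, (q * x i - x j)) *
    ∏ j ∈ Finset.univ.erase i, (x i - x j)⁻¹) * h2

/-! ### The generating function as an identity of alternants -/

/-- The expectation `E ∏ (1 - b + x_i b)` is a polynomial in `x`. -/
theorem integral_prod_eq_sum {B : Measure ℝ}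
    (hB : ∀ k : ℕ, Integrable (fun b : ℝ => b ^ k) B) {N : ℕ} (x : Fin N → ℂ) :
    (∫ b, ∏ i, (1 - (b : ℂ) + x i * (b : ℂ)) ∂B) =
      ∑ t ∈ Finset.univ.powerset, (∏ i ∈ t, x i) *
        ∫ b, (b : ℂ) ^ t.card * (1 - (b : ℂ)) ^ (Finset.univ \ t).card ∂B := by
  have h : ∀ b : ℝ, ∏ i, (1 - (b : ℂ) + x i * (b : ℂ)) =
      ∑ t ∈ Finset.univ.powerset, (∏ i ∈ t, x i) *
        ((b : ℂ) ^ t.card * (1 - (b : ℂ)) ^ (Finset.univ \ t).card) := by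
    intro b
    simp_rw [add_comm (1 - (b : ℂ))]
    rw [Finset.prod_add]
    refine Finset.sum_congr rfl fun t _ => ?_
    rw [Finset.prod_mul_distrib, Finset.prod_const, Finset.prod_const]
    ring
  simp_rw [h]
  rw [integral_finsetSum]
  · simp_rw [integral_const_mul]
  · intro t _
    refine Integrable.const_mul ?_ _
    have := integrable_polynomial_eval hB
      (Polynomial.X ^ t.card * (1 - Polynomial.X) ^ (Finset.univ \ t).card)
    simpa using this

theorem analyticAt_coord {N : ℕ} (i : Fin N) (x : Fin N → ℂ) :
    AnalyticAt ℂ (fun y : Fin N → ℂ => y i) x :=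
  (ContinuousLinearMap.proj (R := ℂ) (φ := fun _ : Fin N => ℂ) i).analyticAt x

theorem analyticOnNhd_mixtureSGF {B : Measure ℝ}
    (hB : ∀ k : ℕ, Integrable (fun b : ℝ => b ^ k) B) {N : ℕ} (M : ℕ) :
    AnalyticOnNhd ℂ (mixtureSGF B M : (Fin N → ℂ) → ℂ) Set.univ := by
  intro x _
  have : (mixtureSGF B M : (Fin N → ℂ) → ℂ) = fun x =>
      (∑ t ∈ Finset.univ.powerset, (∏ i ∈ t, x i) *
        ∫ b, (b : ℂ) ^ t.card * (1 - (b : ℂ)) ^ (Finset.univ \ t).card ∂B) ^ M := by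
    ext x
    rw [mixtureSGF, integral_prod_eq_sum hB]
  rw [this]
  refine AnalyticAt.pow (Finset.analyticAt_fun_sum _ fun t _ => AnalyticAt.mul ?_ analyticAt_const) M
  exact Finset.analyticAt_fun_prod _ fun i _ => analyticAt_coord i x

/-- The Schur generating function identity, cleared of denominators and extended to all nonzero
arguments. -/
theorem sum_alternant_eq {N : ℕ} (hN : 1 ≤ N) {ρ : Measure (Signature N)} [IsProbabilityMeasure ρ]
    {B : Measure ℝ} (hB : ∀ k : ℕ, Integrable (fun b : ℝ => b ^ k) B) {M : ℕ}
    (hS : HasSchurGeneratingFunction ρ (mixtureSGF B M)) {x : Fin N → ℂ} (hx : ∀ i, x i ≠ 0) :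
    ∑ lam ∈ (finite_support hN hB hS).toFinset, ((ρ.real {lam} / lam.dim : ℝ) : ℂ) * lam.alternant x =
      vandermondeProd x * mixtureSGF B M x := by
  set F := (finite_support hN hB hS).toFinset with hF
  -- `(∏ x_i) ^ K` clears all negative exponents, so that both sides become entire
  set K : ℕ := ∑ lam ∈ F, ∑ j, (lam.coord j).natAbs with hK
  have hKl : ∀ lam ∈ F, ∀ j, 0 ≤ lam.coord j + K := by
    intro lam hlam j
    have h1 : (lam.coord j).natAbs ≤ ∑ j, (lam.coord j).natAbs :=
      Finset.single_le_sum (f := fun j => (lam.coord j).natAbs) (fun _ _ => Nat.zero_le _)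
        (Finset.mem_univ j)
    have h2 : ∑ j, (lam.coord j).natAbs ≤ K :=
      Finset.single_le_sum (f := fun lam : Signature N => ∑ j, (lam.coord j).natAbs)
        (fun _ _ => Nat.zero_le _) hlam
    omega
  set f : (Fin N → ℂ) → ℂ := fun x => ∑ lam ∈ F, ((ρ.real {lam} / lam.dim : ℝ) : ℂ) *
    (Matrix.of fun i j : Fin N => x i ^ (lam.coord j + K).toNat).det with hf
  set g : (Fin N → ℂ) → ℂ := fun x => (∏ i, x i) ^ K * (vandermondeProd x * mixtureSGF B M x)
    with hg
  have hfA : ∀ x : Fin N → ℂ, (∀ i, x i ≠ 0) → f x = (∏ i, x i) ^ K *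
      ∑ lam ∈ F, ((ρ.real {lam} / lam.dim : ℝ) : ℂ) * lam.alternant x := by
    intro x hx
    rw [Finset.mul_sum]
    refine Finset.sum_congr rfl fun lam hlam => ?_
    rw [mul_left_comm]
    congr 1
    rw [← Finset.prod_pow, Signature.alternant, ← Matrix.det_mul_column]
    congr 1
    ext i j
    simp only [Matrix.of_apply]
    rw [← zpow_natCast, Int.toNat_of_nonneg (hKl lam hlam j), zpow_add₀ (hx i), mul_comm,
      zpow_natCast]
  have hfan : AnalyticOnNhd ℂ f Set.univ := by
    intro x _
    simp only [hf, Matrix.det_apply', Matrix.of_apply]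
    refine Finset.analyticAt_fun_sum _ fun lam _ => analyticAt_const.mul
      (Finset.analyticAt_fun_sum _ fun σ _ => analyticAt_const.mul
        (Finset.analyticAt_fun_prod _ fun i _ => (analyticAt_coord _ x).pow _))
  have hgan : AnalyticOnNhd ℂ g Set.univ := by
    intro x hx
    have h1 := analyticOnNhd_mixtureSGF hB (N := N) M x hx
    simp only [hg, vandermondeProd]
    refine AnalyticAt.mul ?_ (AnalyticAt.mul ?_ h1)
    · exact (Finset.analyticAt_fun_prod _ fun i _ => analyticAt_coord i x).pow K
    · exact Finset.analyticAt_fun_prod _ fun p _ => (analyticAt_coord _ x).sub (analyticAt_coord _ x)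
  have hev : f =ᶠ[𝓝 1] g := by
    have hnz : ∀ᶠ x : Fin N → ℂ in 𝓝 1, ∀ i, x i ≠ 0 := by
      rw [eventually_all]
      intro i
      exact (continuous_apply i).continuousAt.eventually_ne (by simp)
    filter_upwards [hS, hnz] with x hsum hx
    rw [hfA x hx]
    simp only [hg]
    congr 1
    have h2 := hsum.unique (hasSum_sum_of_ne_finset_zero (s := F) fun lam hlam => by
      have : ρ.real {lam} = 0 := by simpa [hF] using hlam
      simp [this])
    rw [h2, Finset.mul_sum]
    refine Finset.sum_congr rfl fun lam _ => ?_
    rw [← lam.schur_mul_vandermonde hx, lam.schur_one]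
    push_cast
    ring
  have heq := congrFun (hfan.eq_of_eventuallyEq hgan hev) x
  rw [hfA x hx] at heq
  refine mul_left_cancel₀ (pow_ne_zero K ?_) heq
  exact Finset.prod_ne_zero_iff.2 fun i _ => hx i

/-! ### Averages over a parameter in the unit interval -/

theorem norm_one_sub_add_mul_ge (b : Set.Icc (0 : ℝ) 1) (z : ℂ) :
    1 - ‖z - 1‖ ≤ ‖1 - (b : ℂ) + b * z‖ := by
  have h : (1 - (b : ℂ) + b * z) = 1 - (-(b * (z - 1))) := by ring
  rw [h]
  have h1 := norm_sub_norm_le (1 : ℂ) (-(b * (z - 1)))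
  have h2 : ‖-((b : ℂ) * (z - 1))‖ ≤ ‖z - 1‖ := by
    rw [norm_neg, norm_mul, Complex.norm_real, Real.norm_of_nonneg b.2.1]
    exact mul_le_of_le_one_left (norm_nonneg _) b.2.2
  rw [norm_one] at h1
  linarith

theorem one_sub_add_mul_ne_zero (b : Set.Icc (0 : ℝ) 1) {z : ℂ} (hz : z ∈ Metric.ball (1 : ℂ) 1) :
    1 - (b : ℂ) + b * z ≠ 0 := by
  rw [mem_ball_iff_norm] at hz
  have := norm_one_sub_add_mul_ge b z
  exact norm_pos_iff.1 (by linarith)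

theorem continuous_unitInterval_coe : Continuous fun b : Set.Icc (0 : ℝ) 1 => ((b : ℝ) : ℂ) :=
  Complex.continuous_ofReal.comp continuous_subtype_val

theorem integrable_of_continuous_unitInterval {β : Measure (Set.Icc (0 : ℝ) 1)} [IsFiniteMeasure β]
    {H : Set.Icc (0 : ℝ) 1 → ℂ} (hH : Continuous H) : Integrable H β := by
  rw [← integrableOn_univ]
  exact hH.continuousOn.integrableOn_compact isCompact_univ

theorem continuous_div_affine {H : Set.Icc (0 : ℝ) 1 → ℂ} (hH : Continuous H) {z : ℂ}
    (hz : z ∈ Metric.ball (1 : ℂ) 1) :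
    Continuous fun b : Set.Icc (0 : ℝ) 1 => H b / (1 - (b : ℂ) + b * z) := by
  have := continuous_unitInterval_coe
  exact hH.div (by fun_prop) fun b => one_sub_add_mul_ne_zero b hz

theorem differentiableOn_integral_div {β : Measure (Set.Icc (0 : ℝ) 1)} [IsFiniteMeasure β]
    {H : Set.Icc (0 : ℝ) 1 → ℂ} (hH : Continuous H) :
    DifferentiableOn ℂ (fun z : ℂ => ∫ b, H b / (1 - (b : ℂ) + b * z) ∂β) (Metric.ball 1 1) := by
  intro z₀ hz₀
  refine DifferentiableAt.differentiableWithinAt ?_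
  have hc := continuous_unitInterval_coe
  have hlt : ‖z₀ - 1‖ < 1 := mem_ball_iff_norm.1 hz₀
  set δ := (1 - ‖z₀ - 1‖) / 2 with hδ
  have hδ0 : 0 < δ := by simp only [hδ]; linarith
  have hball : ∀ z ∈ Metric.ball z₀ δ, δ ≤ 1 - ‖z - 1‖ := by
    intro z hz
    rw [mem_ball_iff_norm] at hz
    have : ‖z - 1‖ ≤ ‖z - z₀‖ + ‖z₀ - 1‖ := norm_sub_le_norm_sub_add_norm_sub _ _ _
    linarith
  have hball' : ∀ z ∈ Metric.ball z₀ δ, z ∈ Metric.ball (1 : ℂ) 1 := by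
    intro z hz
    rw [mem_ball_iff_norm]
    linarith [hball z hz]
  obtain ⟨C, hC⟩ := (isCompact_univ.image hH).isBounded.exists_norm_le
  have hC' : ∀ b, ‖H b‖ ≤ C := fun b => hC _ ⟨b, trivial, rfl⟩
  have key := hasDerivAt_integral_of_dominated_loc_of_deriv_le (μ := β) (𝕜 := ℂ)
    (F := fun z b => H b / (1 - (b : ℂ) + b * z))
    (F' := fun z b => -(H b * b) / (1 - (b : ℂ) + b * z) ^ 2) (x₀ := z₀)
    (bound := fun _ => C / δ ^ 2) (Metric.ball_mem_nhds z₀ hδ0) ?_ ?_ ?_ ?_ ?_ ?_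
  · exact key.2.differentiableAt
  · filter_upwards [Metric.ball_mem_nhds z₀ hδ0] with z hz
    exact (continuous_div_affine hH (hball' z hz)).aestronglyMeasurable
  · exact integrable_of_continuous_unitInterval (continuous_div_affine hH hz₀)
  · refine Continuous.aestronglyMeasurable ?_
    exact Continuous.div (by fun_prop) (by fun_prop) fun b =>
      pow_ne_zero _ (one_sub_add_mul_ne_zero b hz₀)
  · refine ae_of_all _ fun b z hz => ?_
    have h1 : δ ≤ ‖1 - (b : ℂ) + b * z‖ := (hball z hz).trans (norm_one_sub_add_mul_ge b z)
    rw [norm_div, norm_neg, norm_pow, norm_mul]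
    have h2 : ‖H b‖ * ‖(b : ℂ)‖ ≤ C := by
      rw [Complex.norm_real, Real.norm_of_nonneg b.2.1]
      exact (mul_le_of_le_one_right (norm_nonneg _) b.2.2).trans (hC' b)
    have hC0 : 0 ≤ C := (norm_nonneg _).trans (hC' b)
    gcongr
  · exact integrable_const _
  · refine ae_of_all _ fun b z hz => ?_
    have hne := one_sub_add_mul_ne_zero b (hball' z hz)
    have hd : HasDerivAt (fun z : ℂ => 1 - (b : ℂ) + b * z) (b : ℂ) z := by
      simpa using ((hasDerivAt_id z).const_mul (b : ℂ)).const_add (1 - (b : ℂ))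
    convert! (hasDerivAt_const z (H b)).div hd hne using 1
    ring

/-- The factor `(1 - b + b q z) / (1 - b + b z)`. -/
noncomputable def shiftRatio (q z : ℂ) (b : Set.Icc (0 : ℝ) 1) : ℂ :=
  (1 - (b : ℂ) + b * (q * z)) / (1 - (b : ℂ) + b * z)

theorem shiftRatio_one {z : ℂ} (hz : z ∈ Metric.ball (1 : ℂ) 1) (b : Set.Icc (0 : ℝ) 1) :
    shiftRatio 1 z b = 1 := by
  rw [shiftRatio, one_mul, div_self (one_sub_add_mul_ne_zero b hz)]

theorem shiftRatio_eq (q : ℂ) {z : ℂ} (hz : z ∈ Metric.ball (1 : ℂ) 1) (b : Set.Icc (0 : ℝ) 1) :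
    shiftRatio q z b = q + (1 - q) * (1 - b) / (1 - (b : ℂ) + b * z) := by
  have := one_sub_add_mul_ne_zero b hz
  rw [shiftRatio]
  field_simp
  ring

theorem Continuous.shiftRatio {X : Type*} [TopologicalSpace X] {z : X → ℂ} (hz : Continuous z)
    (hz1 : ∀ p, z p ∈ Metric.ball (1 : ℂ) 1) {b : X → Set.Icc (0 : ℝ) 1} (hb : Continuous b)
    (q : ℂ) : Continuous fun p => shiftRatio q (z p) (b p) := by
  have := continuous_unitInterval_coe.comp hb
  simp only [Function.comp_def] at this
  unfold _root_.shiftRatio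
  exact Continuous.div (by fun_prop) (by fun_prop) fun p => one_sub_add_mul_ne_zero (b p) (hz1 p)

/-- The generating function at `x` with two extra factors, for the shifts `z ↦ q z` and `w ↦ p w`:
at nodes `z`, `w` of `x` it is the generating function at the shifted arguments. With `p = 1` the
second factor is trivial for `w` in the unit disc about `1`. -/
noncomputable def mixtureKernel {N : ℕ} (β : Measure (Set.Icc (0 : ℝ) 1)) (M : ℕ) (q p : ℂ)
    (x : Fin N → ℂ) (z w : ℂ) : ℂ :=
  (∫ b, (∏ i, (1 - (b : ℂ) + x i * b)) * shiftRatio q z b * shiftRatio p w b ∂β) ^ M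

theorem continuous_mixtureKernel {X : Type*} [TopologicalSpace X] [FirstCountableTopology X]
    [LocallyCompactSpace X] {β : Measure (Set.Icc (0 : ℝ) 1)} [IsFiniteMeasure β] (M : ℕ)
    (q p : ℂ) {N : ℕ} {x : X → Fin N → ℂ} (hx : Continuous x) {z w : X → ℂ} (hz : Continuous z)
    (hz1 : ∀ t, z t ∈ Metric.ball (1 : ℂ) 1) (hw : Continuous w)
    (hw1 : ∀ t, w t ∈ Metric.ball (1 : ℂ) 1) :
    Continuous fun t => mixtureKernel β M q p (x t) (z t) (w t) := by
  unfold mixtureKernel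
  refine Continuous.pow ?_ M
  have h := continuous_parametric_integral_of_continuous (μ := β) (s := Set.univ)
    (f := fun (t : X) (b : Set.Icc (0 : ℝ) 1) =>
      (∏ i, (1 - (b : ℂ) + x t i * b)) * shiftRatio q (z t) b * shiftRatio p (w t) b) ?_
      isCompact_univ
  · simpa using h
  · simp only [Function.uncurry_def]
    refine Continuous.mul (Continuous.mul ?_ ?_) ?_
    · refine continuous_finsetProd _ fun i _ => ?_
      have h1 := continuous_unitInterval_coe.comp
        (continuous_snd : Continuous (Prod.snd : X × Set.Icc (0 : ℝ) 1 → _))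
      simp only [Function.comp_def] at h1
      have h2 : Continuous fun t : X × Set.Icc (0 : ℝ) 1 => x t.1 i :=
        (continuous_apply i).comp (hx.comp continuous_fst)
      fun_prop
    · exact (hz.comp continuous_fst).shiftRatio (fun _ => hz1 _) continuous_snd q
    · exact (hw.comp continuous_fst).shiftRatio (fun _ => hw1 _) continuous_snd p

theorem differentiableOn_mixtureKernel {β : Measure (Set.Icc (0 : ℝ) 1)} [IsFiniteMeasure β]
    (M : ℕ) (q p : ℂ) {N : ℕ} (x : Fin N → ℂ) {w : ℂ} (hw : w ∈ Metric.ball (1 : ℂ) 1) :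
    DifferentiableOn ℂ (fun z => mixtureKernel β M q p x z w) (Metric.ball 1 1) := by
  unfold mixtureKernel
  refine DifferentiableOn.pow ?_ M
  have hc := continuous_unitInterval_coe
  set G : Set.Icc (0 : ℝ) 1 → ℂ := fun b => (∏ i, (1 - (b : ℂ) + x i * b)) * shiftRatio p w b
  have hG : Continuous G :=
    Continuous.mul (by fun_prop) (continuous_const.shiftRatio (fun _ => hw) continuous_id p)
  have hH : Continuous fun b : Set.Icc (0 : ℝ) 1 => G b * (1 - (b : ℂ)) := by fun_prop
  have h1 := differentiableOn_integral_div (β := β) hH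
  refine ((h1.const_mul (1 - q)).const_add (q * ∫ b, G b ∂β)).congr fun z hz => ?_
  rw [← integral_const_mul, ← integral_const_mul, ← integral_add]
  · refine integral_congr_ae (ae_of_all _ fun b => ?_)
    simp only [G, shiftRatio_eq q hz b]
    ring
  · exact (integrable_of_continuous_unitInterval hG).const_mul _
  · exact (integrable_of_continuous_unitInterval (continuous_div_affine hH hz)).const_mul _

theorem prod_shiftVar {N : ℕ} (q : ℂ) (x : Fin N → ℂ) {i : Fin N}
    (hx : x i ∈ Metric.ball (1 : ℂ) 1) (b : Set.Icc (0 : ℝ) 1) :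
    ∏ j, (1 - (b : ℂ) + shiftVar q x i j * b) =
      (∏ j, (1 - (b : ℂ) + x j * b)) * shiftRatio q (x i) b := by
  have hne := one_sub_add_mul_ne_zero b hx
  rw [← Finset.mul_prod_erase _ _ (Finset.mem_univ i),
    ← Finset.mul_prod_erase _ (fun j => 1 - (b : ℂ) + x j * b) (Finset.mem_univ i)]
  have : ∏ j ∈ Finset.univ.erase i, (1 - (b : ℂ) + shiftVar q x i j * b) =
      ∏ j ∈ Finset.univ.erase i, (1 - (b : ℂ) + x j * b) :=
    Finset.prod_congr rfl fun j hj => by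
      rw [shiftVar, Function.update_of_ne (Finset.ne_of_mem_erase hj)]
  rw [this, shiftVar, Function.update_self, shiftRatio, mul_comm (x i)]
  field_simp

theorem mixtureKernel_shiftVar {N : ℕ} (β : Measure (Set.Icc (0 : ℝ) 1)) (M : ℕ) (q : ℂ)
    {x : Fin N → ℂ} {i : Fin N} (hx : x i ∈ Metric.ball (1 : ℂ) 1) (w : ℂ) :
    mixtureKernel β M q 1 (shiftVar q x i) w 1 = mixtureKernel β M q q x (x i) w := by
  unfold mixtureKernel
  congr 2
  ext b
  rw [prod_shiftVar q x hx, shiftRatio_one (by simp), mul_one]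

theorem mixtureSGF_map {N : ℕ} (β : Measure (Set.Icc (0 : ℝ) 1)) (M : ℕ) (x : Fin N → ℂ) :
    mixtureSGF (β.map Subtype.val) M x = (∫ b, ∏ i, (1 - (b : ℂ) + x i * b) ∂β) ^ M := by
  rw [mixtureSGF, (MeasurableEmbedding.subtype_coe measurableSet_Icc).integral_map]

theorem mixtureSGF_shiftVar {N : ℕ} (β : Measure (Set.Icc (0 : ℝ) 1)) (M : ℕ) (q : ℂ)
    {x : Fin N → ℂ} {i : Fin N} (hx : x i ∈ Metric.ball (1 : ℂ) 1) :
    mixtureSGF (β.map Subtype.val) M (shiftVar q x i) = mixtureKernel β M q 1 x (x i) 1 := by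
  rw [mixtureSGF_map, mixtureKernel]
  congr 2
  ext b
  rw [prod_shiftVar q x hx, shiftRatio_one (by simp), mul_one]

theorem continuous_circleIntegral {X : Type*} [TopologicalSpace X] {f : X → ℂ → ℂ} {c : ℂ} {r : ℝ}
    (hf : Continuous fun p : X × ℝ => f p.1 (circleMap c r p.2)) :
    Continuous fun x => ∮ z in C(c, r), f x z := by
  unfold circleIntegral
  refine intervalIntegral.continuous_parametric_intervalIntegral_of_continuous' ?_ _ _
  simp only [Function.uncurry_def, deriv_circleMap, smul_eq_mul]
  exact Continuous.mul (by fun_prop) hf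

/-- The polydisc of radius `r` around `(1, …, 1)`. -/
def onePolydisc (N : ℕ) (r : ℝ) : Set (Fin N → ℂ) := {x | ∀ i, x i ∈ Metric.ball (1 : ℂ) r}

theorem isOpen_onePolydisc (N : ℕ) (r : ℝ) : IsOpen (onePolydisc N r) := by
  have : onePolydisc N r = ⋂ i, (fun x : Fin N → ℂ => x i) ⁻¹' Metric.ball (1 : ℂ) r := by
    ext x; simp [onePolydisc]
  rw [this]
  exact isOpen_iInter_of_finite fun i => Metric.isOpen_ball.preimage (continuous_apply i)

theorem continuous_shiftKernel {X : Type*} [TopologicalSpace X] {N : ℕ} {q : ℂ} (hq : q ≠ 1)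
    {x : X → Fin N → ℂ} (hx : Continuous x) {z : X → ℂ} (hz : Continuous z) (hz0 : ∀ t, z t ≠ 0)
    (hzx : ∀ t i, z t ≠ x t i) : Continuous fun t => shiftKernel q (x t) (z t) := by
  unfold shiftKernel
  refine Continuous.mul ?_ (continuous_finsetProd _ fun i _ => ?_)
  · exact (continuous_const.mul hz).inv₀ fun t => mul_ne_zero (sub_ne_zero.2 hq) (hz0 t)
  · have h1 : Continuous fun t => x t i := (continuous_apply i).comp hx
    exact ((continuous_const.mul hz).sub h1).mul
      ((hz.sub h1).inv₀ fun t => sub_ne_zero.2 (hzx t i))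

theorem circleMap_ne_of_mem_ball {c : ℂ} {r : ℝ} {y : ℂ} (hy : y ∈ Metric.ball c r) (θ : ℝ) :
    circleMap c r θ ≠ y := by
  rintro rfl
  have := circleMap_mem_sphere' c r θ
  rw [Metric.mem_sphere] at this
  rw [Metric.mem_ball, this] at hy
  exact absurd hy (not_lt.2 (le_abs_self r))

theorem circleMap_mem_ball_one {r : ℝ} (hr0 : 0 ≤ r) (hr1 : r < 1) (θ : ℝ) :
    circleMap (1 : ℂ) r θ ∈ Metric.ball (1 : ℂ) 1 := by
  have := circleMap_mem_sphere (1 : ℂ) hr0 θ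
  rw [Metric.mem_sphere] at this
  rw [Metric.mem_ball, this]
  exact hr1

theorem ne_zero_of_mem_ball_one {z : ℂ} (hz : z ∈ Metric.ball (1 : ℂ) 1) : z ≠ 0 := by
  rintro rfl
  simp at hz

/-! ### Exact contour integral formulas for the expected power sums -/

theorem integrable_pow_map_unitInterval (β : Measure (Set.Icc (0 : ℝ) 1)) [IsFiniteMeasure β]
    (k : ℕ) : Integrable (fun b : ℝ => b ^ k) (β.map Subtype.val) := by
  rw [(MeasurableEmbedding.subtype_coe measurableSet_Icc).integrable_map_iff, ← integrableOn_univ]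
  refine Continuous.continuousOn ?_ |>.integrableOn_compact isCompact_univ
  exact continuous_subtype_val.pow k

theorem eventually_principalPoint_mem_onePolydisc {N : ℕ} {r : ℝ} (hr : 0 < r) :
    ∀ᶠ s : ℝ in 𝓝[≠] 0, principalPoint N s ∈ onePolydisc N r := by
  have hc : Tendsto (fun s : ℝ => principalPoint N s) (𝓝 0) (𝓝 1) :=
    Continuous.tendsto' ((continuous_principalPoint N).comp Complex.continuous_ofReal) _ _
      (by simp [principalPoint_zero])
  exact (hc.eventually ((isOpen_onePolydisc N r).mem_nhds
    (by simp [onePolydisc, hr]))).filter_mono nhdsWithin_le_nhds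

/-- Division by the Vandermonde product and the limit `x → (1, …, 1)` along the principal
specialization turn an identity of alternants into an expectation. -/
theorem sum_mul_eq_of_alternant {N : ℕ} {ρ : Measure (Signature N)} (F : Finset (Signature N))
    (a : Signature N → ℂ) {r : ℝ} (hr : 0 < r) {J : (Fin N → ℂ) → ℂ}
    (hJ : ContinuousOn J (onePolydisc N r))
    (h : ∀ᶠ s : ℝ in 𝓝[≠] 0,
      ∑ lam ∈ F, ((ρ.real {lam} / lam.dim : ℝ) : ℂ) * (a lam * lam.alternant (principalPoint N s)) =
        vandermondeProd (principalPoint N s) * J (principalPoint N s)) :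
    ∑ lam ∈ F, (ρ.real {lam} : ℂ) * a lam = J 1 := by
  have hc : ContinuousAt (fun s : ℝ => principalPoint N s) 0 :=
    ((continuous_principalPoint N).comp Complex.continuous_ofReal).continuousAt
  have h0 : principalPoint N ((0 : ℝ) : ℂ) = 1 := by simp [principalPoint_zero]
  have hJ1 : ContinuousAt (fun s : ℝ => J (principalPoint N s)) 0 := by
    refine ContinuousAt.comp (g := J) (f := fun s : ℝ => principalPoint N s) ?_ hc
    rw [h0]
    exact hJ.continuousAt ((isOpen_onePolydisc N r).mem_nhds (by simp [onePolydisc, hr]))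
  have hL : ContinuousAt (fun s : ℝ => ∑ lam ∈ F, ((ρ.real {lam} / lam.dim : ℝ) : ℂ) *
      (a lam * lam.schur (principalPoint N s))) 0 := by
    refine tendsto_finsetSum _ fun lam _ => ?_
    refine Tendsto.const_mul _ (Tendsto.const_mul _ ?_)
    exact ContinuousAt.comp (g := lam.schur) (f := fun s : ℝ => principalPoint N s)
      (lam.continuousAt_schur (principalPoint_ne_zero _)) hc
  have hlim := tendsto_nhds_unique (hL.tendsto.mono_left nhdsWithin_le_nhds)
    ((hJ1.tendsto.mono_left (nhdsWithin_le_nhds (s := {0}ᶜ))).congr' (by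
      filter_upwards [h, self_mem_nhdsWithin] with s hs hs0
      have hV := vandermondeProd_ne_zero (injective_principalPoint (N := N) hs0)
      refine mul_left_cancel₀ hV ?_
      rw [← hs, Finset.mul_sum]
      refine Finset.sum_congr rfl fun lam _ => ?_
      rw [← lam.schur_mul_vandermonde (principalPoint_ne_zero _)]
      ring))
  rw [h0] at hlim
  rw [← hlim]
  refine Finset.sum_congr rfl fun lam _ => ?_
  have : (lam.dim : ℂ) ≠ 0 := by exact_mod_cast lam.dim_pos.ne'
  rw [lam.schur_one]
  push_cast
  field_simp

theorem continuousOn_circleIntegral {N : ℕ} {f : (Fin N → ℂ) → ℂ → ℂ} {c : ℂ} {r r' : ℝ}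
    (hf : Continuous fun p : onePolydisc N r' × ℝ => f p.1.1 (circleMap c r p.2)) :
    ContinuousOn (fun x => ∮ z in C(c, r), f x z) (onePolydisc N r') :=
  continuousOn_iff_continuous_domRestrict.2
    (continuous_circleIntegral (f := fun x : onePolydisc N r' => f x.1) hf)

section Formulas

variable {N : ℕ} {ρ : Measure (Signature N)} [IsProbabilityMeasure ρ]
  {β : Measure (Set.Icc (0 : ℝ) 1)} [IsProbabilityMeasure β] {M : ℕ}

theorem finite_support_map (hN : 1 ≤ N)
    (hS : HasSchurGeneratingFunction ρ (mixtureSGF (β.map Subtype.val) M)) :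
    {lam : Signature N | ρ.real {lam} ≠ 0}.Finite :=
  finite_support hN (integrable_pow_map_unitInterval β) hS

theorem sum_psum_mul_alternant (hN : 1 ≤ N)
    (hS : HasSchurGeneratingFunction ρ (mixtureSGF (β.map Subtype.val) M)) {q : ℂ} (hq0 : q ≠ 0)
    {x : Fin N → ℂ} (hx : ∀ i, x i ≠ 0) :
    ∑ lam ∈ (finite_support_map hN hS).toFinset,
        ((ρ.real {lam} / lam.dim : ℝ) : ℂ) * (lam.psum q * lam.alternant x) =
      ∑ i, vandermondeProd (shiftVar q x i) * mixtureSGF (β.map Subtype.val) M (shiftVar q x i) := by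
  simp_rw [← Signature.sum_alternant_shiftVar, Finset.mul_sum]
  rw [Finset.sum_comm]
  refine Finset.sum_congr rfl fun i _ => ?_
  exact sum_alternant_eq hN (integrable_pow_map_unitInterval β) hS (shiftVar_ne_zero hq0 hx i)

/-- Expectation of `∑ q ^ (λ_j + N - j)`. -/
theorem sum_psum_eq_circleIntegral (hN : 1 ≤ N)
    (hS : HasSchurGeneratingFunction ρ (mixtureSGF (β.map Subtype.val) M)) {q : ℂ} (hq0 : q ≠ 0)
    (hq1 : q ≠ 1) {r : ℝ} (hr0 : 0 < r) (hr1 : r < 1) :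
    ∑ lam ∈ (finite_support_map hN hS).toFinset, (ρ.real {lam} : ℂ) * lam.psum q =
      (2 * Real.pi * Complex.I)⁻¹ *
        ∮ z in C(1, r), mixtureKernel β M q 1 (1 : Fin N → ℂ) z 1 * shiftKernel q (1 : Fin N → ℂ) z := by
  refine sum_mul_eq_of_alternant (J := fun x => (2 * Real.pi * Complex.I)⁻¹ *
    ∮ z in C(1, r), mixtureKernel β M q 1 x z 1 * shiftKernel q x z) _ _ hr0 ?_ ?_
  · have : LocallyCompactSpace (onePolydisc N r) := (isOpen_onePolydisc N r).locallyCompactSpace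
    refine ContinuousOn.mul continuousOn_const (continuousOn_circleIntegral ?_)
    have hx : Continuous fun p : onePolydisc N r × ℝ => (p.1 : Fin N → ℂ) :=
      continuous_subtype_val.comp continuous_fst
    have hz : Continuous fun p : onePolydisc N r × ℝ => circleMap 1 r p.2 :=
      (continuous_circleMap 1 r).comp continuous_snd
    refine Continuous.mul ?_ ?_
    · exact continuous_mixtureKernel M q 1 hx hz (fun _ => circleMap_mem_ball_one hr0.le hr1 _)
        continuous_const (fun _ => by simp)
    · exact continuous_shiftKernel hq1 hx hz
        (fun _ => ne_zero_of_mem_ball_one (circleMap_mem_ball_one hr0.le hr1 _))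
        (fun p i => circleMap_ne_of_mem_ball (p.1.2 i) _)
  · filter_upwards [eventually_principalPoint_mem_onePolydisc (N := N) hr0, self_mem_nhdsWithin] with s hs hs0
    have hball : Metric.closedBall (1 : ℂ) r ⊆ Metric.ball 1 1 := Metric.closedBall_subset_ball hr1
    rw [sum_psum_mul_alternant hN hS hq0 (principalPoint_ne_zero _),
      ← sum_vandermonde_shiftVar_mul hN hq1 hr1 (injective_principalPoint hs0) hs
        ((differentiableOn_mixtureKernel M q 1 _ (by simp)).mono hball)]
    refine Finset.sum_congr rfl fun i _ => ?_
    rw [mixtureSGF_shiftVar β M q (hball (Metric.ball_subset_closedBall (hs i)))]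

/-- The interaction between the two contours: shifting a variable `z` by `q` multiplies the kernel
at `w` by this factor. -/
noncomputable def crossFactor (q z w : ℂ) : ℂ :=
  (q * w - q * z) * (w - z) / ((w - q * z) * (q * w - z))

theorem shiftKernel_shiftVar {q : ℂ} {x : Fin N → ℂ} {i : Fin N} {w : ℂ} (h1 : w ≠ x i)
    (h2 : q * w ≠ x i) :
    shiftKernel q (shiftVar q x i) w = shiftKernel q x w * crossFactor q (x i) w := by
  have e1 : w - x i ≠ 0 := sub_ne_zero.2 h1
  have e2 : q * w - x i ≠ 0 := sub_ne_zero.2 h2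
  unfold shiftKernel crossFactor
  rw [← Finset.mul_prod_erase _ _ (Finset.mem_univ i),
    ← Finset.mul_prod_erase _ (fun j => (q * w - x j) * (w - x j)⁻¹) (Finset.mem_univ i)]
  have : ∏ j ∈ Finset.univ.erase i,
        ((q * w - shiftVar q x i j) * (w - shiftVar q x i j)⁻¹) =
      ∏ j ∈ Finset.univ.erase i, ((q * w - x j) * (w - x j)⁻¹) :=
    Finset.prod_congr rfl fun j hj => by
      rw [shiftVar, Function.update_of_ne (Finset.ne_of_mem_erase hj)]
  rw [this, shiftVar, Function.update_self]
  generalize ((q - 1) * w)⁻¹ = A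
  rw [div_eq_mul_inv, mul_inv]
  have e3 : (w - x i)⁻¹ * (w - x i) = 1 := inv_mul_cancel₀ e1
  have e4 : (q * w - x i) * (q * w - x i)⁻¹ = 1 := mul_inv_cancel₀ e2
  set P := ∏ j ∈ Finset.univ.erase i, ((q * w - x j) * (w - x j)⁻¹)
  linear_combination -(A * P * (q * w - q * x i) * (w - q * x i)⁻¹) *
    (e3 * ((q * w - x i) * (q * w - x i)⁻¹) + e4)

/-- The integrand of the double contour formula. -/
noncomputable def doubleIntegrand {N : ℕ} (β : Measure (Set.Icc (0 : ℝ) 1)) (M : ℕ) (q : ℂ)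
    (x : Fin N → ℂ) (z w : ℂ) : ℂ :=
  mixtureKernel β M q q x z w * (shiftKernel q x w * crossFactor q z w) * shiftKernel q x z

theorem crossFactor_denom_ne_zero {q : ℂ} {r₁ r₂ : ℝ}
    (hqz : ∀ z ∈ Metric.closedBall (1 : ℂ) r₁, q * z ∈ Metric.ball (1 : ℂ) r₂)
    (hqw : ∀ w ∈ Metric.sphere (1 : ℂ) r₂, q * w ∉ Metric.closedBall (1 : ℂ) r₁)
    {z w : ℂ} (hz : z ∈ Metric.closedBall (1 : ℂ) r₁) (hw : w ∈ Metric.sphere (1 : ℂ) r₂) :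
    (w - q * z) * (q * w - z) ≠ 0 := by
  refine mul_ne_zero (sub_ne_zero.2 ?_) (sub_ne_zero.2 ?_)
  · intro h
    have h1 := hqz z hz
    rw [← h, Metric.mem_ball, Metric.mem_sphere.1 hw] at h1
    exact lt_irrefl _ h1
  · rintro rfl
    exact hqw w hw hz

theorem continuous_doubleIntegrand {X : Type*} [TopologicalSpace X] [FirstCountableTopology X]
    [LocallyCompactSpace X] {β : Measure (Set.Icc (0 : ℝ) 1)} [IsFiniteMeasure β] (M : ℕ)
    {q : ℂ} (hq1 : q ≠ 1) {r₁ r₂ : ℝ} (hr0 : 0 < r₁) (hr12 : r₁ < r₂) (hr1 : r₂ < 1)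
    (hqz : ∀ z ∈ Metric.closedBall (1 : ℂ) r₁, q * z ∈ Metric.ball (1 : ℂ) r₂)
    (hqw : ∀ w ∈ Metric.sphere (1 : ℂ) r₂, q * w ∉ Metric.closedBall (1 : ℂ) r₁)
    {N : ℕ} {x : X → Fin N → ℂ} (hx : Continuous x) (hxr : ∀ p, x p ∈ onePolydisc N r₁)
    {θ φ : X → ℝ} (hθ : Continuous θ) (hφ : Continuous φ) :
    Continuous fun p =>
      doubleIntegrand β M q (x p) (circleMap 1 r₁ (θ p)) (circleMap 1 r₂ (φ p)) := by
  have hr0' : 0 < r₂ := hr0.trans hr12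
  have hr1' : r₁ < 1 := hr12.trans hr1
  have hb₁₂ : Metric.closedBall (1 : ℂ) r₁ ⊆ Metric.ball 1 r₂ := Metric.closedBall_subset_ball hr12
  have hz : Continuous fun p => circleMap 1 r₁ (θ p) := (continuous_circleMap 1 r₁).comp hθ
  have hw : Continuous fun p => circleMap 1 r₂ (φ p) := (continuous_circleMap 1 r₂).comp hφ
  unfold doubleIntegrand
  refine Continuous.mul (Continuous.mul ?_ (Continuous.mul ?_ ?_)) ?_
  · exact continuous_mixtureKernel M q q hx hz (fun _ => circleMap_mem_ball_one hr0.le hr1' _)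
      hw (fun _ => circleMap_mem_ball_one hr0'.le hr1 _)
  · exact continuous_shiftKernel hq1 hx hw
      (fun _ => ne_zero_of_mem_ball_one (circleMap_mem_ball_one hr0'.le hr1 _))
      (fun p i => circleMap_ne_of_mem_ball
        (hb₁₂ (Metric.ball_subset_closedBall (hxr p i))) _)
  · unfold crossFactor
    refine Continuous.div (by fun_prop) (by fun_prop) fun p => ?_
    exact crossFactor_denom_ne_zero hqz hqw (circleMap_mem_closedBall 1 hr0.le _)
      (circleMap_mem_sphere 1 hr0'.le _)
  · exact continuous_shiftKernel hq1 hx hz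
      (fun _ => ne_zero_of_mem_ball_one (circleMap_mem_ball_one hr0.le hr1' _))
      (fun p i => circleMap_ne_of_mem_ball (hxr p i) _)

/-- Expectation of `(∑ q ^ (λ_j + N - j)) ^ 2`: the second application of the shift operator
contributes the cross factor, for contours nested so that it has no poles in `z`. -/
theorem sum_psum_sq_eq_circleIntegral (hN : 1 ≤ N)
    (hS : HasSchurGeneratingFunction ρ (mixtureSGF (β.map Subtype.val) M)) {q : ℂ} (hq0 : q ≠ 0)
    (hq1 : q ≠ 1) {r₁ r₂ : ℝ} (hr0 : 0 < r₁) (hr12 : r₁ < r₂) (hr1 : r₂ < 1)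
    (hqz : ∀ z ∈ Metric.closedBall (1 : ℂ) r₁, q * z ∈ Metric.ball (1 : ℂ) r₂)
    (hqw : ∀ w ∈ Metric.sphere (1 : ℂ) r₂, q * w ∉ Metric.closedBall (1 : ℂ) r₁) :
    ∑ lam ∈ (finite_support_map hN hS).toFinset, (ρ.real {lam} : ℂ) * lam.psum q ^ 2 =
      (2 * Real.pi * Complex.I)⁻¹ * ∮ w in C(1, r₂), (2 * Real.pi * Complex.I)⁻¹ *
        ∮ z in C(1, r₁), doubleIntegrand β M q (1 : Fin N → ℂ) z w := by
  have hr0' : 0 < r₂ := hr0.trans hr12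
  have hr1' : r₁ < 1 := hr12.trans hr1
  have hb₁ : Metric.closedBall (1 : ℂ) r₁ ⊆ Metric.ball 1 1 := Metric.closedBall_subset_ball hr1'
  have hb₁₂ : Metric.closedBall (1 : ℂ) r₁ ⊆ Metric.ball 1 r₂ := Metric.closedBall_subset_ball hr12
  have hsph : ∀ w ∈ Metric.sphere (1 : ℂ) r₂, ∀ z ∈ Metric.ball (1 : ℂ) r₂, w ≠ z := by
    rintro w hw z hz rfl
    rw [Metric.mem_sphere] at hw
    rw [Metric.mem_ball, hw] at hz
    exact lt_irrefl _ hz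
  refine sum_mul_eq_of_alternant (J := fun x => (2 * Real.pi * Complex.I)⁻¹ *
    ∮ w in C(1, r₂), (2 * Real.pi * Complex.I)⁻¹ * ∮ z in C(1, r₁),
      doubleIntegrand β M q x z w) _ _ hr0 ?_ ?_
  · have : LocallyCompactSpace (onePolydisc N r₁) := (isOpen_onePolydisc N r₁).locallyCompactSpace
    refine ContinuousOn.mul continuousOn_const (continuousOn_circleIntegral ?_)
    suffices h : Continuous fun p : onePolydisc N r₁ × ℝ => ∮ z in C(1, r₁),
        doubleIntegrand β M q p.1.1 z (circleMap 1 r₂ p.2) from continuous_const.mul h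
    refine continuous_circleIntegral (f := fun (p : onePolydisc N r₁ × ℝ) z =>
      doubleIntegrand β M q p.1.1 z (circleMap 1 r₂ p.2)) ?_
    exact continuous_doubleIntegrand M hq1 hr0 hr12 hr1 hqz hqw
      (continuous_subtype_val.comp (continuous_fst.comp continuous_fst)) (fun p => p.1.1.2)
      continuous_snd (continuous_snd.comp continuous_fst)
  · have hdist : ∀ᶠ s : ℝ in 𝓝[≠] 0, ∀ i j : Fin N,
        q * principalPoint N s i ≠ principalPoint N s j := by
      rw [eventually_all]
      intro i
      rw [eventually_all]
      intro j
      have hc : ∀ k : Fin N, ContinuousAt (fun s : ℝ => principalPoint N s k) 0 := fun k =>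
        ((continuous_apply k).comp
          ((continuous_principalPoint N).comp Complex.continuous_ofReal)).continuousAt
      have := (((hc i).const_mul q).sub (hc j)).eventually_ne (y := 0) (by
        simp [principalPoint_zero, sub_eq_zero, hq1])
      exact (this.mono fun s hs => sub_ne_zero.1 hs).filter_mono nhdsWithin_le_nhds
    filter_upwards [eventually_principalPoint_mem_onePolydisc (N := N) hr0, self_mem_nhdsWithin, hdist]
      with s hs hs0 hsd
    set x := principalPoint N s with hx
    have hxi : Function.Injective x := injective_principalPoint hs0
    have hx0 : ∀ i, x i ≠ 0 := principalPoint_ne_zero _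
    have hxc : ∀ i, x i ∈ Metric.closedBall (1 : ℂ) r₁ := fun i =>
      Metric.ball_subset_closedBall (hs i)
    have hTi : ∀ i, Function.Injective (shiftVar q x i) := by
      intro i a b hab
      unfold shiftVar at hab
      rcases eq_or_ne a i with ha | ha <;> rcases eq_or_ne b i with hb | hb
      · rw [ha, hb]
      · subst ha
        rw [Function.update_self, Function.update_of_ne hb] at hab
        exact absurd hab (hsd _ _)
      · subst hb
        rw [Function.update_self, Function.update_of_ne ha] at hab
        exact absurd hab.symm (hsd _ _)
      · rw [Function.update_of_ne ha, Function.update_of_ne hb] at hab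
        exact hxi hab
    have hTr : ∀ i, ∀ j, shiftVar q x i j ∈ Metric.ball (1 : ℂ) r₂ := by
      intro i j
      unfold shiftVar
      rcases eq_or_ne j i with rfl | hj
      · rw [Function.update_self]; exact hqz _ (hxc j)
      · rw [Function.update_of_ne hj]; exact hb₁₂ (hxc j)
    have hstep : ∑ lam ∈ (finite_support_map hN hS).toFinset,
        ((ρ.real {lam} / lam.dim : ℝ) : ℂ) * (lam.psum q ^ 2 * lam.alternant x) =
        ∑ i, ∑ lam ∈ (finite_support_map hN hS).toFinset,
          ((ρ.real {lam} / lam.dim : ℝ) : ℂ) * (lam.psum q * lam.alternant (shiftVar q x i)) := by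
      rw [Finset.sum_comm]
      refine Finset.sum_congr rfl fun lam _ => ?_
      rw [← Finset.mul_sum, ← Finset.mul_sum, Signature.sum_alternant_shiftVar]
      ring
    rw [hstep]
    have hcirc : ∀ i, ∑ lam ∈ (finite_support_map hN hS).toFinset,
          ((ρ.real {lam} / lam.dim : ℝ) : ℂ) * (lam.psum q * lam.alternant (shiftVar q x i)) =
        vandermondeProd (shiftVar q x i) * ((2 * Real.pi * Complex.I)⁻¹ *
          ∮ w in C(1, r₂), mixtureKernel β M q q x (x i) w *
            (shiftKernel q x w * crossFactor q (x i) w)) := by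
      intro i
      rw [sum_psum_mul_alternant hN hS hq0 (shiftVar_ne_zero hq0 hx0 i)]
      have hball : Metric.closedBall (1 : ℂ) r₂ ⊆ Metric.ball 1 1 :=
        Metric.closedBall_subset_ball hr1
      have h1 := sum_vandermonde_shiftVar_mul hN hq1 hr1 (hTi i) (hTr i)
        ((differentiableOn_mixtureKernel (β := β) M q 1 (shiftVar q x i) (w := 1) (by simp)).mono
          hball)
      have h2 : (∮ w in C(1, r₂), mixtureKernel β M q 1 (shiftVar q x i) w 1 *
            shiftKernel q (shiftVar q x i) w) =
          ∮ w in C(1, r₂), mixtureKernel β M q q x (x i) w *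
            (shiftKernel q x w * crossFactor q (x i) w) := by
        refine circleIntegral.integral_congr hr0'.le fun w hw => ?_
        rw [mixtureKernel_shiftVar β M q (hb₁ (hxc i)), shiftKernel_shiftVar
          (hsph w hw _ (hb₁₂ (hxc i))) (fun h => hqw w hw (h ▸ hxc i))]
      rw [← h2, ← h1]
      refine Finset.sum_congr rfl fun k _ => ?_
      rw [mixtureSGF_shiftVar β M q (hball (Metric.ball_subset_closedBall (hTr i k)))]
    simp_rw [hcirc]
    -- the sum over `i` is moved inside the outer contour and turned into the inner one
    have hint : ∀ i ∈ Finset.univ, CircleIntegrable (fun w => vandermondeProd (shiftVar q x i) *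
        (mixtureKernel β M q q x (x i) w * (shiftKernel q x w * crossFactor q (x i) w))) 1 r₂ := by
      intro i _
      refine Continuous.intervalIntegrable ?_ _ _
      have hw : Continuous fun θ : ℝ => circleMap 1 r₂ θ := continuous_circleMap 1 r₂
      refine Continuous.mul continuous_const (Continuous.mul ?_ (Continuous.mul ?_ ?_))
      · exact continuous_mixtureKernel M q q continuous_const continuous_const
          (fun _ => hb₁ (hxc i)) hw (fun _ => circleMap_mem_ball_one hr0'.le hr1 _)
      · exact continuous_shiftKernel hq1 continuous_const hw
          (fun _ => ne_zero_of_mem_ball_one (circleMap_mem_ball_one hr0'.le hr1 _))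
          (fun p i => circleMap_ne_of_mem_ball (hb₁₂ (hxc i)) _)
      · unfold crossFactor
        refine Continuous.div (by fun_prop) (by fun_prop) fun p => ?_
        exact crossFactor_denom_ne_zero hqz hqw (hxc i) (circleMap_mem_sphere 1 hr0'.le _)
    have hswap : ∑ i, vandermondeProd (shiftVar q x i) * ((2 * Real.pi * Complex.I)⁻¹ *
          ∮ w in C(1, r₂), mixtureKernel β M q q x (x i) w *
            (shiftKernel q x w * crossFactor q (x i) w)) =
        (2 * Real.pi * Complex.I)⁻¹ * ∮ w in C(1, r₂), ∑ i, vandermondeProd (shiftVar q x i) *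
          (mixtureKernel β M q q x (x i) w * (shiftKernel q x w * crossFactor q (x i) w)) := by
      rw [circleIntegral.integral_fun_sum hint, Finset.mul_sum]
      refine Finset.sum_congr rfl fun i _ => ?_
      rw [circleIntegral.integral_const_mul]
      ring
    rw [hswap, mul_left_comm]
    congr 1
    rw [← circleIntegral.integral_const_mul]
    refine circleIntegral.integral_congr hr0'.le fun w hw => ?_
    have hw1 : w ∈ Metric.ball (1 : ℂ) 1 := by
      rw [Metric.mem_ball, Metric.mem_sphere.1 hw]; exact hr1
    have hK : DifferentiableOn ℂ (fun z => mixtureKernel β M q q x z w *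
        (shiftKernel q x w * crossFactor q z w)) (Metric.closedBall 1 r₁) := by
      refine ((differentiableOn_mixtureKernel M q q x hw1).mono hb₁).mul
        (DifferentiableOn.const_mul ?_ _)
      unfold crossFactor
      exact DifferentiableOn.div (by fun_prop) (by fun_prop) fun z hz =>
        crossFactor_denom_ne_zero hqz hqw hz hw
    exact sum_vandermonde_shiftVar_mul hN hq1 hr1' hxi hs hK

end Formulas

/-! ### Range of the coordinates -/

theorem integral_eq_sum_of_finite_support {Ω E : Type*} [MeasurableSpace Ω]
    [MeasurableSingletonClass Ω] [Countable Ω] [NormedAddCommGroup E] [NormedSpace ℝ E]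
    [CompleteSpace E] {ρ : Measure Ω} [IsFiniteMeasure ρ]
    (hfin : {ω | ρ.real {ω} ≠ 0}.Finite) (g : Ω → E) :
    Integrable g ρ ∧ ∫ ω, g ω ∂ρ = ∑ ω ∈ hfin.toFinset, ρ.real {ω} • g ω := by
  have hae : ∀ᵐ ω ∂ρ, ω ∈ (hfin.toFinset : Set Ω) := by
    rw [ae_iff_of_countable]
    intro ω hω
    simpa [measureReal_eq_zero_iff] using hω
  have hr : ρ.restrict (hfin.toFinset : Set Ω) = ρ := Measure.restrict_eq_self_of_ae_mem hae
  have hint : IntegrableOn g (hfin.toFinset : Set Ω) ρ := by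
    rw [← Set.biUnion_of_singleton (hfin.toFinset : Set Ω), integrableOn_finite_biUnion
      hfin.toFinset.finite_toSet]
    exact fun _ _ => integrableOn_singleton
  have h := setIntegral_finset hfin.toFinset hint
  rw [IntegrableOn, hr] at hint
  rw [hr] at h
  exact ⟨hint, h⟩

theorem norm_shiftRatio_le (q : ℂ) {z : ℂ} (hz : ‖z - 1‖ ≤ 1 / 2) (b : Set.Icc (0 : ℝ) 1) :
    ‖shiftRatio q z b‖ ≤ 1 + 3 * ‖q - 1‖ := by
  have hb : z ∈ Metric.ball (1 : ℂ) 1 := by rw [mem_ball_iff_norm]; linarith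
  have hne := one_sub_add_mul_ne_zero b hb
  have h : shiftRatio q z b = 1 + (q - 1) * (b * z / (1 - (b : ℂ) + b * z)) := by
    rw [shiftRatio]; field_simp; ring
  have h1 : (1 : ℝ) / 2 ≤ ‖1 - (b : ℂ) + b * z‖ := by
    linarith [norm_one_sub_add_mul_ge b z]
  have h2 : ‖(b : ℂ) * z‖ ≤ 3 / 2 := by
    rw [norm_mul, Complex.norm_real, Real.norm_of_nonneg b.2.1]
    have : ‖z‖ ≤ 3 / 2 := by
      have := norm_add_le (z - 1) 1
      rw [sub_add_cancel, norm_one] at this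
      linarith
    exact (mul_le_of_le_one_left (norm_nonneg _) b.2.2).trans this
  rw [h]
  refine (norm_add_le _ _).trans ?_
  rw [norm_one, norm_mul, norm_div]
  have h3 : ‖(b : ℂ) * z‖ / ‖1 - (b : ℂ) + b * z‖ ≤ 3 := by
    rw [div_le_iff₀ (by linarith)]
    linarith
  have := mul_le_mul_of_nonneg_left h3 (norm_nonneg (q - 1))
  linarith

theorem norm_mixtureKernel_one_le {N : ℕ} {β : Measure (Set.Icc (0 : ℝ) 1)}
    [IsProbabilityMeasure β] (M : ℕ) (q p : ℂ) {z w : ℂ} (hz : ‖z - 1‖ ≤ 1 / 2)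
    (hw : ‖w - 1‖ ≤ 1 / 2) :
    ‖mixtureKernel β M q p (1 : Fin N → ℂ) z w‖ ≤
      ((1 + 3 * ‖q - 1‖) * (1 + 3 * ‖p - 1‖)) ^ M := by
  rw [mixtureKernel, norm_pow]
  refine pow_le_pow_left₀ (norm_nonneg _) ?_ M
  have := norm_integral_le_of_norm_le_const (μ := β)
    (f := fun b => (∏ i : Fin N, (1 - (b : ℂ) + (1 : Fin N → ℂ) i * b)) * shiftRatio q z b *
      shiftRatio p w b) (C := (1 + 3 * ‖q - 1‖) * (1 + 3 * ‖p - 1‖)) (ae_of_all _ fun b => by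
      simp only [Pi.one_apply, one_mul, sub_add_cancel, Finset.prod_const_one, norm_mul]
      have h1 := norm_shiftRatio_le q hz b
      have h2 := norm_shiftRatio_le p hw b
      gcongr)
  simpa using this

theorem shiftKernel_one {N : ℕ} (q z : ℂ) (hz : z ≠ 1) : shiftKernel q (1 : Fin N → ℂ) z =
    ((q - 1) * z)⁻¹ * (1 + (q - 1) * (z / (z - 1))) ^ N := by
  have : z - 1 ≠ 0 := sub_ne_zero.2 hz
  simp only [shiftKernel, Pi.one_apply, Finset.prod_const, Finset.card_univ, Fintype.card_fin]
  congr 2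
  field_simp
  ring

theorem norm_shiftKernel_one_le {N : ℕ} (q : ℂ) {z : ℂ} (hz : ‖z - 1‖ ≤ 1 / 2)
    (hz' : 1 / 4 ≤ ‖z - 1‖) : ‖shiftKernel q (1 : Fin N → ℂ) z‖ ≤
      2 / ‖q - 1‖ * (1 + 6 * ‖q - 1‖) ^ N := by
  have hz1 : z ≠ 1 := by rintro rfl; norm_num at hz'
  have hz2 : ‖z‖ ≤ 3 / 2 := by
    have := norm_add_le (z - 1) 1
    rw [sub_add_cancel, norm_one] at this
    linarith
  have hz3 : 1 / 2 ≤ ‖z‖ := by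
    have := norm_sub_norm_le 1 (1 - z)
    rw [norm_one, norm_sub_rev, sub_sub_cancel] at this
    linarith
  rw [shiftKernel_one q z hz1, norm_mul, norm_inv, norm_mul, norm_pow, mul_inv, div_eq_mul_inv (2 : ℝ),
    mul_comm (2 : ℝ)]
  have h1 : ‖z‖⁻¹ ≤ 2 := by
    rw [inv_le_comm₀ (by linarith) (by norm_num)]; linarith
  have h2 : ‖1 + (q - 1) * (z / (z - 1))‖ ≤ 1 + 6 * ‖q - 1‖ := by
    refine (norm_add_le _ _).trans ?_
    rw [norm_one, norm_mul, norm_div]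
    have h3 : ‖z‖ / ‖z - 1‖ ≤ 6 := by
      rw [div_le_iff₀ (by linarith)]
      linarith
    have := mul_le_mul_of_nonneg_left h3 (norm_nonneg (q - 1))
    linarith
  gcongr

section Support

variable {N : ℕ} {ρ : Measure (Signature N)} [IsProbabilityMeasure ρ]
  {β : Measure (Set.Icc (0 : ℝ) 1)} [IsProbabilityMeasure β] {M : ℕ}

/-- A positive term of the expected power sum is bounded by the contour integral. -/
theorem mass_mul_zpow_le (hN : 1 ≤ N)
    (hS : HasSchurGeneratingFunction ρ (mixtureSGF (β.map Subtype.val) M)) {q : ℝ} (hq0 : 0 < q)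
    (hq1 : q ≠ 1) (lam : Signature N) (j : Fin N) :
    ρ.real {lam} * q ^ lam.coord j ≤ (1 + 6 * |q - 1|) ^ (N + M) / |q - 1| := by
  have hform := sum_psum_eq_circleIntegral hN hS (q := q) (by exact_mod_cast hq0.ne')
    (by exact_mod_cast hq1) (r := 1 / 2) (by norm_num) (by norm_num)
  have hqn : ‖(q : ℂ) - 1‖ = |q - 1| := by
    rw [← Complex.ofReal_one, ← Complex.ofReal_sub, Complex.norm_real, Real.norm_eq_abs]
  have hbound : ‖(2 * Real.pi * Complex.I : ℂ)⁻¹ * ∮ z in C(1, 1 / 2),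
      mixtureKernel β M q 1 (1 : Fin N → ℂ) z 1 * shiftKernel (q : ℂ) (1 : Fin N → ℂ) z‖ ≤
      1 / 2 * ((1 + 6 * |q - 1|) ^ M * (2 / |q - 1| * (1 + 6 * |q - 1|) ^ N)) := by
    rw [← smul_eq_mul]
    refine circleIntegral.norm_two_pi_i_inv_smul_integral_le_of_norm_le_const (by norm_num) fun z hz => ?_
    rw [mem_sphere_iff_norm] at hz
    rw [norm_mul]
    have h1 := norm_mixtureKernel_one_le (N := N) (β := β) M (q : ℂ) 1 (z := z) (w := 1) hz.le
      (by norm_num)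
    have h2 := norm_shiftKernel_one_le (N := N) (q : ℂ) (z := z) hz.le (by rw [hz]; norm_num)
    rw [hqn] at h1 h2
    have h3 : ((1 + 3 * |q - 1|) * (1 + 3 * ‖(1 : ℂ) - 1‖)) ^ M ≤ (1 + 6 * |q - 1|) ^ M := by
      have : 0 ≤ |q - 1| := abs_nonneg _
      refine pow_le_pow_left₀ (by positivity) ?_ M
      simp only [sub_self, norm_zero, mul_zero, add_zero, mul_one]
      linarith
    exact mul_le_mul (h1.trans h3) h2 (norm_nonneg _) (by positivity)
  rw [← hform] at hbound
  have hreal : ∑ lam ∈ (finite_support_map hN hS).toFinset, (ρ.real {lam} : ℂ) * lam.psum q =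
      ((∑ lam ∈ (finite_support_map hN hS).toFinset, ρ.real {lam} * ∑ j, q ^ lam.coord j : ℝ) : ℂ) := by
    push_cast
    rfl
  rw [hreal, Complex.norm_real] at hbound
  have hnn : ∀ lam : Signature N, 0 ≤ ρ.real {lam} * ∑ j, q ^ lam.coord j := fun lam =>
    mul_nonneg measureReal_nonneg (Finset.sum_nonneg fun j _ => (zpow_pos hq0 _).le)
  have h1 : ρ.real {lam} * q ^ lam.coord j ≤
      ∑ lam ∈ (finite_support_map hN hS).toFinset, ρ.real {lam} * ∑ j, q ^ lam.coord j := by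
    by_cases hl : ρ.real {lam} = 0
    · rw [hl, zero_mul]
      exact Finset.sum_nonneg fun lam _ => hnn lam
    · refine le_trans ?_ (Finset.single_le_sum (f := fun lam : Signature N =>
        ρ.real {lam} * ∑ j, q ^ lam.coord j) (fun lam _ => hnn lam) (by simpa using hl))
      exact mul_le_mul_of_nonneg_left (Finset.single_le_sum (f := fun j => q ^ lam.coord j)
        (fun j _ => (zpow_pos hq0 _).le) (Finset.mem_univ j)) measureReal_nonneg
  refine h1.trans ((le_abs_self _).trans (hbound.trans (le_of_eq ?_)))
  rw [pow_add]
  ring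

/-- Growth of the expected power sums as `q → 0` and `q → ∞` confines the coordinates. -/
theorem coord_mem_of_mass_ne_zero (hN : 1 ≤ N)
    (hS : HasSchurGeneratingFunction ρ (mixtureSGF (β.map Subtype.val) M)) {lam : Signature N}
    (hl : ρ.real {lam} ≠ 0) (j : Fin N) : 0 ≤ lam.coord j ∧ lam.coord j < N + M := by
  have hpos : 0 < ρ.real {lam} := lt_of_le_of_ne measureReal_nonneg (Ne.symm hl)
  set c := ρ.real {lam}
  constructor
  · by_contra hneg
    push Not at hneg
    -- the shift parameter is taken so extreme that the bound contradicts the mass `c`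
    obtain ⟨n, hn⟩ := exists_nat_gt (7 ^ (N + M) * 2 / c)
    set m : ℝ := (n : ℝ) + 2 with hm
    have hm2 : 2 ≤ m := by
      have : (0 : ℝ) ≤ n := Nat.cast_nonneg n
      linarith
    have h1 := mass_mul_zpow_le hN hS (q := m⁻¹) (by positivity)
      (fun h => by rw [inv_eq_one] at h; linarith) lam j
    have hinv : m⁻¹ ≤ 1 / 2 := by
      rw [inv_le_comm₀ (by linarith) (by norm_num)]; linarith
    have hinv0 : 0 < m⁻¹ := by positivity
    have habs : |m⁻¹ - 1| = 1 - m⁻¹ := by rw [abs_of_nonpos (by linarith)]; ring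
    rw [habs] at h1
    have h2 : m ≤ m⁻¹ ^ lam.coord j := by
      rw [inv_zpow', ← zpow_one m, ← zpow_mul]
      refine zpow_le_zpow_right₀ (by linarith) ?_
      omega
    have h3 : (1 + 6 * (1 - m⁻¹)) ^ (N + M) / (1 - m⁻¹) ≤ 7 ^ (N + M) / (1 / 2) := by
      gcongr
      · linarith
      · linarith
      · linarith
    have h4 : c * m ≤ 7 ^ (N + M) * 2 := by
      have := mul_le_mul_of_nonneg_left h2 hpos.le
      have e : (7 : ℝ) ^ (N + M) / (1 / 2) = 7 ^ (N + M) * 2 := by ring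
      linarith
    rw [div_lt_iff₀ hpos] at hn
    nlinarith
  · by_contra hge
    push Not at hge
    -- the shift parameter is taken so extreme that the bound contradicts the mass `c`
    obtain ⟨n, hn⟩ := exists_nat_gt (7 ^ (N + M) * 2 / c)
    set m : ℝ := (n : ℝ) + 2 with hm
    have hm2 : 2 ≤ m := by
      have : (0 : ℝ) ≤ n := Nat.cast_nonneg n
      linarith
    have h1 := mass_mul_zpow_le hN hS (q := m) (by positivity) (fun h => by linarith) lam j
    rw [abs_of_nonneg (by linarith)] at h1
    have h2 : m ^ (N + M) ≤ m ^ lam.coord j := by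
      rw [← zpow_natCast]
      refine zpow_le_zpow_right₀ (by linarith) ?_
      push_cast
      exact hge
    have h3 : (1 + 6 * (m - 1)) ^ (N + M) / (m - 1) ≤ (7 * m) ^ (N + M) / (m / 2) := by
      gcongr
      · linarith
      · linarith
      · linarith
    have hmp : 0 < m ^ (N + M) := by positivity
    have h4 : c * m ^ (N + M) * (m / 2) ≤ 7 ^ (N + M) * m ^ (N + M) := by
      have h5 := (mul_le_mul_of_nonneg_left h2 hpos.le).trans (h1.trans h3)
      rw [le_div_iff₀ (by linarith), mul_pow] at h5
      exact h5
    have h6 : c * (m / 2) ≤ 7 ^ (N + M) := by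
      refine le_of_mul_le_mul_right ?_ hmp
      linarith
    rw [div_lt_iff₀ hpos] at hn
    nlinarith

end Support

/-! ### Passage to the limit in the contour formulas -/

/-- `(1 + g_n) ^ m_n → e ^ L` if `g_n → 0` and `m_n g_n → L`. -/
theorem tendsto_one_add_pow_exp_of_tendsto_mul {g c : ℕ → ℂ} {m : ℕ → ℕ} {L : ℂ}
    (hg : Tendsto g atTop (𝓝 0)) (hc : ∀ n, c n = m n * g n) (hm : Tendsto c atTop (𝓝 L)) :
    Tendsto (fun n => (1 + g n) ^ m n) atTop (𝓝 (Complex.exp L)) := by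
  have hlog : Tendsto (fun n => (m n : ℂ) * Complex.log (1 + g n)) atTop (𝓝 L) := by
    have hsmall : ∀ᶠ n in atTop, ‖g n‖ < 1 / 2 := by
      have := hg.norm
      rw [norm_zero] at this
      exact this.eventually_lt_const (by norm_num)
    have hdiff : Tendsto (fun n => (m n : ℂ) * Complex.log (1 + g n) - c n) atTop (𝓝 0) := by
      rw [tendsto_zero_iff_norm_tendsto_zero]
      have hup : Tendsto (fun n => ‖c n‖ * ‖g n‖) atTop (𝓝 0) := by
        have := hm.norm.mul hg.norm
        simpa using this
      refine squeeze_zero' (Eventually.of_forall fun n => norm_nonneg _) ?_ hup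
      filter_upwards [hsmall] with n hn
      rw [hc, ← mul_sub, norm_mul, norm_mul]
      have h1 := Complex.norm_log_one_add_sub_self_le (z := g n) (by linarith)
      have h2 : (1 - ‖g n‖)⁻¹ ≤ 2 := by
        rw [inv_le_comm₀ (by linarith) (by norm_num)]; linarith
      have h3 : ‖Complex.log (1 + g n) - g n‖ ≤ ‖g n‖ * ‖g n‖ := by
        refine h1.trans ?_
        have : 0 ≤ ‖g n‖ ^ 2 := by positivity
        nlinarith
      have := mul_le_mul_of_nonneg_left h3 (norm_nonneg (m n : ℂ))
      linarith
    have := hdiff.add hm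
    simpa using this
  refine ((Complex.continuous_exp.tendsto L).comp hlog).congr' ?_
  have hne : ∀ᶠ n in atTop, 1 + g n ≠ 0 := by
    have : Tendsto (fun n => 1 + g n) atTop (𝓝 (1 + 0)) := hg.const_add 1
    exact this.eventually_ne (by simp)
  filter_upwards [hne] with n hn
  rw [Function.comp, Complex.exp_nat_mul, Complex.exp_log hn]

theorem tendsto_circleIntegral {f : ℕ → ℂ → ℂ} {g : ℂ → ℂ} {c : ℂ} {r : ℝ} (hr : 0 ≤ r) {C : ℝ}
    (hf : ∀ᶠ n in atTop, Continuous fun θ => f n (circleMap c r θ))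
    (hb : ∀ᶠ n in atTop, ∀ z ∈ Metric.sphere c r, ‖f n z‖ ≤ C)
    (hl : ∀ z ∈ Metric.sphere c r, Tendsto (fun n => f n z) atTop (𝓝 (g z))) :
    Tendsto (fun n => ∮ z in C(c, r), f n z) atTop (𝓝 (∮ z in C(c, r), g z)) := by
  unfold circleIntegral
  refine intervalIntegral.tendsto_integral_filter_of_dominated_convergence (fun _ => r * C) ?_ ?_ ?_ ?_
  · filter_upwards [hf] with n hn
    refine Continuous.aestronglyMeasurable ?_
    simp only [deriv_circleMap, smul_eq_mul]
    exact Continuous.mul (by fun_prop) hn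
  · filter_upwards [hb] with n hn
    refine ae_of_all _ fun θ _ => ?_
    rw [norm_smul, deriv_circleMap, norm_mul, Complex.norm_I, mul_one, norm_circleMap_zero,
      abs_of_nonneg hr]
    exact mul_le_mul_of_nonneg_left (hn _ (circleMap_mem_sphere c hr θ)) hr
  · exact intervalIntegrable_const
  · exact ae_of_all _ fun θ _ => (hl _ (circleMap_mem_sphere c hr θ)).const_smul _

/-- `E[b z / (1 - b + b z)]`. -/
noncomputable def weightedMean (β : Measure (Set.Icc (0 : ℝ) 1)) (z : ℂ) : ℂ :=
  ∫ b, (b : ℂ) * z / (1 - (b : ℂ) + b * z) ∂β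

theorem continuous_mul_div_affine {z : ℂ} (hz : z ∈ Metric.ball (1 : ℂ) 1) :
    Continuous fun b : Set.Icc (0 : ℝ) 1 => (b : ℂ) * z / (1 - (b : ℂ) + b * z) :=
  continuous_div_affine (continuous_unitInterval_coe.mul continuous_const) hz

theorem shiftRatio_eq_one_add (q : ℂ) {z : ℂ} (hz : z ∈ Metric.ball (1 : ℂ) 1)
    (b : Set.Icc (0 : ℝ) 1) :
    shiftRatio q z b = 1 + (q - 1) * ((b : ℂ) * z / (1 - (b : ℂ) + b * z)) := by
  have hne := one_sub_add_mul_ne_zero b hz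
  rw [shiftRatio]
  field_simp
  ring

theorem mixtureKernel_one_eq {N : ℕ} (β : Measure (Set.Icc (0 : ℝ) 1)) [IsProbabilityMeasure β]
    (M : ℕ) (q p : ℂ) {z w : ℂ} (hz : z ∈ Metric.ball (1 : ℂ) 1) (hw : w ∈ Metric.ball (1 : ℂ) 1) :
    mixtureKernel β M q p (1 : Fin N → ℂ) z w =
      (1 + ((q - 1) * weightedMean β z + (p - 1) * weightedMean β w + (q - 1) * (p - 1) *
        ∫ b, (b : ℂ) * z / (1 - (b : ℂ) + b * z) * (b * w / (1 - (b : ℂ) + b * w)) ∂β)) ^ M := by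
  have c1 := continuous_mul_div_affine hz
  have c2 := continuous_mul_div_affine hw
  rw [mixtureKernel]
  congr 1
  have h : ∀ b : Set.Icc (0 : ℝ) 1, (∏ i : Fin N, (1 - (b : ℂ) + (1 : Fin N → ℂ) i * b)) *
      shiftRatio q z b * shiftRatio p w b = 1 + ((q - 1) * ((b : ℂ) * z / (1 - (b : ℂ) + b * z)) +
        (p - 1) * ((b : ℂ) * w / (1 - (b : ℂ) + b * w)) + (q - 1) * (p - 1) *
        ((b : ℂ) * z / (1 - (b : ℂ) + b * z) * (b * w / (1 - (b : ℂ) + b * w)))) := by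
    intro b
    rw [shiftRatio_eq_one_add q hz, shiftRatio_eq_one_add p hw]
    simp only [Pi.one_apply, one_mul, sub_add_cancel, Finset.prod_const_one]
    ring
  simp_rw [h]
  have i1 := (integrable_of_continuous_unitInterval (β := β) c1).const_mul (q - 1)
  have i2 := (integrable_of_continuous_unitInterval (β := β) c2).const_mul (p - 1)
  have i3 := (integrable_of_continuous_unitInterval (β := β) (c1.fun_mul c2)).const_mul
    ((q - 1) * (p - 1))
  rw [integral_add (integrable_const _) ((i1.fun_add i2).fun_add i3),
    integral_add (i1.fun_add i2) i3, integral_add i1 i2, integral_const_mul, integral_const_mul,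
    integral_const_mul]
  simp [weightedMean]

theorem limitF_map (a : ℝ) (β : Measure (Set.Icc (0 : ℝ) 1)) (z : ℂ) :
    limitF a (β.map Subtype.val) z = z / (z - 1) + a * weightedMean β z := by
  rw [limitF, (MeasurableEmbedding.subtype_coe measurableSet_Icc).integral_map, weightedMean,
    mul_assoc, ← integral_const_mul]
  congr 3
  ext b
  ring

/-- The shift parameter `e ^ (t / N)`. -/
noncomputable def scaledShift (t : ℝ) (N : ℕ) : ℂ := ((Real.exp (t / N) : ℝ) : ℂ)

theorem tendsto_nat_mul_scaledShift_sub_one {t : ℝ} (ht : t ≠ 0) :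
    Tendsto (fun N : ℕ => (N : ℂ) * (scaledShift t N - 1)) atTop (𝓝 (t : ℂ)) := by
  have h := (hasDerivAt_iff_tendsto_slope.1 (Real.hasDerivAt_exp 0))
  have hu : Tendsto (fun N : ℕ => t / (N : ℝ)) atTop (𝓝[≠] 0) := by
    refine tendsto_nhdsWithin_iff.2 ⟨tendsto_const_div_atTop_nhds_zero_nat t, ?_⟩
    filter_upwards [eventually_ge_atTop 1] with N hN
    have : (N : ℝ) ≠ 0 := by positivity
    simpa using ⟨ht, by omega⟩
  have h2 := (h.comp hu).const_mul t
  rw [Real.exp_zero, mul_one] at h2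
  have h3 : Tendsto (fun N : ℕ => (N : ℝ) * (Real.exp (t / N) - 1)) atTop (𝓝 t) := by
    refine h2.congr' ?_
    filter_upwards [eventually_ge_atTop 1] with N hN
    have : (N : ℝ) ≠ 0 := by positivity
    simp only [Function.comp, slope, vsub_eq_sub, sub_zero, Real.exp_zero, smul_eq_mul]
    field_simp
  have := (Complex.continuous_ofReal.tendsto t).comp h3
  refine this.congr fun N => ?_
  simp [scaledShift]

theorem tendsto_scaledShift_sub_one {t : ℝ} :
    Tendsto (fun N : ℕ => scaledShift t N - 1) atTop (𝓝 0) := by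
  have h : Tendsto (fun N : ℕ => Real.exp (t / N)) atTop (𝓝 1) := by
    have := (Real.continuous_exp.tendsto 0).comp (tendsto_const_div_atTop_nhds_zero_nat t)
    rwa [Real.exp_zero] at this
  have h2 := ((Complex.continuous_ofReal.tendsto 1).comp h).sub_const 1
  simpa [scaledShift, Function.comp_def] using h2

theorem tendsto_mul_scaledShift_sub_one {t : ℝ} (ht : t ≠ 0) {M : ℕ → ℕ} {a : ℝ}
    (hM : Tendsto (fun N => (M N : ℝ) / (N : ℝ)) atTop (𝓝 a)) :
    Tendsto (fun N : ℕ => (M N : ℂ) * (scaledShift t N - 1)) atTop (𝓝 (a * t : ℂ)) := by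
  have h := ((Complex.continuous_ofReal.tendsto a).comp hM).mul
    (tendsto_nat_mul_scaledShift_sub_one ht)
  refine h.congr' ?_
  filter_upwards [eventually_ge_atTop 1] with N hN
  have : (N : ℂ) ≠ 0 := by exact_mod_cast (by omega : N ≠ 0)
  simp only [Function.comp]
  push_cast
  field_simp

theorem scaledShift_ne_one {t : ℝ} (ht : t ≠ 0) {N : ℕ} (hN : 1 ≤ N) : scaledShift t N ≠ 1 := by
  intro h
  rw [scaledShift, Complex.ofReal_eq_one, Real.exp_eq_one_iff] at h
  have : (N : ℝ) ≠ 0 := by positivity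
  rw [div_eq_zero_iff] at h
  tauto

theorem scaledShift_ne_zero (t : ℝ) (N : ℕ) : scaledShift t N ≠ 0 := by
  rw [scaledShift, Complex.ofReal_ne_zero]
  exact (Real.exp_pos _).ne'

/-- The limiting transform `(2 π i)⁻¹ ∮ exp (t 𝓕(z)) / (t z) dz`. -/
noncomputable def limitTransform (a : ℝ) (B : Measure ℝ) (t r : ℝ) : ℂ :=
  (2 * Real.pi * Complex.I)⁻¹ * ∮ z in C(1, r), Complex.exp (t * limitF a B z) * ((t : ℂ) * z)⁻¹

theorem tendsto_shiftKernel {t : ℝ} (ht : t ≠ 0) {z : ℂ} (hz : z ≠ 1) (hz0 : z ≠ 0) :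
    Tendsto (fun N : ℕ => (N : ℂ)⁻¹ * shiftKernel (scaledShift t N) (1 : Fin N → ℂ) z) atTop
      (𝓝 (Complex.exp (t * (z / (z - 1))) * ((t : ℂ) * z)⁻¹)) := by
  have h1 : Tendsto (fun N : ℕ => (1 + (scaledShift t N - 1) * (z / (z - 1))) ^ N) atTop
      (𝓝 (Complex.exp (t * (z / (z - 1))))) := by
    refine tendsto_one_add_pow_exp_of_tendsto_mul (m := fun N => N)
      (c := fun N => (N : ℂ) * (scaledShift t N - 1) * (z / (z - 1))) ?_ (fun N => by ring) ?_
    · simpa using (tendsto_scaledShift_sub_one (t := t)).mul_const (z / (z - 1))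
    · exact (tendsto_nat_mul_scaledShift_sub_one ht).mul_const _
  have h2 : Tendsto (fun N : ℕ => ((N : ℂ) * (scaledShift t N - 1) * z)⁻¹) atTop
      (𝓝 ((t : ℂ) * z)⁻¹) :=
    ((tendsto_nat_mul_scaledShift_sub_one ht).mul_const z).inv₀
      (mul_ne_zero (by exact_mod_cast ht) hz0)
  refine (h1.mul h2).congr fun N => ?_
  rw [shiftKernel_one _ _ hz, mul_assoc, mul_inv, mul_comm, mul_assoc]

theorem eventually_norm_shift_bounds {t : ℝ} (ht : t ≠ 0) {M : ℕ → ℕ} {a : ℝ}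
    (hM : Tendsto (fun N => (M N : ℝ) / (N : ℝ)) atTop (𝓝 a)) :
    ∀ᶠ N : ℕ in atTop, |t| / 2 ≤ N * ‖scaledShift t N - 1‖ ∧
      N * ‖scaledShift t N - 1‖ ≤ |t| + 1 ∧ M N * ‖scaledShift t N - 1‖ ≤ |a * t| + 1 ∧
      ‖scaledShift t N - 1‖ ≤ 1 / 10 := by
  have h1 := (tendsto_nat_mul_scaledShift_sub_one ht).norm
  have h2 := (tendsto_mul_scaledShift_sub_one ht hM).norm
  have h3 := (tendsto_scaledShift_sub_one (t := t)).norm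
  simp only [norm_mul, Complex.norm_natCast, Complex.norm_real, Real.norm_eq_abs, norm_zero]
    at h1 h2 h3
  have ht' : 0 < |t| := abs_pos.2 ht
  filter_upwards [h1.eventually_const_lt (by linarith : |t| / 2 < |t|),
    h1.eventually_lt_const (by linarith : |t| < |t| + 1),
    h2.eventually_lt_const (by linarith : |a| * |t| < |a| * |t| + 1),
    h3.eventually_lt_const (by norm_num : (0 : ℝ) < 1 / 10)] with N b1 b2 b3 b4
  rw [abs_mul]
  exact ⟨b1.le, b2.le, b3.le, b4.le⟩

/-- A uniform bound for the rescaled kernels on the contours. -/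
noncomputable def kernelBound (t : ℝ) : ℝ := 4 / |t| * Real.exp (6 * (|t| + 1))

theorem kernelBound_nonneg (t : ℝ) : 0 ≤ kernelBound t := by
  unfold kernelBound; positivity

theorem one_add_pow_le_exp {x : ℝ} (hx : 0 ≤ x) (n : ℕ) : (1 + x) ^ n ≤ Real.exp (n * x) := by
  rw [Real.exp_nat_mul]
  refine pow_le_pow_left₀ (by linarith) ?_ n
  linarith [Real.add_one_le_exp x]

theorem norm_scaled_shiftKernel_le {t : ℝ} (ht : t ≠ 0) {N : ℕ}
    (h1 : |t| / 2 ≤ N * ‖scaledShift t N - 1‖) (h2 : N * ‖scaledShift t N - 1‖ ≤ |t| + 1)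
    {z : ℂ} (hz : ‖z - 1‖ ≤ 1 / 2) (hz' : 1 / 4 ≤ ‖z - 1‖) :
    ‖(N : ℂ)⁻¹ * shiftKernel (scaledShift t N) (1 : Fin N → ℂ) z‖ ≤ kernelBound t := by
  have ht' : 0 < |t| := abs_pos.2 ht
  rw [norm_mul, norm_inv, Complex.norm_natCast]
  have h3 := norm_shiftKernel_one_le (N := N) (scaledShift t N) hz hz'
  set d := ‖scaledShift t N - 1‖ with hd
  have hd0 : 0 ≤ d := norm_nonneg _
  have h4 : (1 + 6 * d) ^ N ≤ Real.exp (6 * (|t| + 1)) := by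
    refine (one_add_pow_le_exp (by positivity) N).trans (Real.exp_le_exp.2 ?_)
    linarith
  have h5 : (N : ℝ)⁻¹ * (2 / d) ≤ 4 / |t| := by
    have : (N : ℝ)⁻¹ * (2 / d) = 2 / (N * d) := by
      rw [div_eq_mul_inv, div_eq_mul_inv, mul_inv]; ring
    rw [this, div_le_div_iff₀ (by linarith) ht']
    linarith
  calc (N : ℝ)⁻¹ * ‖shiftKernel (scaledShift t N) (1 : Fin N → ℂ) z‖
      ≤ (N : ℝ)⁻¹ * (2 / d * (1 + 6 * d) ^ N) := by gcongr
    _ = (N : ℝ)⁻¹ * (2 / d) * (1 + 6 * d) ^ N := by ring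
    _ ≤ kernelBound t := by
      unfold kernelBound
      gcongr

theorem norm_mixtureKernel_one_le_exp {N : ℕ} {β : Measure (Set.Icc (0 : ℝ) 1)}
    [IsProbabilityMeasure β] {M : ℕ} {q p : ℂ} {z w : ℂ} (hz : ‖z - 1‖ ≤ 1 / 2)
    (hw : ‖w - 1‖ ≤ 1 / 2) {c : ℝ} (hp : ‖p - 1‖ ≤ ‖q - 1‖) (hq : M * ‖q - 1‖ ≤ c) :
    ‖mixtureKernel β M q p (1 : Fin N → ℂ) z w‖ ≤ Real.exp (6 * c) := by
  refine (norm_mixtureKernel_one_le M q p hz hw).trans ?_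
  have h0 : 0 ≤ ‖q - 1‖ := norm_nonneg _
  have h1 : ((1 + 3 * ‖q - 1‖) * (1 + 3 * ‖p - 1‖)) ^ M ≤
      ((1 + 3 * ‖q - 1‖) ^ M) * (1 + 3 * ‖q - 1‖) ^ M := by
    rw [← mul_pow]
    gcongr
  refine h1.trans ?_
  have h2 := one_add_pow_le_exp (x := 3 * ‖q - 1‖) (by positivity) M
  calc _ ≤ Real.exp (M * (3 * ‖q - 1‖)) * Real.exp (M * (3 * ‖q - 1‖)) := by gcongr
    _ = Real.exp (6 * (M * ‖q - 1‖)) := by rw [← Real.exp_add]; congr 1; ring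
    _ ≤ _ := Real.exp_le_exp.2 (by linarith)

theorem tendsto_mixtureKernel {β : Measure (Set.Icc (0 : ℝ) 1)} [IsProbabilityMeasure β] {t : ℝ}
    (ht : t ≠ 0) {M : ℕ → ℕ} {a : ℝ} (hM : Tendsto (fun N => (M N : ℝ) / (N : ℝ)) atTop (𝓝 a))
    {z w : ℂ} (hz : z ∈ Metric.ball (1 : ℂ) 1) (hw : w ∈ Metric.ball (1 : ℂ) 1) :
    Tendsto (fun N => mixtureKernel β (M N) (scaledShift t N) 1 (1 : Fin N → ℂ) z 1) atTop
        (𝓝 (Complex.exp (t * (a * weightedMean β z)))) ∧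
      Tendsto (fun N => mixtureKernel β (M N) (scaledShift t N) (scaledShift t N)
        (1 : Fin N → ℂ) z w) atTop
        (𝓝 (Complex.exp (t * (a * weightedMean β z) + t * (a * weightedMean β w)))) := by
  have hδ := tendsto_scaledShift_sub_one (t := t)
  have hMδ := tendsto_mul_scaledShift_sub_one ht hM
  constructor
  · simp_rw [mixtureKernel_one_eq β _ _ _ hz (by simp : (1 : ℂ) ∈ Metric.ball (1 : ℂ) 1)]
    simp only [sub_self, zero_mul, mul_zero, add_zero]
    refine tendsto_one_add_pow_exp_of_tendsto_mul
      (c := fun N => (M N : ℂ) * (scaledShift t N - 1) * weightedMean β z) ?_ (fun N => by ring) ?_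
    · simpa using hδ.mul_const (weightedMean β z)
    · convert hMδ.mul_const (weightedMean β z) using 2
      ring
  · simp_rw [mixtureKernel_one_eq β _ _ _ hz hw]
    set u := ∫ b, (b : ℂ) * z / (1 - (b : ℂ) + b * z) * (b * w / (1 - (b : ℂ) + b * w)) ∂β
    refine tendsto_one_add_pow_exp_of_tendsto_mul
      (c := fun N => (M N : ℂ) * (scaledShift t N - 1) * weightedMean β z +
        (M N : ℂ) * (scaledShift t N - 1) * weightedMean β w +
        (M N : ℂ) * (scaledShift t N - 1) * (scaledShift t N - 1) * u) ?_ (fun N => by ring) ?_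
    · have := ((hδ.mul_const (weightedMean β z)).add (hδ.mul_const (weightedMean β w))).add
        ((hδ.mul hδ).mul_const u)
      simpa using this
    · have := ((hMδ.mul_const (weightedMean β z)).add (hMδ.mul_const (weightedMean β w))).add
        ((hMδ.mul hδ).mul_const u)
      convert this using 2
      ring

theorem tendsto_single_contour {β : Measure (Set.Icc (0 : ℝ) 1)} [IsProbabilityMeasure β] {t : ℝ}
    (ht : t ≠ 0) {M : ℕ → ℕ} {a : ℝ} (hM : Tendsto (fun N => (M N : ℝ) / (N : ℝ)) atTop (𝓝 a))
    {r : ℝ} (hr4 : 1 / 4 ≤ r) (hr2 : r ≤ 1 / 2) :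
    Tendsto (fun N : ℕ => (N : ℂ)⁻¹ * ((2 * Real.pi * Complex.I)⁻¹ *
      ∮ z in C(1, r), mixtureKernel β (M N) (scaledShift t N) 1 (1 : Fin N → ℂ) z 1 *
        shiftKernel (scaledShift t N) (1 : Fin N → ℂ) z)) atTop
      (𝓝 (limitTransform a (β.map Subtype.val) t r)) := by
  have hr0 : 0 < r := by linarith
  have hr1 : r < 1 := by linarith
  have hmove : ∀ N : ℕ, (N : ℂ)⁻¹ * ((2 * Real.pi * Complex.I)⁻¹ *
      ∮ z in C(1, r), mixtureKernel β (M N) (scaledShift t N) 1 (1 : Fin N → ℂ) z 1 *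
        shiftKernel (scaledShift t N) (1 : Fin N → ℂ) z) = (2 * Real.pi * Complex.I)⁻¹ *
      ∮ z in C(1, r), mixtureKernel β (M N) (scaledShift t N) 1 (1 : Fin N → ℂ) z 1 *
        ((N : ℂ)⁻¹ * shiftKernel (scaledShift t N) (1 : Fin N → ℂ) z) := by
    intro N
    rw [mul_left_comm, ← circleIntegral.integral_const_mul]
    congr 2
    ext z
    ring
  simp_rw [hmove]
  refine Tendsto.const_mul _ ?_
  refine tendsto_circleIntegral hr0.le (C := Real.exp (6 * (|a * t| + 1)) * kernelBound t) ?_ ?_ ?_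
  · filter_upwards [eventually_ge_atTop 1] with N hN
    refine Continuous.mul ?_ (Continuous.mul continuous_const ?_)
    · exact continuous_mixtureKernel _ _ _ continuous_const (continuous_circleMap 1 r)
        (fun _ => circleMap_mem_ball_one hr0.le hr1 _) continuous_const (fun _ => by simp)
    · exact continuous_shiftKernel (scaledShift_ne_one ht hN) continuous_const
        (continuous_circleMap 1 r)
        (fun _ => ne_zero_of_mem_ball_one (circleMap_mem_ball_one hr0.le hr1 _))
        (fun p i => circleMap_ne_of_mem_ball (by simp [hr0]) _)
  · filter_upwards [eventually_norm_shift_bounds ht hM] with N ⟨b1, b2, b3, b4⟩ z hz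
    rw [mem_sphere_iff_norm] at hz
    rw [norm_mul]
    exact mul_le_mul (norm_mixtureKernel_one_le_exp (by rw [hz]; exact hr2) (by norm_num)
      (by simp) b3) (norm_scaled_shiftKernel_le ht b1 b2 (by rw [hz]; exact hr2)
        (by rw [hz]; exact hr4)) (norm_nonneg _) (Real.exp_pos _).le
  · intro z hz
    have hzb : z ∈ Metric.ball (1 : ℂ) 1 := by
      rw [Metric.mem_ball, Metric.mem_sphere.1 hz]; exact hr1
    have hz1 : z ≠ 1 := by
      rintro rfl
      rw [Metric.mem_sphere, dist_self] at hz
      linarith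
    have h := (tendsto_mixtureKernel (β := β) ht hM hzb hzb).1.mul
      (tendsto_shiftKernel ht hz1 (ne_zero_of_mem_ball_one hzb))
    convert h using 2
    rw [limitF_map, ← mul_assoc, ← Complex.exp_add]
    congr 2
    ring

theorem tendsto_crossFactor {t : ℝ} {z w : ℂ} (hzw : w ≠ z) :
    Tendsto (fun N => crossFactor (scaledShift t N) z w) atTop (𝓝 1) := by
  have hq : Tendsto (fun N => scaledShift t N) atTop (𝓝 1) := by
    have := (tendsto_scaledShift_sub_one (t := t)).add_const 1
    simpa using this
  have hne : (w - 1 * z) * (1 * w - z) ≠ 0 := by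
    simpa using sub_ne_zero.2 hzw
  have := (((hq.mul_const w).sub (hq.mul_const z)).mul_const (w - z)).div
    (((tendsto_const_nhds (x := w)).sub (hq.mul_const z)).mul ((hq.mul_const w).sub_const z)) hne
  have e : (1 * w - 1 * z) * (w - z) / ((w - 1 * z) * (1 * w - z)) = 1 := by
    rw [div_eq_one_iff_eq hne]; ring
  rw [e] at this
  exact this

theorem norm_crossFactor_le {q z w : ℂ} (hq : ‖q - 1‖ ≤ 1 / 10) (hz : ‖z - 1‖ = 1 / 4)
    (hw : ‖w - 1‖ = 1 / 2) : ‖crossFactor q z w‖ ≤ 100 := by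
  have hz0 : ‖z‖ ≤ 5 / 4 := by
    have := norm_add_le (z - 1) 1
    rw [sub_add_cancel, norm_one] at this
    linarith
  have hw0 : ‖w‖ ≤ 3 / 2 := by
    have := norm_add_le (w - 1) 1
    rw [sub_add_cancel, norm_one] at this
    linarith
  have hq0 : ‖q‖ ≤ 11 / 10 := by
    have := norm_add_le (q - 1) 1
    rw [sub_add_cancel, norm_one] at this
    linarith
  have hwz : ‖w - z‖ ≤ 3 / 4 := by
    have := norm_sub_le (w - 1) (z - 1)
    rw [sub_sub_sub_cancel_right] at this
    linarith
  have hwz' : 1 / 4 ≤ ‖w - z‖ := by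
    have := norm_sub_norm_le (w - 1) (z - 1)
    rw [sub_sub_sub_cancel_right] at this
    linarith
  have h1 : 1 / 10 ≤ ‖w - q * z‖ := by
    have e : w - q * z = (w - z) - (q - 1) * z := by ring
    rw [e]
    have := norm_sub_norm_le (w - z) ((q - 1) * z)
    have h : ‖(q - 1) * z‖ ≤ 1 / 10 * (5 / 4) := by rw [norm_mul]; gcongr
    linarith
  have h2 : 1 / 10 ≤ ‖q * w - z‖ := by
    have e : q * w - z = (w - z) - -((q - 1) * w) := by ring
    rw [e]
    have := norm_sub_norm_le (w - z) (-((q - 1) * w))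
    have h : ‖-((q - 1) * w)‖ ≤ 1 / 10 * (3 / 2) := by rw [norm_neg, norm_mul]; gcongr
    linarith
  rw [crossFactor, norm_div, norm_mul, norm_mul, ← mul_sub, norm_mul]
  have h3 : 1 / 10 * (1 / 10) ≤ ‖w - q * z‖ * ‖q * w - z‖ := by gcongr
  rw [div_le_iff₀ (by linarith)]
  have h4 : ‖q‖ * ‖w - z‖ * ‖w - z‖ ≤ 11 / 10 * (3 / 4) * (3 / 4) := by gcongr
  linarith

/-- The circles of radii `1 / 4` and `1 / 2` are nested as the double contour formula requires, for
`q` near `1`. -/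
theorem scaledShift_contours {q : ℂ} (hq : ‖q - 1‖ ≤ 1 / 10) :
    (∀ z ∈ Metric.closedBall (1 : ℂ) (1 / 4), q * z ∈ Metric.ball (1 : ℂ) (1 / 2)) ∧
      ∀ w ∈ Metric.sphere (1 : ℂ) (1 / 2), q * w ∉ Metric.closedBall (1 : ℂ) (1 / 4) := by
  have hb : ∀ z : ℂ, ‖z - 1‖ ≤ 1 / 2 → ‖(q - 1) * z‖ ≤ 1 / 10 * (3 / 2) := by
    intro z hz
    have := norm_add_le (z - 1) 1
    rw [sub_add_cancel, norm_one] at this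
    have hz0 : ‖z‖ ≤ 3 / 2 := by linarith
    rw [norm_mul]
    gcongr
  constructor
  · intro z hz
    rw [mem_closedBall_iff_norm] at hz
    rw [mem_ball_iff_norm]
    have e : q * z - 1 = (z - 1) + (q - 1) * z := by ring
    rw [e]
    have := norm_add_le (z - 1) ((q - 1) * z)
    have := hb z (by linarith)
    linarith
  · intro w hw hcon
    rw [mem_sphere_iff_norm] at hw
    rw [mem_closedBall_iff_norm] at hcon
    have e : w - 1 = (q * w - 1) - (q - 1) * w := by ring
    have := norm_sub_le (q * w - 1) ((q - 1) * w)
    rw [← e] at this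
    have := hb w hw.le
    linarith

/-- Since the cross factor tends to `1`, the second moment decouples in the limit. -/
theorem tendsto_double_contour {β : Measure (Set.Icc (0 : ℝ) 1)} [IsProbabilityMeasure β] {t : ℝ}
    (ht : t ≠ 0) {M : ℕ → ℕ} {a : ℝ} (hM : Tendsto (fun N => (M N : ℝ) / (N : ℝ)) atTop (𝓝 a)) :
    Tendsto (fun N : ℕ => (N : ℂ)⁻¹ ^ 2 * ((2 * Real.pi * Complex.I)⁻¹ *
      ∮ w in C(1, 1 / 2), (2 * Real.pi * Complex.I)⁻¹ * ∮ z in C(1, 1 / 4),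
        doubleIntegrand β (M N) (scaledShift t N) (1 : Fin N → ℂ) z w)) atTop
      (𝓝 (limitTransform a (β.map Subtype.val) t (1 / 2) *
        limitTransform a (β.map Subtype.val) t (1 / 4))) := by
  set B := β.map Subtype.val with hB
  set D := Real.exp (6 * (|a * t| + 1)) * kernelBound t * 100 * kernelBound t with hD
  have hD0 : 0 ≤ D := by
    have := kernelBound_nonneg t
    positivity
  set f : ℕ → ℂ → ℂ → ℂ := fun N w z => (N : ℂ)⁻¹ ^ 2 *
    doubleIntegrand β (M N) (scaledShift t N) (1 : Fin N → ℂ) z w with hf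
  have hmove : ∀ N : ℕ, (N : ℂ)⁻¹ ^ 2 * ((2 * Real.pi * Complex.I)⁻¹ *
      ∮ w in C(1, 1 / 2), (2 * Real.pi * Complex.I)⁻¹ * ∮ z in C(1, 1 / 4),
        doubleIntegrand β (M N) (scaledShift t N) (1 : Fin N → ℂ) z w) =
      (2 * Real.pi * Complex.I)⁻¹ *
      ∮ w in C(1, 1 / 2), (2 * Real.pi * Complex.I)⁻¹ * ∮ z in C(1, 1 / 4), f N w z := by
    intro N
    simp only [hf]
    rw [mul_left_comm, ← circleIntegral.integral_const_mul]
    congr 2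
    ext w
    rw [circleIntegral.integral_const_mul]
    ring
  simp_rw [hmove]
  have hlimeq : limitTransform a B t (1 / 2) * limitTransform a B t (1 / 4) =
      (2 * Real.pi * Complex.I)⁻¹ * ∮ w in C(1, 1 / 2), (2 * Real.pi * Complex.I)⁻¹ *
        ∮ z in C(1, 1 / 4), (Complex.exp (t * limitF a B w) * ((t : ℂ) * w)⁻¹) *
          (Complex.exp (t * limitF a B z) * ((t : ℂ) * z)⁻¹) := by
    simp only [limitTransform]
    simp_rw [circleIntegral.integral_const_mul]
    generalize (∮ z in C(1, 1 / 4), Complex.exp (t * limitF a B z) * ((t : ℂ) * z)⁻¹) = J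
    have e : ∀ w : ℂ, (Complex.exp (t * limitF a B w) * ((t : ℂ) * w)⁻¹) * J =
        J * (Complex.exp (t * limitF a B w) * ((t : ℂ) * w)⁻¹) := fun w => mul_comm _ _
    simp_rw [e, circleIntegral.integral_const_mul]
    ring
  rw [hlimeq]
  have hsphere : ∀ w ∈ Metric.sphere (1 : ℂ) (1 / 2), ∀ z ∈ Metric.sphere (1 : ℂ) (1 / 4),
      w ≠ z := by
    rintro w hw z hz rfl
    rw [Metric.mem_sphere] at hw hz
    rw [hw] at hz
    norm_num at hz
  have hbound : ∀ᶠ N : ℕ in atTop, ∀ w ∈ Metric.sphere (1 : ℂ) (1 / 2),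
      ∀ z ∈ Metric.sphere (1 : ℂ) (1 / 4), ‖f N w z‖ ≤ D := by
    filter_upwards [eventually_norm_shift_bounds ht hM] with N ⟨b1, b2, b3, b4⟩ w hw z hz
    rw [mem_sphere_iff_norm] at hz hw
    have e : f N w z = mixtureKernel β (M N) (scaledShift t N) (scaledShift t N)
        (1 : Fin N → ℂ) z w * ((N : ℂ)⁻¹ * shiftKernel (scaledShift t N) (1 : Fin N → ℂ) w) *
        crossFactor (scaledShift t N) z w *
        ((N : ℂ)⁻¹ * shiftKernel (scaledShift t N) (1 : Fin N → ℂ) z) := by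
      simp only [hf, doubleIntegrand]; ring
    rw [e, norm_mul, norm_mul, norm_mul]
    have k1 := norm_mixtureKernel_one_le_exp (β := β) (N := N) (z := z) (w := w)
      (by rw [hz]; norm_num) hw.le le_rfl b3
    have k2 := norm_scaled_shiftKernel_le ht b1 b2 (z := w) hw.le (by rw [hw]; norm_num)
    have k3 := norm_scaled_shiftKernel_le ht b1 b2 (z := z) (by rw [hz]; norm_num) hz.ge
    have k4 := norm_crossFactor_le b4 hz hw
    have := kernelBound_nonneg t
    simp only [hD]
    gcongr
  have hcont : ∀ᶠ N : ℕ in atTop, Continuous fun p : ℝ × ℝ =>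
      f N (circleMap 1 (1 / 2) p.1) (circleMap 1 (1 / 4) p.2) := by
    filter_upwards [eventually_norm_shift_bounds ht hM, eventually_ge_atTop 1]
      with N ⟨b1, b2, b3, b4⟩ hN
    obtain ⟨c1, c2⟩ := scaledShift_contours b4
    exact continuous_const.mul (continuous_doubleIntegrand (M N) (scaledShift_ne_one ht hN)
      (by norm_num) (by norm_num) (by norm_num) c1 c2 continuous_const
      (fun _ => by simp [onePolydisc]) continuous_snd continuous_fst)
  refine Tendsto.const_mul _ ?_
  refine tendsto_circleIntegral (by norm_num) (C := 1 / 4 * D) ?_ ?_ ?_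
  · filter_upwards [hcont] with N hN
    refine continuous_const.mul (continuous_circleIntegral
      (f := fun θ z => f N (circleMap 1 (1 / 2) θ) z) hN)
  · filter_upwards [hbound] with N hN w hw
    rw [← smul_eq_mul]
    exact circleIntegral.norm_two_pi_i_inv_smul_integral_le_of_norm_le_const (by norm_num)
      fun z hz => hN w hw z hz
  · intro w hw
    refine Tendsto.const_mul _ ?_
    refine tendsto_circleIntegral (by norm_num) (C := D) ?_ ?_ ?_
    · filter_upwards [hcont] with N hN
      obtain ⟨θ, hθ⟩ : ∃ θ : ℝ, circleMap 1 (1 / 2) θ = w := by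
        have : w ∈ Set.range (circleMap (1 : ℂ) (1 / 2)) := by
          rw [range_circleMap, abs_of_nonneg (by norm_num)]; exact hw
        exact this
      have := hN.comp (Continuous.prodMk (continuous_const (y := θ)) continuous_id)
      simp only [Function.comp_def, hθ, id] at this
      exact this
    · filter_upwards [hbound] with N hN z hz using hN w hw z hz
    · intro z hz
      have hzb : z ∈ Metric.ball (1 : ℂ) 1 := by
        rw [Metric.mem_ball, Metric.mem_sphere.1 hz]; norm_num
      have hwb : w ∈ Metric.ball (1 : ℂ) 1 := by
        rw [Metric.mem_ball, Metric.mem_sphere.1 hw]; norm_num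
      have hz1 : z ≠ 1 := by
        rintro rfl
        rw [Metric.mem_sphere, dist_self] at hz
        norm_num at hz
      have hw1 : w ≠ 1 := by
        rintro rfl
        rw [Metric.mem_sphere, dist_self] at hw
        norm_num at hw
      have h := (((tendsto_mixtureKernel (β := β) ht hM hzb hwb).2.mul
        (tendsto_shiftKernel ht hw1 (ne_zero_of_mem_ball_one hwb))).mul
        (tendsto_crossFactor (t := t) (hsphere w hw z hz))).mul
        (tendsto_shiftKernel ht hz1 (ne_zero_of_mem_ball_one hzb))
      have e2 : Complex.exp (t * (a * weightedMean β z) + t * (a * weightedMean β w)) *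
          (Complex.exp (t * (w / (w - 1))) * ((t : ℂ) * w)⁻¹) * 1 *
          (Complex.exp (t * (z / (z - 1))) * ((t : ℂ) * z)⁻¹) =
          (Complex.exp (t * limitF a B w) * ((t : ℂ) * w)⁻¹) *
          (Complex.exp (t * limitF a B z) * ((t : ℂ) * z)⁻¹) := by
        rw [hB, limitF_map, limitF_map, mul_add, mul_add, Complex.exp_add, Complex.exp_add,
          Complex.exp_add]
        ring
      rw [e2] at h
      refine h.congr fun N => ?_
      simp only [hf, doubleIntegrand]
      ring

/-! ### Circle integrals around an isolated pole -/

/-- The integral of a function with at most a pole at `1` does not depend on the circle around `1`,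
as long as there are no other singularities: the principal part is removed term by term, and
Cauchy's theorem applies to what is left. -/
theorem exists_circleIntegral_eq_of_pole (n : ℕ) : ∀ {f G : ℂ → ℂ}, AnalyticAt ℂ G 1 →
    (∀ᶠ z in 𝓝[≠] (1 : ℂ), f z = (z - 1) ^ (-(n : ℤ)) * G z) →
    ∃ α : ℂ, ∀ (c : ℂ) (R : ℝ), (1 : ℂ) ∈ Metric.ball c R →
      AnalyticOnNhd ℂ f (Metric.closedBall c R \ {1}) → ∮ z in C(c, R), f z = α := by
  have hsphere : ∀ {c : ℂ} {R : ℝ}, (1 : ℂ) ∈ Metric.ball c R → ∀ z ∈ Metric.sphere c R,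
      z ≠ 1 := by
    rintro c R h1 z hz rfl
    rw [Metric.mem_sphere] at hz
    rw [Metric.mem_ball, hz] at h1
    exact lt_irrefl _ h1
  induction n with
  | zero =>
    intro f G hG hf
    refine ⟨0, fun c R h1 hfa => ?_⟩
    have hR : 0 < R := Metric.pos_of_mem_ball h1
    set g := Function.update f 1 (G 1) with hg
    have hga : AnalyticOnNhd ℂ g (Metric.closedBall c R) := by
      intro z hz
      by_cases hz1 : z = 1
      · subst hz1
        refine hG.congr ?_
        rw [eventually_nhdsWithin_iff] at hf
        filter_upwards [hf] with z hz
        by_cases h : z = 1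
        · rw [h, hg, Function.update_self]
        · rw [hg, Function.update_of_ne h, hz h]
          simp
      · refine (hfa z ⟨hz, hz1⟩).congr ?_
        filter_upwards [isOpen_ne.mem_nhds hz1] with w hw
        rw [hg, Function.update_of_ne hw]
    have heq : ∮ z in C(c, R), f z = ∮ z in C(c, R), g z :=
      circleIntegral.integral_congr hR.le fun z hz => by
        rw [hg, Function.update_of_ne (hsphere h1 z hz)]
    rw [heq]
    exact Complex.circleIntegral_eq_zero_of_differentiable_on_off_countable hR.le
      Set.countable_empty hga.continuousOn fun z hz =>
        (hga z (Metric.ball_subset_closedBall hz.1)).differentiableAt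
  | succ n ih =>
    intro f G hG hf
    have hD : AnalyticAt ℂ (dslope G 1) 1 := by
      rw [Complex.analyticAt_iff_eventually_differentiableAt] at hG ⊢
      obtain ⟨s, hs, hso, h1s⟩ := eventually_nhds_iff.1 hG
      filter_upwards [hso.mem_nhds h1s] with z hz
      have := (Complex.differentiableOn_dslope (hso.mem_nhds h1s)).2
        (fun w hw => (hs w hw).differentiableWithinAt)
      exact (this z hz).differentiableAt (hso.mem_nhds hz)
    have hpole : ∀ z : ℂ, z ≠ 1 →
        AnalyticAt ℂ (fun z : ℂ => G 1 * (z - 1) ^ (-((n + 1 : ℕ) : ℤ))) z := by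
      intro z hz
      refine analyticAt_const.mul ?_
      exact AnalyticAt.zpow (analyticAt_id.sub analyticAt_const) (sub_ne_zero.2 hz)
    obtain ⟨α, hα⟩ := ih (f := fun z => f z - G 1 * (z - 1) ^ (-((n + 1 : ℕ) : ℤ))) hD (by
      filter_upwards [hf, self_mem_nhdsWithin] with z hz hz1
      have hz0 : z - 1 ≠ 0 := sub_ne_zero.2 hz1
      rw [hz, dslope_of_ne _ hz1, slope_def_field]
      have e : (z - 1) ^ (-(n : ℤ)) = (z - 1) ^ (-((n + 1 : ℕ) : ℤ)) * (z - 1) := by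
        rw [← zpow_add_one₀ hz0]
        congr 1
        push_cast
        ring
      rw [e]
      field_simp)
    refine ⟨α + G 1 * (if n = 0 then 2 * Real.pi * Complex.I else 0), fun c R h1 hfa => ?_⟩
    have hR : 0 < R := Metric.pos_of_mem_ball h1
    have hp : AnalyticOnNhd ℂ (fun z : ℂ => G 1 * (z - 1) ^ (-((n + 1 : ℕ) : ℤ)))
        (Metric.closedBall c R \ {1}) := fun z hz => hpole z hz.2
    have hsub : Metric.sphere c R ⊆ Metric.closedBall c R \ {1} := fun z hz =>
      ⟨Metric.sphere_subset_closedBall hz, hsphere h1 z hz⟩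
    have h := hα c R h1 (hfa.sub hp)
    rw [circleIntegral.integral_sub ((hfa.continuousOn.mono hsub).circleIntegrable hR.le)
      ((hp.continuousOn.mono hsub).circleIntegrable hR.le), sub_eq_iff_eq_add] at h
    rw [h, circleIntegral.integral_const_mul]
    congr 2
    split_ifs with h0
    · subst h0
      simpa using circleIntegral.integral_sub_inv_of_mem_ball h1
    · exact circleIntegral.integral_sub_zpow_of_ne (by omega) _ _ _

theorem analyticAt_weightedMean {β : Measure (Set.Icc (0 : ℝ) 1)} [IsFiniteMeasure β] {z : ℂ}
    (hz : z ∈ Metric.ball (1 : ℂ) 1) : AnalyticAt ℂ (weightedMean β) z := by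
  have h := differentiableOn_integral_div (β := β) continuous_unitInterval_coe
  have h2 : weightedMean β = fun z => z * ∫ b, ((b : ℝ) : ℂ) / (1 - (b : ℂ) + b * z) ∂β := by
    ext z
    rw [weightedMean, ← integral_const_mul]
    congr 1
    ext b
    ring
  rw [h2]
  exact analyticAt_id.mul (h.analyticAt (Metric.isOpen_ball.mem_nhds hz))

theorem analyticAt_limitF (a : ℝ) {β : Measure (Set.Icc (0 : ℝ) 1)} [IsFiniteMeasure β] {z : ℂ}
    (hz : z ∈ Metric.ball (1 : ℂ) 1) (hz1 : z ≠ 1) :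
    AnalyticAt ℂ (limitF a (β.map Subtype.val)) z := by
  have h : limitF a (β.map Subtype.val) = fun z => z / (z - 1) + a * weightedMean β z := by
    ext z
    exact limitF_map a β z
  rw [h]
  exact (analyticAt_id.div (analyticAt_id.sub analyticAt_const) (sub_ne_zero.2 hz1)).add
    (analyticAt_const.mul (analyticAt_weightedMean hz))

/-- Every admissible circle around `1` may be replaced by the one of radius `1 / 2` about `1`. -/
theorem circleIntegral_limitF_pow (a : ℝ) {β : Measure (Set.Icc (0 : ℝ) 1)} [IsFiniteMeasure β]
    (n : ℕ) {c : ℂ} {R : ℝ} (h1 : (1 : ℂ) ∈ Metric.ball c R)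
    (hf : AnalyticOnNhd ℂ (fun z => z⁻¹ * limitF a (β.map Subtype.val) z ^ n)
      (Metric.closedBall c R \ {1})) :
    ∮ z in C(c, R), z⁻¹ * limitF a (β.map Subtype.val) z ^ n =
      ∮ z in C(1, 1 / 2), z⁻¹ * limitF a (β.map Subtype.val) z ^ n := by
  obtain ⟨α, hα⟩ := exists_circleIntegral_eq_of_pole n
    (f := fun z => z⁻¹ * limitF a (β.map Subtype.val) z ^ n)
    (G := fun z => z⁻¹ * (z + (z - 1) * (a * weightedMean β z)) ^ n) (by
      have := analyticAt_weightedMean (β := β) (z := 1) (by simp)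
      exact (analyticAt_id.inv one_ne_zero).mul ((analyticAt_id.add
        ((analyticAt_id.sub analyticAt_const).mul (analyticAt_const.mul this))).pow n)) (by
      filter_upwards [self_mem_nhdsWithin] with z hz
      have hz0 : z - 1 ≠ 0 := sub_ne_zero.2 hz
      rw [limitF_map, zpow_neg, zpow_natCast, ← inv_pow, mul_left_comm, ← mul_pow]
      congr 2
      field_simp)
  rw [hα c R h1 hf, hα 1 (1 / 2) (by simp)]
  rintro z ⟨hz, hz1⟩
  have hzb : z ∈ Metric.ball (1 : ℂ) 1 := Metric.closedBall_subset_ball (by norm_num) hz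
  exact (analyticAt_id.inv (ne_zero_of_mem_ball_one hzb)).mul
    ((analyticAt_limitF a hzb hz1).pow n)

/-! ### Moments from exponential integrals -/

theorem HasSum.of_eq {f g : ℕ → ℂ} {x y : ℂ} (h : HasSum f x) (hfg : ∀ k, g k = f k) (hxy : y = x) :
    HasSum g y := by
  rw [funext hfg, hxy]
  exact h

/-- Termwise integration of the exponential series. -/
theorem hasSum_integral_exp_mul {X : Type*} [MeasurableSpace X] {ν : Measure X} [IsFiniteMeasure ν]
    {φ ψ : X → ℂ} (hφ : AEStronglyMeasurable φ ν) (hψ : AEStronglyMeasurable ψ ν) {A D : ℝ}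
    (hA : ∀ᵐ x ∂ν, ‖φ x‖ ≤ A) (hD : ∀ᵐ x ∂ν, ‖ψ x‖ ≤ D) (t : ℂ) :
    HasSum (fun k : ℕ => t ^ k * ((∫ x, φ x ^ k * ψ x ∂ν) / k.factorial))
      (∫ x, Complex.exp (t * φ x) * ψ x ∂ν) := by
  have h := hasSum_integral_of_dominated_convergence (μ := ν)
    (F := fun (k : ℕ) x => (t * φ x) ^ k / k.factorial * ψ x)
    (f := fun x => Complex.exp (t * φ x) * ψ x)
    (fun (k : ℕ) _ => (‖t‖ * A) ^ k / k.factorial * D) ?_ ?_ ?_ ?_ ?_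
  · refine h.of_eq (fun k => ?_) rfl
    rw [← mul_div_assoc, ← integral_const_mul, ← integral_div]
    congr 1
    ext x
    ring
  · intro k
    simp_rw [div_eq_mul_inv]
    exact (((hφ.const_mul t).pow k).mul_const _).mul hψ
  · intro k
    filter_upwards [hA, hD] with x h1 h2
    rw [norm_mul, norm_div, norm_pow, norm_mul, Complex.norm_natCast]
    have : 0 ≤ A := (norm_nonneg _).trans h1
    gcongr
  · refine ae_of_all _ fun x => ?_
    exact (Real.summable_pow_div_factorial _).mul_right D
  · exact integrable_const _
  · refine ae_of_all _ fun x => ?_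
    have := NormedSpace.expSeries_div_hasSum_exp (t * φ x)
    rw [← Complex.exp_eq_exp_ℂ] at this
    exact this.mul_right _

theorem hasFPowerSeriesAt_of_hasSum_pow_mul {a : ℕ → ℂ} {g : ℝ → ℂ}
    (ha : ∀ t : ℝ, HasSum (fun k => (t : ℂ) ^ k * a k) (g t))
    (p : FormalMultilinearSeries ℝ ℝ ℂ)
    (hp : ∀ n, p n = ContinuousMultilinearMap.mkPiRing ℝ (Fin n) (a n)) :
    HasFPowerSeriesAt g p 0 := by
  rw [hasFPowerSeriesAt_iff]
  refine Eventually.of_forall fun t => ?_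
  refine (ha t).of_eq (fun k => ?_) (by rw [zero_add])
  have e : p.coeff k = a k := by
    rw [FormalMultilinearSeries.coeff, hp]
    simp
  rw [e, Complex.real_smul]
  push_cast
  rfl

/-- Coefficients of an everywhere convergent power series of a real variable are unique. -/
theorem eq_of_hasSum_pow_mul {a b : ℕ → ℂ} {g : ℝ → ℂ}
    (ha : ∀ t : ℝ, HasSum (fun k => (t : ℂ) ^ k * a k) (g t))
    (hb : ∀ t : ℝ, HasSum (fun k => (t : ℂ) ^ k * b k) (g t)) : a = b := by
  have h := (hasFPowerSeriesAt_of_hasSum_pow_mul ha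
    (fun n => ContinuousMultilinearMap.mkPiRing ℝ (Fin n) (a n)) fun _ =>
      rfl).eq_formalMultilinearSeries (hasFPowerSeriesAt_of_hasSum_pow_mul hb
    (fun n => ContinuousMultilinearMap.mkPiRing ℝ (Fin n) (b n)) fun _ => rfl)
  funext n
  have := congrArg (fun p : FormalMultilinearSeries ℝ ℝ ℂ => p n fun _ => 1) h
  simpa using this

theorem hasSum_circleIntegral_exp_mul {F ψ : ℂ → ℂ} {c : ℂ} {r : ℝ} (hr : 0 ≤ r)
    (hF : ContinuousOn F (Metric.sphere c r)) (hψ : ContinuousOn ψ (Metric.sphere c r)) (t : ℂ) :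
    HasSum (fun k : ℕ => t ^ k * ((∮ z in C(c, r), ψ z * F z ^ k) / k.factorial))
      (∮ z in C(c, r), ψ z * Complex.exp (t * F z)) := by
  have hFc : Continuous fun θ => F (circleMap c r θ) :=
    hF.comp_continuous (continuous_circleMap c r) fun θ => circleMap_mem_sphere c hr θ
  have hψc : Continuous fun θ => ψ (circleMap c r θ) :=
    hψ.comp_continuous (continuous_circleMap c r) fun θ => circleMap_mem_sphere c hr θ
  have hdc : Continuous (deriv (circleMap c r)) := by
    rw [funext (deriv_circleMap c r)]
    fun_prop
  obtain ⟨A, hA⟩ := (isCompact_Icc.image_of_continuousOn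
    (s := Set.Icc 0 (2 * Real.pi)) hFc.continuousOn).isBounded.exists_norm_le
  obtain ⟨D, hD⟩ := (isCompact_Icc.image_of_continuousOn (s := Set.Icc 0 (2 * Real.pi))
    (hdc.mul hψc).continuousOn).isBounded.exists_norm_le
  have h := hasSum_integral_exp_mul (ν := volume.restrict (Set.Icc 0 (2 * Real.pi)))
    hFc.aestronglyMeasurable (hdc.mul hψc).aestronglyMeasurable
    ((ae_restrict_mem measurableSet_Icc).mono fun θ hθ => hA _ ⟨θ, hθ, rfl⟩)
    ((ae_restrict_mem measurableSet_Icc).mono fun θ hθ => hD _ ⟨θ, hθ, rfl⟩) t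
  simp only [circleIntegral_def_Icc, smul_eq_mul]
  refine h.of_eq (fun k => ?_) ?_
  · congr 2
    refine integral_congr_ae (ae_of_all _ fun θ => ?_)
    simp only [Pi.mul_apply]
    ring
  · refine integral_congr_ae (ae_of_all _ fun θ => ?_)
    simp only [Pi.mul_apply]
    ring

/-- If the exponential transform of `μ` is the contour transform, comparing coefficients of powers
of `t` gives the moments of `μ`. -/
theorem moment_eq_of_exp_integral_eq {a : ℝ} {β : Measure (Set.Icc (0 : ℝ) 1)}
    [IsProbabilityMeasure β] {μ : Measure ℝ} [IsFiniteMeasure μ] {A : ℝ}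
    (hμ : ∀ᵐ x ∂μ, |x| ≤ A)
    (h : ∀ t : ℝ, t ≠ 0 → ((∫ x, Real.exp (t * x) ∂μ : ℝ) : ℂ) =
      limitTransform a (β.map Subtype.val) t (1 / 2)) (k : ℕ) :
    ((∫ x, x ^ k ∂μ : ℝ) : ℂ) = 1 / (2 * Real.pi * Complex.I * (k + 1)) *
      ∮ z in C(1, 1 / 2), z⁻¹ * limitF a (β.map Subtype.val) z ^ (k + 1) := by
  set B := β.map Subtype.val with hB
  have hball : ∀ z ∈ Metric.closedBall (1 : ℂ) (1 / 2), z ∈ Metric.ball (1 : ℂ) 1 := fun z hz =>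
    Metric.closedBall_subset_ball (by norm_num) hz
  have hsph : ∀ z ∈ Metric.sphere (1 : ℂ) (1 / 2), z ∈ Metric.ball (1 : ℂ) 1 ∧ z ≠ 1 := by
    intro z hz
    refine ⟨hball z (Metric.sphere_subset_closedBall hz), ?_⟩
    rintro rfl
    rw [Metric.mem_sphere, dist_self] at hz
    norm_num at hz
  have hF : ContinuousOn (limitF a B) (Metric.sphere 1 (1 / 2)) := fun z hz =>
    (analyticAt_limitF a (hsph z hz).1 (hsph z hz).2).continuousAt.continuousWithinAt
  have hinv : ContinuousOn (fun z : ℂ => z⁻¹) (Metric.sphere 1 (1 / 2)) := fun z hz =>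
    (continuousAt_inv₀ (ne_zero_of_mem_ball_one (hsph z hz).1)).continuousWithinAt
  set J : ℕ → ℂ := fun k => ∮ z in C(1, 1 / 2), z⁻¹ * limitF a B z ^ k with hJ
  -- the coefficient of `t ^ 0` vanishes, which matches the factor `t` on the other side
  have hJ0 : J 0 = 0 := by
    simp only [hJ, pow_zero, mul_one]
    refine Complex.circleIntegral_eq_zero_of_differentiable_on_off_countable (by norm_num)
      Set.countable_empty (fun z hz => ?_) fun z hz => ?_
    · exact (continuousAt_inv₀ (ne_zero_of_mem_ball_one (hball z hz))).continuousWithinAt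
    · exact differentiableAt_inv
        (ne_zero_of_mem_ball_one (hball z (Metric.ball_subset_closedBall hz.1)))
  have hright : ∀ t : ℝ, HasSum (fun k : ℕ => (t : ℂ) ^ k *
      ((2 * Real.pi * Complex.I)⁻¹ * (J k / k.factorial)))
      ((2 * Real.pi * Complex.I)⁻¹ * ∮ z in C(1, 1 / 2), z⁻¹ * Complex.exp (t * limitF a B z)) := by
    intro t
    refine ((hasSum_circleIntegral_exp_mul (by norm_num) hF hinv (t : ℂ)).mul_left
      ((2 * Real.pi * Complex.I)⁻¹)).of_eq (fun k => ?_) rfl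
    simp only [hJ]
    ring
  have hleft : ∀ t : ℝ, HasSum (fun k : ℕ => (t : ℂ) ^ k *
      (if k = 0 then 0 else (∫ x, (x : ℂ) ^ (k - 1) ∂μ) / (k - 1).factorial))
      ((2 * Real.pi * Complex.I)⁻¹ * ∮ z in C(1, 1 / 2), z⁻¹ * Complex.exp (t * limitF a B z)) := by
    intro t
    by_cases ht : t = 0
    · subst ht
      have e : (∮ z in C(1, 1 / 2), z⁻¹ * Complex.exp (((0 : ℝ) : ℂ) * limitF a B z)) = 0 := by
        simpa [hJ] using hJ0
      rw [e, mul_zero]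
      refine hasSum_zero.of_eq (fun k => ?_) rfl
      rcases k with _ | k <;> simp
    · have hs := (hasSum_integral_exp_mul (ν := μ) (φ := fun x => (x : ℂ)) (ψ := fun _ => 1)
        (A := A) (D := 1) Complex.continuous_ofReal.aestronglyMeasurable
        aestronglyMeasurable_const (hμ.mono fun x hx => by simpa using hx)
        (ae_of_all _ fun _ => by simp) (t : ℂ)).mul_left (t : ℂ)
      rw [← hasSum_nat_add_iff' 1]
      simp only [Finset.range_one, Finset.sum_singleton, if_true, mul_zero, sub_zero]
      refine hs.of_eq (fun k => ?_) ?_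
      · simp only [Nat.add_eq_zero_iff, one_ne_zero, and_false, if_false, Nat.add_sub_cancel,
          mul_one]
        ring
      · have ht' : (t : ℂ) ≠ 0 := by exact_mod_cast ht
        have e1 : ∫ x, Complex.exp (t * (x : ℂ)) * 1 ∂μ = ((∫ x, Real.exp (t * x) ∂μ : ℝ) : ℂ) := by
          rw [← integral_complex_ofReal]
          congr 1
          ext x
          simp
        have e3 : ∀ z : ℂ, (t : ℂ) * (Complex.exp (t * limitF a B z) * ((t : ℂ) * z)⁻¹) =
            z⁻¹ * Complex.exp (t * limitF a B z) := by
          intro z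
          rw [mul_inv, mul_left_comm, mul_inv_cancel_left₀ ht', mul_comm]
        rw [e1, h t ht, limitTransform, mul_left_comm,
          ← circleIntegral.integral_const_mul (t : ℂ)]
        simp_rw [e3]
  have hk := congrFun (eq_of_hasSum_pow_mul hleft hright) (k + 1)
  simp only [Nat.add_eq_zero_iff, one_ne_zero, and_false, if_false, Nat.add_sub_cancel] at hk
  have hf : (k.factorial : ℂ) ≠ 0 := by exact_mod_cast k.factorial_ne_zero
  have hk1 : (k + 1 : ℂ) ≠ 0 := by exact_mod_cast k.succ_ne_zero
  have hpi : (2 * Real.pi * Complex.I : ℂ) ≠ 0 := Complex.two_pi_I_ne_zero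
  have e2 : ((∫ x, x ^ k ∂μ : ℝ) : ℂ) = ∫ x, (x : ℂ) ^ k ∂μ := by
    rw [← integral_complex_ofReal]
    simp
  rw [e2]
  rw [div_eq_iff hf] at hk
  rw [hk, Nat.factorial_succ]
  push_cast
  simp only [hJ]
  field_simp

/-! ### Exponential means of the empirical measure -/

theorem integral_empiricalMeasure {N : ℕ} (lam : Signature N) (f : ℝ → ℝ) :
    ∫ x, f x ∂lam.empiricalMeasure = (N : ℝ)⁻¹ * ∑ j, f ((lam.coord j : ℝ) / N) := by
  rw [Signature.empiricalMeasure, integral_smul_measure,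
    integral_finsetSum_measure fun i _ => integrable_dirac (by simp)]
  simp [Signature.coord, integral_dirac]

/-- The exponential means of the empirical measure are power sums at `q = e ^ (t / N)`. -/
theorem ofReal_integral_exp_empiricalMeasure {N : ℕ} (lam : Signature N) (t : ℝ) :
    ((∫ x, Real.exp (t * x) ∂lam.empiricalMeasure : ℝ) : ℂ) =
      (N : ℂ)⁻¹ * lam.psum (scaledShift t N) := by
  rw [integral_empiricalMeasure, Signature.psum]
  push_cast
  congr 1
  refine Finset.sum_congr rfl fun j _ => ?_
  rw [scaledShift]
  push_cast
  rw [← Complex.exp_int_mul]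
  congr 1
  ring

section Limit

variable {ρ : ∀ N : ℕ, Measure (Signature N)} [∀ N, IsProbabilityMeasure (ρ N)]
  {β : Measure (Set.Icc (0 : ℝ) 1)} [IsProbabilityMeasure β] {M : ℕ → ℕ} {a : ℝ}

/-- Every function of a random signature is integrable, the law having finite support. -/
theorem integrable_signature {N : ℕ} {ρ : Measure (Signature N)} [IsProbabilityMeasure ρ] {M : ℕ}
    (hN : 1 ≤ N) (hS : HasSchurGeneratingFunction ρ (mixtureSGF (β.map Subtype.val) M))
    (g : Signature N → ℝ) : Integrable g ρ :=
  (integral_eq_sum_of_finite_support (finite_support_map hN hS) g).1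

theorem integrable_of_ae_mem_Icc {μ : Measure ℝ} [IsFiniteMeasure μ] {C : ℝ}
    (hμ : ∀ᵐ x ∂μ, x ∈ Set.Icc 0 C) {f : ℝ → ℝ} (hf : Continuous f) : Integrable f μ := by
  obtain ⟨D, hD⟩ := (isCompact_Icc.image_of_continuousOn
    (s := Set.Icc 0 C) hf.continuousOn).isBounded.exists_norm_le
  exact Integrable.of_bound hf.aestronglyMeasurable D (hμ.mono fun x hx => hD _ ⟨x, hx, rfl⟩)

theorem coord_div_mem_Icc {N : ℕ} {ρ : Measure (Signature N)} [IsProbabilityMeasure ρ] {M : ℕ}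
    (hN : 1 ≤ N) (hS : HasSchurGeneratingFunction ρ (mixtureSGF (β.map Subtype.val) M))
    {C : ℝ} (hC : ((N : ℝ) + M) / N ≤ C) {lam : Signature N} (hl : ρ.real {lam} ≠ 0) (j : Fin N) :
    (lam.coord j : ℝ) / N ∈ Set.Icc 0 C := by
  obtain ⟨h0, h1⟩ := coord_mem_of_mass_ne_zero hN hS hl j
  have h0' : (0 : ℝ) ≤ lam.coord j := by exact_mod_cast h0
  have h1' : (lam.coord j : ℝ) ≤ N + M := by exact_mod_cast h1.le
  refine ⟨by positivity, le_trans ?_ hC⟩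
  gcongr

theorem tendsto_integral_exp_empiricalMeasure
    (hM : Tendsto (fun N => (M N : ℝ) / (N : ℝ)) atTop (𝓝 a))
    (hS : ∀ N : ℕ, 1 ≤ N →
      HasSchurGeneratingFunction (ρ N) (mixtureSGF (β.map Subtype.val) (M N)))
    {t : ℝ} (ht : t ≠ 0) {r : ℝ} (hr4 : 1 / 4 ≤ r) (hr2 : r ≤ 1 / 2) :
    Tendsto (fun N => ((∫ lam, (∫ x, Real.exp (t * x) ∂lam.empiricalMeasure) ∂ρ N : ℝ) : ℂ)) atTop
      (𝓝 (limitTransform a (β.map Subtype.val) t r)) := by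
  refine (tendsto_single_contour ht hM hr4 hr2).congr' ?_
  filter_upwards [eventually_ge_atTop 1] with N hN
  rw [← sum_psum_eq_circleIntegral hN (hS N hN) (scaledShift_ne_zero t N) (scaledShift_ne_one ht hN)
    (by linarith) (by linarith), (integral_eq_sum_of_finite_support (finite_support_map hN (hS N hN))
    _).2, Complex.ofReal_sum, Finset.mul_sum]
  refine Finset.sum_congr rfl fun lam _ => ?_
  rw [smul_eq_mul, Complex.ofReal_mul, ofReal_integral_exp_empiricalMeasure]
  ring

theorem tendsto_integral_exp_empiricalMeasure_sq
    (hM : Tendsto (fun N => (M N : ℝ) / (N : ℝ)) atTop (𝓝 a))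
    (hS : ∀ N : ℕ, 1 ≤ N →
      HasSchurGeneratingFunction (ρ N) (mixtureSGF (β.map Subtype.val) (M N)))
    {t : ℝ} (ht : t ≠ 0) :
    Tendsto (fun N => ((∫ lam, (∫ x, Real.exp (t * x) ∂lam.empiricalMeasure) ^ 2 ∂ρ N : ℝ) : ℂ))
      atTop (𝓝 (limitTransform a (β.map Subtype.val) t (1 / 2) ^ 2)) := by
  -- both circles give the same transform, each being the limit of the same expectations
  have he := tendsto_nhds_unique
    (tendsto_integral_exp_empiricalMeasure hM hS ht (r := 1 / 2) (by norm_num) le_rfl)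
    (tendsto_integral_exp_empiricalMeasure hM hS ht (r := 1 / 4) le_rfl (by norm_num))
  have h := tendsto_double_contour (β := β) ht hM
  rw [← he, ← sq] at h
  refine h.congr' ?_
  filter_upwards [eventually_ge_atTop 1, eventually_norm_shift_bounds ht hM]
    with N hN ⟨_, _, _, hq⟩
  obtain ⟨c1, c2⟩ := scaledShift_contours hq
  rw [← sum_psum_sq_eq_circleIntegral hN (hS N hN) (scaledShift_ne_zero t N)
    (scaledShift_ne_one ht hN) (by norm_num) (by norm_num) (by norm_num) c1 c2,
    (integral_eq_sum_of_finite_support (finite_support_map hN (hS N hN)) _).2, Complex.ofReal_sum,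
    Finset.mul_sum]
  refine Finset.sum_congr rfl fun lam _ => ?_
  rw [smul_eq_mul, Complex.ofReal_mul, Complex.ofReal_pow, ofReal_integral_exp_empiricalMeasure]
  ring

/-- The exponential means of the empirical measures have a limit, in mean square. -/
theorem exists_limit_exp_mean
    (hM : Tendsto (fun N => (M N : ℝ) / (N : ℝ)) atTop (𝓝 a))
    (hS : ∀ N : ℕ, 1 ≤ N →
      HasSchurGeneratingFunction (ρ N) (mixtureSGF (β.map Subtype.val) (M N))) (t : ℝ) :
    ∃ g : ℝ, Tendsto (fun N => ∫ lam, (∫ x, Real.exp (t * x) ∂lam.empiricalMeasure) ∂ρ N) atTop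
        (𝓝 g) ∧
      Tendsto (fun N => ∫ lam, ((∫ x, Real.exp (t * x) ∂lam.empiricalMeasure) - g) ^ 2 ∂ρ N) atTop
        (𝓝 0) ∧
      (t ≠ 0 → (g : ℂ) = limitTransform a (β.map Subtype.val) t (1 / 2)) := by
  by_cases ht : t = 0
  · subst ht
    have h1 : ∀ N : ℕ, 1 ≤ N → ∀ lam : Signature N,
        ∫ x, Real.exp (0 * x) ∂lam.empiricalMeasure = 1 := by
      intro N hN lam
      have : (N : ℝ) ≠ 0 := by positivity
      rw [integral_empiricalMeasure lam (fun x => Real.exp (0 * x))]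
      simp [this]
    refine ⟨1, ?_, ?_, fun h => absurd rfl h⟩
    · refine tendsto_const_nhds.congr' ?_
      filter_upwards [eventually_ge_atTop 1] with N hN
      simp_rw [h1 N hN]
      simp
    · refine tendsto_const_nhds.congr' ?_
      filter_upwards [eventually_ge_atTop 1] with N hN
      simp_rw [h1 N hN]
      simp
  · have l1 := tendsto_integral_exp_empiricalMeasure hM hS ht (r := 1 / 2) (by norm_num) le_rfl
    have l2 := tendsto_integral_exp_empiricalMeasure_sq hM hS ht
    set L := limitTransform a (β.map Subtype.val) t (1 / 2)
    have r1 : Tendsto (fun N => ∫ lam, (∫ x, Real.exp (t * x) ∂lam.empiricalMeasure) ∂ρ N) atTop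
        (𝓝 L.re) := (Complex.continuous_re.tendsto L).comp l1
    have hL : (L.re : ℂ) = L :=
      tendsto_nhds_unique ((Complex.continuous_ofReal.tendsto _).comp r1) l1
    refine ⟨L.re, r1, ?_, fun _ => hL⟩
    have r2 : Tendsto (fun N => ∫ lam, (∫ x, Real.exp (t * x) ∂lam.empiricalMeasure) ^ 2 ∂ρ N) atTop
        (𝓝 (L.re ^ 2)) := by
      rw [← hL, ← Complex.ofReal_pow] at l2
      exact (Complex.continuous_re.tendsto _).comp l2
    have r3 := (r2.sub (r1.const_mul (2 * L.re))).add_const (L.re ^ 2)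
    have e : L.re ^ 2 - 2 * L.re * L.re + L.re ^ 2 = 0 := by ring
    rw [e] at r3
    refine r3.congr' ?_
    filter_upwards [eventually_ge_atTop 1] with N hN
    have hi := integrable_signature hN (hS N hN)
    have hexp : ∀ lam : Signature N, ((∫ x, Real.exp (t * x) ∂lam.empiricalMeasure) - L.re) ^ 2 =
        (∫ x, Real.exp (t * x) ∂lam.empiricalMeasure) ^ 2 -
          2 * L.re * (∫ x, Real.exp (t * x) ∂lam.empiricalMeasure) + L.re ^ 2 := fun lam => by ring
    simp_rw [hexp]
    rw [integral_add (hi _) (hi _), integral_sub (hi _) (hi _), integral_const_mul]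
    simp

/-! ### The limit measure -/

/-- The mean of the empirical measures, as a probability measure on a compact interval. -/
theorem exists_mean_empiricalMeasure {N : ℕ} {ρ : Measure (Signature N)} [IsProbabilityMeasure ρ]
    {M : ℕ} (hN : 1 ≤ N) (hS : HasSchurGeneratingFunction ρ (mixtureSGF (β.map Subtype.val) M))
    {C : ℝ} (hC : ((N : ℝ) + M) / N ≤ C) :
    ∃ ν : ProbabilityMeasure (Set.Icc 0 C), ∀ f : ℝ → ℝ, Continuous f →
      ∫ x, f x ∂(ν : Measure (Set.Icc 0 C)) =
        ∫ lam, (∫ x, f x ∂lam.empiricalMeasure) ∂ρ := by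
  have hN0 : (0 : ℝ) < N := by exact_mod_cast hN
  have hC0 : 0 ≤ C := le_trans (by positivity) hC
  set F := (finite_support_map hN hS).toFinset with hF
  have hpc : Continuous (Set.projIcc 0 C hC0) := continuous_projIcc
  have hemp : ∀ lam : Signature N, IsProbabilityMeasure lam.empiricalMeasure := by
    intro lam
    refine ⟨?_⟩
    rw [Signature.empiricalMeasure]
    simp only [Measure.smul_apply, Measure.finsetSum_apply, measure_univ, Finset.sum_const,
      Finset.card_univ, Fintype.card_fin, nsmul_eq_mul, mul_one, smul_eq_mul]
    exact ENNReal.inv_mul_cancel (by exact_mod_cast hN0.ne') (ENNReal.natCast_ne_top N)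
  have hmap : ∀ lam : Signature N,
      IsProbabilityMeasure (lam.empiricalMeasure.map (Set.projIcc 0 C hC0)) := fun lam =>
    Measure.isProbabilityMeasure_map hpc.measurable.aemeasurable
  have hsum : ∑ lam ∈ F, ρ.real {lam} = 1 := by
    have := (integral_eq_sum_of_finite_support (finite_support_map hN hS) fun _ => (1 : ℝ)).2
    simpa only [integral_const, probReal_univ, smul_eq_mul, mul_one] using this.symm
  set ν : Measure (Set.Icc 0 C) := ∑ lam ∈ F, ENNReal.ofReal (ρ.real {lam}) •
    lam.empiricalMeasure.map (Set.projIcc 0 C hC0) with hν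
  have hνp : IsProbabilityMeasure ν := by
    refine ⟨?_⟩
    rw [hν]
    simp only [Measure.finsetSum_apply, Measure.smul_apply, measure_univ, smul_eq_mul, mul_one]
    rw [← ENNReal.ofReal_sum_of_nonneg fun _ _ => measureReal_nonneg, hsum, ENNReal.ofReal_one]
  refine ⟨⟨ν, hνp⟩, fun f hf => ?_⟩
  have hint : ∀ (κ : Measure (Set.Icc 0 C)) [IsFiniteMeasure κ],
      Integrable (fun x : Set.Icc 0 C => f x) κ := by
    intro κ _
    rw [← integrableOn_univ]
    exact (hf.comp continuous_subtype_val).continuousOn.integrableOn_compact isCompact_univ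
  rw [(integral_eq_sum_of_finite_support (finite_support_map hN hS) _).2, ProbabilityMeasure.coe_mk,
    hν, integral_finsetSum_measure fun lam _ =>
      (hint (lam.empiricalMeasure.map (Set.projIcc 0 C hC0))).smul_measure ENNReal.ofReal_ne_top]
  refine Finset.sum_congr rfl fun lam hl => ?_
  rw [integral_smul_measure, ENNReal.toReal_ofReal measureReal_nonneg,
    integral_map (f := fun x : Set.Icc 0 C => f x) hpc.measurable.aemeasurable
      (hf.comp continuous_subtype_val).aestronglyMeasurable,
    integral_empiricalMeasure lam f,
    integral_empiricalMeasure lam fun x => f (Set.projIcc 0 C hC0 x)]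
  congr 2
  refine Finset.sum_congr rfl fun j _ => ?_
  rw [Set.projIcc_of_mem _ (coord_div_mem_Icc hN hS hC (by simpa using hl) j)]

/-- Compactness of the space of probability measures on a compact space, in terms of integrals. -/
theorem exists_probabilityMeasure_integral_eq {K : Type*} [MetricSpace K] [CompactSpace K]
    [MeasurableSpace K] [BorelSpace K] (ν : ℕ → ProbabilityMeasure K) :
    ∃ μ : ProbabilityMeasure K, ∀ f : K → ℝ, Continuous f → ∀ ℓ : ℝ,
      Tendsto (fun n => ∫ x, f x ∂(ν n : Measure K)) atTop (𝓝 ℓ) → ∫ x, f x ∂(μ : Measure K) = ℓ := by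
  set U : Ultrafilter (ProbabilityMeasure K) := (hyperfilter ℕ).map ν
  refine ⟨U.lim, fun f hf ℓ hℓ => ?_⟩
  have h1 : Tendsto ν (hyperfilter ℕ) (𝓝 U.lim) := U.le_nhds_lim
  have h2 := ProbabilityMeasure.tendsto_iff_forall_integral_tendsto.1 h1
    (BoundedContinuousFunction.mkOfCompact ⟨f, hf⟩)
  exact tendsto_nhds_unique h2 (hℓ.mono_left Nat.hyperfilter_le_atTop)

/-- Weierstrass approximation of `(log y) ^ k`, read in the variable `y = e ^ x`. -/
theorem exists_sum_exp_near_pow (C : ℝ) (k : ℕ) {ε : ℝ} (hε : 0 < ε) :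
    ∃ (n : ℕ) (p : ℕ → ℝ), ∀ x ∈ Set.Icc 0 C,
      |∑ i ∈ Finset.range n, p i * Real.exp ((i : ℝ) * x) - x ^ k| ≤ ε := by
  have hlogc : ContinuousOn (fun y : ℝ => Real.log y ^ k) (Set.Icc 1 (Real.exp C)) := fun y hy =>
    ((Real.continuousAt_log (by linarith [hy.1])).pow k).continuousWithinAt
  obtain ⟨P, hP⟩ := exists_polynomial_near_of_continuousOn 1 (Real.exp C) _ hlogc ε hε
  refine ⟨P.natDegree + 1, P.coeff, fun x hx => ?_⟩
  have := (hP (Real.exp x) ⟨Real.one_le_exp hx.1, Real.exp_le_exp.2 hx.2⟩).le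
  rw [Polynomial.eval_eq_sum_range, Real.log_exp] at this
  simpa only [Real.exp_nat_mul] using this

theorem integral_sum_exp_empiricalMeasure {N : ℕ} (lam : Signature N) (n : ℕ) (p : ℕ → ℝ) :
    ∫ x, (∑ i ∈ Finset.range n, p i * Real.exp ((i : ℝ) * x)) ∂lam.empiricalMeasure =
      ∑ i ∈ Finset.range n, p i * ∫ x, Real.exp ((i : ℝ) * x) ∂lam.empiricalMeasure := by
  rw [integral_empiricalMeasure]
  simp_rw [integral_empiricalMeasure lam fun x => Real.exp (_ * x)]
  rw [Finset.sum_comm, Finset.mul_sum]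
  refine Finset.sum_congr rfl fun i _ => ?_
  rw [← Finset.mul_sum]
  ring

theorem integral_sum_exp {μ : Measure ℝ} [IsFiniteMeasure μ] {C : ℝ}
    (hμ : ∀ᵐ x ∂μ, x ∈ Set.Icc 0 C) (n : ℕ) (p : ℕ → ℝ) :
    ∫ x, (∑ i ∈ Finset.range n, p i * Real.exp ((i : ℝ) * x)) ∂μ =
      ∑ i ∈ Finset.range n, p i * ∫ x, Real.exp ((i : ℝ) * x) ∂μ := by
  rw [integral_finsetSum _ fun i _ => integrable_of_ae_mem_Icc hμ (by fun_prop)]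
  simp_rw [integral_const_mul]

theorem abs_integral_empiricalMeasure_sub_le {N : ℕ} (hN : 1 ≤ N) {lam : Signature N} {f h : ℝ → ℝ}
    {C ε : ℝ} (hlam : ∀ j, (lam.coord j : ℝ) / N ∈ Set.Icc 0 C)
    (hfh : ∀ x ∈ Set.Icc 0 C, |h x - f x| ≤ ε) :
    |∫ x, h x ∂lam.empiricalMeasure - ∫ x, f x ∂lam.empiricalMeasure| ≤ ε := by
  have hN0 : (0 : ℝ) < N := by exact_mod_cast hN
  rw [integral_empiricalMeasure, integral_empiricalMeasure lam f, ← mul_sub,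
    ← Finset.sum_sub_distrib, abs_mul, abs_of_nonneg (by positivity), inv_mul_le_iff₀ hN0]
  refine (Finset.abs_sum_le_sum_abs _ _).trans ?_
  exact (Finset.sum_le_card_nsmul _ _ ε fun j _ => hfh _ (hlam j)).trans (by simp)

/-- Chebyshev's and the Cauchy-Schwarz inequality: deviations of a moment are controlled by the
mean square deviations of finitely many exponential means. -/
theorem measure_moment_dev_le {N : ℕ} {ρ : Measure (Signature N)} [IsProbabilityMeasure ρ] {M : ℕ}
    (hN : 1 ≤ N) (hS : HasSchurGeneratingFunction ρ (mixtureSGF (β.map Subtype.val) M))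
    {C : ℝ} (hC : ((N : ℝ) + M) / N ≤ C) {μ : Measure ℝ} [IsProbabilityMeasure μ]
    (hμ : ∀ᵐ x ∂μ, x ∈ Set.Icc 0 C) {k : ℕ} {ε : ℝ} (hε : 0 < ε) {n : ℕ} {p : ℕ → ℝ}
    (hp : ∀ x ∈ Set.Icc 0 C,
      |∑ i ∈ Finset.range n, p i * Real.exp ((i : ℝ) * x) - x ^ k| ≤ ε / 4) :
    ρ {lam : Signature N | ε ≤ |(∫ x, x ^ k ∂lam.empiricalMeasure) - ∫ x, x ^ k ∂μ|} ≤
      ENNReal.ofReal (((ε / 2) ^ 2)⁻¹ * ((∑ i ∈ Finset.range n, p i ^ 2) *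
        ∑ i ∈ Finset.range n, ∫ lam, ((∫ x, Real.exp ((i : ℝ) * x) ∂lam.empiricalMeasure) -
          ∫ x, Real.exp ((i : ℝ) * x) ∂μ) ^ 2 ∂ρ)) := by
  set h : ℝ → ℝ := fun x => ∑ i ∈ Finset.range n, p i * Real.exp ((i : ℝ) * x) with hh
  have hhc : Continuous h := by simp only [hh]; fun_prop
  have hμnear : |∫ x, h x ∂μ - ∫ x, x ^ k ∂μ| ≤ ε / 4 := by
    rw [← integral_sub (integrable_of_ae_mem_Icc hμ hhc)
      (integrable_of_ae_mem_Icc hμ (continuous_pow k))]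
    have := norm_integral_le_of_norm_le_const (μ := μ) (f := fun x => h x - x ^ k) (C := ε / 4)
      (hμ.mono fun x hx => hp x hx)
    simpa using this
  have hN0 : (0 : ℝ) < N := by exact_mod_cast hN
  have hi := integrable_signature hN hS
  have hae : ∀ᵐ lam ∂ρ, |∫ x, h x ∂lam.empiricalMeasure - ∫ x, x ^ k ∂lam.empiricalMeasure| ≤
      ε / 4 := by
    rw [ae_iff_of_countable]
    intro lam hl
    have hl' : ρ.real {lam} ≠ 0 := by simpa [measureReal_eq_zero_iff] using hl
    exact abs_integral_empiricalMeasure_sub_le hN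
      (fun j => coord_div_mem_Icc hN hS hC hl' j) hp
  set Y : Signature N → ℝ := fun lam => ∑ i ∈ Finset.range n,
    p i * ((∫ x, Real.exp ((i : ℝ) * x) ∂lam.empiricalMeasure) -
      ∫ x, Real.exp ((i : ℝ) * x) ∂μ) with hY
  have hYh : ∀ lam : Signature N, Y lam = ∫ x, h x ∂lam.empiricalMeasure - ∫ x, h x ∂μ := by
    intro lam
    rw [integral_sum_exp_empiricalMeasure, integral_sum_exp hμ, ← Finset.sum_sub_distrib]
    simp only [hY, mul_sub]
  have hsub : ρ {lam : Signature N |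
      ε ≤ |(∫ x, x ^ k ∂lam.empiricalMeasure) - ∫ x, x ^ k ∂μ|} ≤
      ρ {lam | (ε / 2) ^ 2 ≤ Y lam ^ 2} := by
    refine measure_mono_ae ?_
    filter_upwards [hae] with lam h1 h2
    change ε ≤ _ at h2
    change (ε / 2) ^ 2 ≤ Y lam ^ 2
    rw [sq_le_sq, abs_of_pos (by positivity), hYh]
    rw [abs_le] at h1 hμnear
    rw [le_abs] at h2 ⊢
    rcases h2 with h2 | h2
    · left; linarith [h1.1, hμnear.2]
    · right; linarith [h1.2, hμnear.1]
  refine hsub.trans ?_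
  rw [← ofReal_measureReal]
  refine ENNReal.ofReal_le_ofReal ?_
  rw [le_inv_mul_iff₀ (by positivity)]
  refine (mul_meas_ge_le_integral_of_nonneg (ae_of_all _ fun lam => sq_nonneg (Y lam)) (hi _)
    _).trans ?_
  rw [← integral_finsetSum _ fun i _ => hi _, ← integral_const_mul]
  exact integral_mono (hi _) (hi _) fun lam => Finset.sum_mul_sq_le_sq_mul_sq _ _ _

/-- Convergence of exponential means in mean square forces convergence of moments in
probability. -/
theorem tendsto_measure_moment_dev
    (hS : ∀ N : ℕ, 1 ≤ N →
      HasSchurGeneratingFunction (ρ N) (mixtureSGF (β.map Subtype.val) (M N)))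
    {C : ℝ} (hC : ∀ᶠ N : ℕ in atTop, ((N : ℝ) + M N) / N ≤ C)
    {μ : Measure ℝ} [IsProbabilityMeasure μ] (hμ : ∀ᵐ x ∂μ, x ∈ Set.Icc 0 C)
    (hlim : ∀ t : ℝ, Tendsto (fun N => ∫ lam, ((∫ x, Real.exp (t * x) ∂lam.empiricalMeasure) -
      ∫ x, Real.exp (t * x) ∂μ) ^ 2 ∂ρ N) atTop (𝓝 0)) (k : ℕ) {ε : ℝ} (hε : 0 < ε) :
    Tendsto (fun N => ρ N {lam : Signature N |
      ε ≤ |(∫ x, x ^ k ∂lam.empiricalMeasure) - ∫ x, x ^ k ∂μ|}) atTop (𝓝 0) := by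
  obtain ⟨n, p, hp⟩ := exists_sum_exp_near_pow C k (ε := ε / 4) (by positivity)
  have hz := ENNReal.tendsto_ofReal (((tendsto_finsetSum (Finset.range n) fun i _ =>
    hlim i).const_mul (∑ i ∈ Finset.range n, p i ^ 2)).const_mul ((ε / 2) ^ 2)⁻¹)
  simp only [Finset.sum_const_zero, mul_zero, ENNReal.ofReal_zero] at hz
  refine tendsto_of_tendsto_of_tendsto_of_le_of_le' tendsto_const_nhds hz
    (Eventually.of_forall fun _ => zero_le) ?_
  filter_upwards [eventually_ge_atTop 1, hC] with N hN hCN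
  exact measure_moment_dev_le hN (hS N hN) hCN hμ hε hp

/-- The limit measure exists, is carried by a bounded interval, and its exponential transform is
the limit of the exponential means. -/
theorem exists_limit_measure
    (hM : Tendsto (fun N => (M N : ℝ) / (N : ℝ)) atTop (𝓝 a))
    (hS : ∀ N : ℕ, 1 ≤ N →
      HasSchurGeneratingFunction (ρ N) (mixtureSGF (β.map Subtype.val) (M N))) :
    ∃ (μ : Measure ℝ) (C : ℝ), IsProbabilityMeasure μ ∧ (∀ᵐ x ∂μ, x ∈ Set.Icc 0 C) ∧
      (∀ᶠ N : ℕ in atTop, ((N : ℝ) + M N) / N ≤ C) ∧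
      (∀ t : ℝ, Tendsto (fun N => ∫ lam, ((∫ x, Real.exp (t * x) ∂lam.empiricalMeasure) -
        ∫ x, Real.exp (t * x) ∂μ) ^ 2 ∂ρ N) atTop (𝓝 0)) ∧
      ∀ t : ℝ, t ≠ 0 → ((∫ x, Real.exp (t * x) ∂μ : ℝ) : ℂ) =
        limitTransform a (β.map Subtype.val) t (1 / 2) := by
  have ha : 0 ≤ a := ge_of_tendsto' hM fun N => by positivity
  -- the coordinates `l_j / N` are at most `(N + M_N) / N → a + 1`
  set C := a + 2 with hCdef
  have hC : ∀ᶠ N : ℕ in atTop, ((N : ℝ) + M N) / N ≤ C := by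
    filter_upwards [hM.eventually_lt_const (lt_add_one a), eventually_ge_atTop 1] with N h1 hN
    have hN0 : (N : ℝ) ≠ 0 := by positivity
    rw [add_div, div_self hN0]
    linarith
  have : Nonempty (Set.Icc 0 C) := ⟨⟨0, le_rfl, by linarith⟩⟩
  have hν : ∀ N : ℕ, ∃ ν : ProbabilityMeasure (Set.Icc 0 C), 1 ≤ N → ((N : ℝ) + M N) / N ≤ C →
      ∀ f : ℝ → ℝ, Continuous f → ∫ x, f x ∂(ν : Measure (Set.Icc 0 C)) =
        ∫ lam, (∫ x, f x ∂lam.empiricalMeasure) ∂ρ N := by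
    intro N
    by_cases h : 1 ≤ N ∧ ((N : ℝ) + M N) / N ≤ C
    · obtain ⟨ν, hν⟩ := exists_mean_empiricalMeasure h.1 (hS N h.1) h.2
      exact ⟨ν, fun _ _ => hν⟩
    · exact ⟨⟨Measure.dirac (Classical.arbitrary _), inferInstance⟩, fun h1 h2 => absurd ⟨h1, h2⟩ h⟩
  choose ν hν using hν
  obtain ⟨κ, hκ⟩ := exists_probabilityMeasure_integral_eq ν
  have hval : MeasurableEmbedding (Subtype.val : Set.Icc 0 C → ℝ) :=
    MeasurableEmbedding.subtype_coe measurableSet_Icc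
  choose g hg1 hg2 hg3 using fun t => exists_limit_exp_mean hM hS t
  have hexp : ∀ t : ℝ, ∫ x, Real.exp (t * x) ∂((κ : Measure (Set.Icc 0 C)).map Subtype.val) =
      g t := by
    intro t
    rw [hval.integral_map]
    refine hκ (fun x : Set.Icc 0 C => Real.exp (t * x)) (by fun_prop) (g t) ?_
    refine (hg1 t).congr' ?_
    filter_upwards [eventually_ge_atTop 1, hC] with N hN hCN
    exact (hν N hN hCN (fun x => Real.exp (t * x)) (by fun_prop)).symm
  refine ⟨(κ : Measure (Set.Icc 0 C)).map Subtype.val, C,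
    Measure.isProbabilityMeasure_map hval.measurable.aemeasurable, ?_, hC, fun t => ?_,
    fun t ht => ?_⟩
  · rw [hval.ae_map_iff]
    exact ae_of_all _ fun x => x.2
  · rw [hexp]
    exact hg2 t
  · rw [hexp]
    exact hg3 t ht

end Limit

/-! ### The limit theorem -/

theorem mainTheorem4
    (ρ : ∀ N : ℕ, Measure (Signature N)) [∀ N, IsProbabilityMeasure (ρ N)]
    (M : ℕ → ℕ) (a : ℝ) (ha : 0 < a)
    (hM : Tendsto (fun N => (M N : ℝ) / (N : ℝ)) atTop (𝓝 a))
    (B : Measure ℝ) [IsProbabilityMeasure B]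
    (hB : ∀ k : ℕ, Integrable (fun b : ℝ => b ^ k) B)
    (hS : ∀ N : ℕ, 1 ≤ N → HasSchurGeneratingFunction (ρ N)
      (fun x => (∫ b, ∏ i, (1 - (b : ℂ) + x i * (b : ℂ)) ∂B) ^ M N)) :
    (∀ z : ℂ, ‖z - 1‖ < 1 →
      Integrable (fun b : ℝ => (b : ℂ) / (1 - b + b * z)) B ∧
      (z ≠ 1 → AnalyticAt ℂ (limitF a B) z)) ∧
    ∃ μ : Measure ℝ, IsProbabilityMeasure μ ∧
      EmpiricalTendstoInMoments ρ μ ∧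
      ∀ k : ℕ, 1 ≤ k → ∀ (c : ℂ) (R : ℝ),
        (1 : ℂ) ∈ Metric.ball c R →
        AnalyticOnNhd ℂ (fun z => z⁻¹ * limitF a B z ^ (k + 1)) (Metric.closedBall c R \ {1}) →
        ((∫ x, x ^ k ∂μ : ℝ) : ℂ) =
          1 / (2 * Real.pi * Complex.I * (k + 1)) *
            ∮ z in C(c, R), z⁻¹ * limitF a B z ^ (k + 1) := by
  have hM1 : ∀ᶠ N in atTop, 1 ≤ M N := by
    filter_upwards [hM.eventually_const_lt ha] with N hN
    rcases Nat.eq_zero_or_pos (M N) with h | h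
    · simp [h] at hN
    · exact h
  have hval : MeasurableEmbedding (Subtype.val : Set.Icc (0 : ℝ) 1 → ℝ) :=
    MeasurableEmbedding.subtype_coe measurableSet_Icc
  -- `B` is carried by `[0, 1]`, so it is replaced by a measure on that compact space.
  obtain ⟨β, hβ, rfl⟩ : ∃ β : Measure (Set.Icc (0 : ℝ) 1), IsProbabilityMeasure β ∧
      B = β.map Subtype.val := by
    have hB01 := ae_mem_Icc_of_schurGeneratingFunction ρ M hM1 B hB hS
    set β : Measure (Set.Icc (0 : ℝ) 1) := B.comap Subtype.val with hβ
    have hBmap : β.map Subtype.val = B := by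
      rw [hβ, hval.map_comap, Subtype.range_coe]
      exact Measure.restrict_eq_self_of_ae_mem hB01
    refine ⟨β, ⟨?_⟩, hBmap.symm⟩
    have h1 : β.map Subtype.val Set.univ = 1 := by
      rw [hBmap, measure_univ]
    rwa [hval.map_apply, Set.preimage_univ] at h1
  refine ⟨fun z hz => ?_, ?_⟩
  · have hz' : z ∈ Metric.ball (1 : ℂ) 1 := by rwa [mem_ball_iff_norm]
    refine ⟨?_, analyticAt_limitF a hz'⟩
    rw [hval.integrable_map_iff]
    exact integrable_of_continuous_unitInterval
      (continuous_div_affine continuous_unitInterval_coe hz')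
  · obtain ⟨μ, C, hμp, hμ, hC, hlim, hexp⟩ := exists_limit_measure hM hS
    refine ⟨μ, hμp, ⟨fun k => integrable_of_ae_mem_Icc hμ (continuous_pow k),
      fun k ε hε => tendsto_measure_moment_dev hS hC hμ hlim k hε⟩, fun k _ c R h1 hf => ?_⟩
    rw [circleIntegral_limitF_pow a (k + 1) h1 hf]
    exact moment_eq_of_exp_integral_eq (A := C)
      (hμ.mono fun x hx => by rw [abs_of_nonneg hx.1]; exact hx.2) hexp k
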